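/- **Setting.** Let $n\ge 1$ and $p\in[0,1]$. Let $D^2=D([0,1],\mathbb R^2)$ be the space of càdlàg functions $w:[0,1]\to\mathbb R^2$ with norm $\|w\|=\sup_{t\in[0,1]}|w(t)|$, where $|\cdot|$ is the Euclidean norm. *Test functionals.* For a bilinear form $B$ on $D^2$ put $\|B\|=\sup_{\|h\|=1}|B[h,h]|$. Let $M$ be the set of continuous, twice Fréchet differentiable $g:D^2\to\mathbb R$ with $\sup_w\frac{|g(w)|}{1+\|w\|^3}<\infty$ such that, for some constant $k_g$, $\|D^2g(w+h)-D^2g(w)\|\le k_g\|h\|$ for all $w,h\in D^2$. Let $M^2$ be the set of $g\in M$ for which $$\|g\|_{M^2}=\sup_{w}\frac{|g(w)|}{1+\|w\|^3}+\sup_{w}\frac{\|Dg(w)\|}{1+\|w\|}+\sup_{w}\frac{\|D^2g(w)\|}{1+\|w\|}+\sup_{w,\,h\ne0}\frac{\|D^2g(w+h)-D^2g(w)\|}{\|h\|}<\infty .$$ *The graph process.* Let $I_{i,j}=I_{j,i}$ be the indicator that $\{i,j\}$ is an edge of the random graph $G(n,p)$ on $\{1,\dots,n\}$ ($I_{i,i}=0$,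 and the $I_{i,j}$, $i<j$, are independent Bernoulli($p$)). For $t\in[0,1]$ let $$\mathbf T_n(t)=\frac{\lfloor nt\rfloor-2}{2n^2}\sum_{i,j=1}^{\lfloor nt\rfloor}I_{i,j},\qquad \mathbf V_n(t)=\frac1{2n^2}\sum_{\substack{1\le i,j,k\le\lfloor nt\rfloor\\ i,j,k\text{ distinct}}}I_{i,j}I_{j,k},$$ and $\mathbf Y_n(t)=(\mathbf T_n(t)-\mathbb E\mathbf T_n(t),\ \mathbf V_n(t)-\mathbb E\mathbf V_n(t))$. *The pre-limiting process.* $\mathbf D_n=(\mathbf D_n^{(1)},\mathbf D_n^{(2)})$ is a centred Gaussian process with paths in $D^2$ that depend on $t$ only through $\lfloor nt\rfloor$. Its covariance function is the one obtained by bilinear expansion from $$\mathbf D_n^{(1)}(t)=(\lfloor nt\rfloor-2)\sum_{i,j=1}^{\lfloor nt\rfloor}Z^{(1)}_{i,j},\qquad \mathbf D_n^{(2)}(t)=(\lfloor nt\rfloor-2)\sum_{i,j=1}^{\lfloor nt\rfloor}Z^{(2,1)}_{i,j}+\sum_{i,j,k=1}^{\lfloor nt\rfloor}Z^{(2,2)}_{i,j,k}$$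 with the following table of covariances (for distinct $i,j,k$, and distinct $i,j,k'$ in the last line), all others being $0$: $$\begin{aligned} &\mathbb E\,Z^{(1)}_{i,j}Z^{(1)}_{i,j}=\tfrac{p(1-p)}{2n^4},\qquad \mathbb E\,Z^{(1)}_{i,j}Z^{(2,1)}_{i,j}=\tfrac{p^2(1-p)}{4n^4},\qquad \mathbb E\,Z^{(2,1)}_{i,j}Z^{(2,1)}_{i,j}=\tfrac1{n^5},\\ &\mathbb E\,Z^{(2,2)}_{i,j,k}Z^{(1)}_{i,j}=\tfrac{3p^2(1-p)}{4n^4},\qquad \mathbb E\,Z^{(2,2)}_{i,j,k}Z^{(2,1)}_{i,j}=\tfrac{p^3(1-p)}{2n^4},\\ &\mathbb E\,Z^{(2,2)}_{i,j,k}Z^{(2,2)}_{i,j,k}=\tfrac{p^2(1-p^2)}{2n^4},\qquad \mathbb E\,Z^{(2,2)}_{i,j,k}Z^{(2,2)}_{i,j,k'}=\tfrac{p^3(1-p)}{n^4}\quad(k\ne k'). \end{aligned}$$ The table is used only as a formal device for writing down the covariance function of $\mathbf D_n$; it is not claimed that Gaussian variables $Z$ with these covariances exist. Explicitly, with $a=\lfloor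 ns\rfloor$, $b=\lfloor nt\rfloor$, $m=\min(a,b)$, $$\begin{aligned} \mathbb E\,\mathbf D_n^{(1)}(s)\mathbf D_n^{(1)}(t)&=(a-2)(b-2)\,m(m-1)\,\tfrac{p(1-p)}{2n^4},\qquad \mathbb E\,\mathbf D_n^{(1)}(s)\mathbf D_n^{(2)}(t)=(a-2)(b-2)\,m(m-1)\,\tfrac{p^2(1-p)}{n^4},\\ \mathbb E\,\mathbf D_n^{(2)}(s)\mathbf D_n^{(2)}(t)&=(a-2)(b-2)\,m(m-1)\Big(\tfrac{2p^3(1-p)}{n^4}+\tfrac1{n^5}\Big)+m(m-1)(m-2)\,\tfrac{p^2(1-p)^2}{2n^4}. \end{aligned}$$ **Theorem.** Such a process $\mathbf D_n$ exists, and for every such process and every $g\in M^2$ the random variables $g(\mathbf Y_n)$ and $g(\mathbf D_n)$ are integrable and $$\left|\mathbb E g(\mathbf Y_n)-\mathbb E g(\mathbf D_n)\right|\le \frac{12\,\|g\|_{M^2}}{n}.$$ -/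

import Mathlib

open MeasureTheory ProbabilityTheory Filter Topology unitInterval

noncomputable section

/-! ### The space `D([0,1], ℝ^d)` with the uniform norm -/

/-- A function on `[0,1]` is càdlàg if it is right-continuous and has left limits. -/
def IsCadlag {d : ℕ} (f : I → EuclideanSpace ℝ (Fin d)) : Prop :=
  ∀ t, ContinuousWithinAt f (Set.Ici t) t ∧ ∃ l, Tendsto f (𝓝[<] t) (𝓝 l)

/-- A càdlàg function on `[0,1]` is bounded. -/
theorem IsCadlag.memLp {d : ℕ} {f : I → EuclideanSpace ℝ (Fin d)} (hf : IsCadlag f) :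
    Memℓp f ⊤ := by
  refine memℓp_infty ?_
  have key : ∃ C : ℝ, ∀ t ∈ (Set.univ : Set I), ‖f t‖ ≤ C := by
    refine isCompact_univ.induction_on (p := fun s => ∃ C : ℝ, ∀ t ∈ s, ‖f t‖ ≤ C)
      ⟨0, by simp⟩ ?_ ?_ ?_
    · rintro s t hst ⟨C, hC⟩
      exact ⟨C, fun x hx => hC x (hst hx)⟩
    · rintro s t ⟨C, hC⟩ ⟨C', hC'⟩
      refine ⟨max C C', ?_⟩
      rintro x (hx | hx)
      · exact (hC x hx).trans (le_max_left _ _)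
      · exact (hC' x hx).trans (le_max_right _ _)
    · intro t _
      obtain ⟨h1, l, h2⟩ := hf t
      have e1 : ∀ᶠ x in 𝓝[≥] t, ‖f x‖ ≤ ‖f t‖ + 1 :=
        (h1.norm.eventually (gt_mem_nhds (lt_add_one _))).mono fun _ h => le_of_lt h
      have e2 : ∀ᶠ x in 𝓝[<] t, ‖f x‖ ≤ ‖l‖ + 1 :=
        (h2.norm.eventually (gt_mem_nhds (lt_add_one _))).mono fun _ h => le_of_lt h
      have e3 : ∀ᶠ x in 𝓝 t, ‖f x‖ ≤ max (‖f t‖ + 1) (‖l‖ + 1) := by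
        rw [← nhdsLT_sup_nhdsGE, eventually_sup]
        exact ⟨e2.mono fun _ h => h.trans (le_max_right _ _),
          e1.mono fun _ h => h.trans (le_max_left _ _)⟩
      exact ⟨_, mem_nhdsWithin_of_mem_nhds e3, _, fun x hx => hx⟩
  obtain ⟨C, hC⟩ := key
  refine ⟨C, ?_⟩
  rintro _ ⟨t, rfl⟩
  exact hC t trivial

/-- `D([0,1], ℝ^d)`: the càdlàg functions, normed by `‖w‖ = sup_t |w(t)|` with `|·|` Euclidean
(the norm of `lp _ ⊤`). All càdlàg functions are bounded, so none is lost; see `ofCadlag`. -/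
def skorokhodSubmodule (d : ℕ) : Submodule ℝ (lp (fun _ : I => EuclideanSpace ℝ (Fin d)) ⊤) where
  carrier := {w | IsCadlag (fun t => w t)}
  zero_mem' := fun t => ⟨continuousWithinAt_const, 0, tendsto_const_nhds⟩
  add_mem' := by
    intro a b ha hb t
    obtain ⟨h1, l, h2⟩ := ha t
    obtain ⟨h3, m, h4⟩ := hb t
    exact ⟨h1.add h3, l + m, h2.add h4⟩
  smul_mem' := by
    intro c a ha t
    obtain ⟨h1, l, h2⟩ := ha t
    exact ⟨h1.const_smul c, c • l, h2.const_smul c⟩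

abbrev SkorokhodD (d : ℕ) : Type := skorokhodSubmodule d

/-- A càdlàg function as an element of `D([0,1], ℝ^d)`. -/
def ofCadlag {d : ℕ} (f : I → EuclideanSpace ℝ (Fin d)) (hf : IsCadlag f) : SkorokhodD d :=
  ⟨⟨f, hf.memLp⟩, hf⟩

/-! ### The class `M²` of test functionals -/

/-- The second Fréchet derivative, as a bilinear form. -/
def D2 {d : ℕ} (g : SkorokhodD d → ℝ) (w : SkorokhodD d) :
    SkorokhodD d →L[ℝ] SkorokhodD d →L[ℝ] ℝ :=
  fderiv ℝ (fderiv ℝ g) w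

/-- The norm `sup {|B[h,h]| : ‖h‖ = 1}` of a bilinear form. -/
def formNorm {d : ℕ} (B : SkorokhodD d →L[ℝ] SkorokhodD d →L[ℝ] ℝ) : ℝ :=
  ⨆ h : {h : SkorokhodD d // ‖h‖ = 1}, |B h.1 h.1|

/-- The class `M`: continuous functionals of at most cubic growth, twice Fréchet differentiable,
with Lipschitz second derivative. -/
structure MemM {d : ℕ} (g : SkorokhodD d → ℝ) : Prop where
  continuous : Continuous g
  growth : BddAbove (Set.range fun w => |g w| / (1 + ‖w‖ ^ 3))
  differentiable : Differentiable ℝ g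
  twice_differentiable : Differentiable ℝ (fderiv ℝ g)
  lipschitz : ∃ k : ℝ, ∀ w h : SkorokhodD d, formNorm (D2 g (w + h) - D2 g w) ≤ k * ‖h‖

/-- The class `M²`: those `g ∈ M` for which all four suprema in `normM2 g` are finite. -/
structure MemM2 {d : ℕ} (g : SkorokhodD d → ℝ) : Prop where
  memM : MemM g
  bdd_zero : BddAbove (Set.range fun w => |g w| / (1 + ‖w‖ ^ 3))
  bdd_one : BddAbove (Set.range fun w => ‖fderiv ℝ g w‖ / (1 + ‖w‖))
  bdd_two : BddAbove (Set.range fun w => formNorm (D2 g w) / (1 + ‖w‖))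
  bdd_lip : BddAbove (Set.range fun x : SkorokhodD d × SkorokhodD d =>
    formNorm (D2 g (x.1 + x.2) - D2 g x.1) / ‖x.2‖)

/-- `‖g‖_{M²}` (the pairs with increment `0` contribute `0` to the last supremum). -/
def normM2 {d : ℕ} (g : SkorokhodD d → ℝ) : ℝ :=
  (⨆ w, |g w| / (1 + ‖w‖ ^ 3)) + (⨆ w, ‖fderiv ℝ g w‖ / (1 + ‖w‖)) +
    (⨆ w, formNorm (D2 g w) / (1 + ‖w‖)) +
    ⨆ x : SkorokhodD d × SkorokhodD d, formNorm (D2 g (x.1 + x.2) - D2 g x.1) / ‖x.2‖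

/-! ### The graph process -/

/-- The first `m` vertices; the vertex `i` in `{1, …, n}` is represented by `i - 1 : Fin n`. -/
def firstVertices (n m : ℕ) : Finset (Fin n) := Finset.univ.filter fun i => i.val < m

/-- The number `⌊n t⌋` of vertices revealed at time `t`. -/
def revealed (n : ℕ) (t : I) : ℕ := ⌊(n : ℝ) * (t : ℝ)⌋₊

open Classical in
/-- `I_{i,j}`, the indicator of the edge `{i, j}`. -/
def edgeInd {n : ℕ} (G : SimpleGraph (Fin n)) (i j : Fin n) : ℝ := if G.Adj i j then 1 else 0

/-- The rescaled number of edges among the first `m` vertices. -/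
def edgeStat (n m : ℕ) (G : SimpleGraph (Fin n)) : ℝ :=
  ((m : ℝ) - 2) / (2 * (n : ℝ) ^ 2) *
    ∑ i ∈ firstVertices n m, ∑ j ∈ firstVertices n m, edgeInd G i j

/-- The rescaled number of two-stars among the first `m` vertices. -/
def twoStarStat (n m : ℕ) (G : SimpleGraph (Fin n)) : ℝ :=
  1 / (2 * (n : ℝ) ^ 2) *
    ∑ i ∈ firstVertices n m, ∑ j ∈ firstVertices n m, ∑ k ∈ firstVertices n m,
      if i ≠ j ∧ j ≠ k ∧ i ≠ k then edgeInd G i j * edgeInd G j k else 0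

/-- Functions of `⌊n t⌋` are càdlàg. -/
theorem isCadlag_revealed {d : ℕ} (n : ℕ) (a : ℕ → EuclideanSpace ℝ (Fin d)) :
    IsCadlag (fun t : I => a (revealed n t)) := by
  rcases Nat.eq_zero_or_pos n with rfl | hn
  · simp only [revealed, Nat.cast_zero, zero_mul]
    exact fun t => ⟨continuousWithinAt_const, _, tendsto_const_nhds⟩
  have hn' : (0 : ℝ) < n := by exact_mod_cast hn
  have hc : Continuous fun s : I => (n : ℝ) * (s : ℝ) := by fun_prop
  intro t
  constructor
  · have h1 : Tendsto (fun s : I => (n : ℝ) * (s : ℝ)) (𝓝[≥] t) (𝓝[≥] ((n : ℝ) * (t : ℝ))) := by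
      refine tendsto_nhdsWithin_iff.2 ⟨(hc.tendsto t).mono_left nhdsWithin_le_nhds, ?_⟩
      filter_upwards [self_mem_nhdsWithin] with s hs
      exact mul_le_mul_of_nonneg_left hs hn'.le
    have h2 := (tendsto_floor_right_pure_floor ((n : ℝ) * (t : ℝ))).comp h1
    rw [tendsto_pure] at h2
    refine ContinuousWithinAt.congr_of_eventuallyEq (f := fun _ => a (revealed n t))
      continuousWithinAt_const ?_ rfl
    filter_upwards [h2] with s hs
    simp only [revealed, ← Int.floor_toNat]
    simp only [Function.comp] at hs
    rw [hs]
  · have h1 : Tendsto (fun s : I => (n : ℝ) * (s : ℝ)) (𝓝[<] t) (𝓝[<] ((n : ℝ) * (t : ℝ))) := by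
      refine tendsto_nhdsWithin_iff.2 ⟨(hc.tendsto t).mono_left nhdsWithin_le_nhds, ?_⟩
      filter_upwards [self_mem_nhdsWithin] with s hs
      exact mul_lt_mul_of_pos_left hs hn'
    have h2 := (tendsto_floor_left_pure_ceil_sub_one ((n : ℝ) * (t : ℝ))).comp h1
    rw [tendsto_pure] at h2
    refine ⟨a (⌈(n : ℝ) * (t : ℝ)⌉ - 1).toNat, tendsto_const_nhds.congr' ?_⟩
    filter_upwards [h2] with s hs
    simp only [revealed, ← Int.floor_toNat]
    simp only [Function.comp] at hs
    rw [hs]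

/-- The path `t ↦ (T_n(t) - 𝔼 T_n(t), V_n(t) - 𝔼 V_n(t))` of a random graph `G`. -/
def graphProcess {Ω : Type*} [MeasurableSpace Ω] (P : Measure Ω) {n : ℕ}
    (G : Ω → SimpleGraph (Fin n)) (ω : Ω) : SkorokhodD 2 :=
  ofCadlag _ (isCadlag_revealed n fun m =>
    !₂[edgeStat n m (G ω) - ∫ η, edgeStat n m (G η) ∂P,
      twoStarStat n m (G ω) - ∫ η, twoStarStat n m (G η) ∂P])

/-! ### The pre-limiting Gaussian process

With `m = ⌊n t⌋` and all indices running through the first `m` vertices, the process is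
`D¹(t) = (m - 2) ∑_{i,j} Z¹_{i,j}` and
`D²(t) = (m - 2) ∑_{i,j} Z²¹_{i,j} + ∑_{i,j,k} Z²²_{i,j,k}`, the summands being centred with the
following covariances. -/

/-- Covariance of `Z¹_{i,j}` and `Z¹_{k,l}`. -/
def cov1_1 (n : ℕ) (p : ℝ) (i j k l : Fin n) : ℝ :=
  if i = k ∧ j = l ∧ i ≠ j then p * (1 - p) / (2 * (n : ℝ) ^ 4) else 0

/-- Covariance of `Z¹_{i,j}` and `Z²¹_{k,l}`. -/
def cov1_21 (n : ℕ) (p : ℝ) (i j k l : Fin n) : ℝ :=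
  if i = k ∧ j = l ∧ i ≠ j then p ^ 2 * (1 - p) / (4 * (n : ℝ) ^ 4) else 0

/-- Covariance of `Z²²_{i,j,k}` and `Z¹_{l,m}`. -/
def cov22_1 (n : ℕ) (p : ℝ) (i j k l m : Fin n) : ℝ :=
  if i = l ∧ j = m ∧ i ≠ j ∧ j ≠ k ∧ k ≠ i then 3 * p ^ 2 * (1 - p) / (4 * (n : ℝ) ^ 4) else 0

/-- Covariance of `Z²²_{i,j,k}` and `Z²¹_{l,m}`. -/
def cov22_21 (n : ℕ) (p : ℝ) (i j k l m : Fin n) : ℝ :=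
  if i = l ∧ j = m ∧ i ≠ j ∧ j ≠ k ∧ k ≠ i then p ^ 3 * (1 - p) / (2 * (n : ℝ) ^ 4) else 0

/-- Covariance of `Z²²_{i,j,k}` and `Z²²_{r,s,t}`. -/
def cov22_22 (n : ℕ) (p : ℝ) (i j k r s t : Fin n) : ℝ :=
  if i = r ∧ j = s ∧ k = t ∧ i ≠ j ∧ j ≠ k ∧ k ≠ i then
    p ^ 2 * (1 - p ^ 2) / (2 * (n : ℝ) ^ 4)
  else if i = r ∧ j = s ∧ k ≠ t ∧ (i ≠ j ∧ j ≠ k ∧ k ≠ i) ∧ (i ≠ j ∧ j ≠ t ∧ t ≠ i) then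
    p ^ 3 * (1 - p) / (n : ℝ) ^ 4
  else 0

/-- Covariance of `Z²¹_{i,j}` and `Z²¹_{k,l}`. -/
def cov21_21 (n : ℕ) (i j k l : Fin n) : ℝ :=
  if i = k ∧ j = l ∧ i ≠ j then 1 / (n : ℝ) ^ 5 else 0

/-- Covariance of `D¹(s)` and `D¹(t)`, where `a = ⌊n s⌋` and `b = ⌊n t⌋`. -/
def covD11 (n : ℕ) (p : ℝ) (a b : ℕ) : ℝ :=
  ((a : ℝ) - 2) * ((b : ℝ) - 2) *
    ∑ i ∈ firstVertices n a, ∑ j ∈ firstVertices n a,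
      ∑ k ∈ firstVertices n b, ∑ l ∈ firstVertices n b, cov1_1 n p i j k l

/-- Covariance of `D¹(s)` and `D²(t)`, where `a = ⌊n s⌋` and `b = ⌊n t⌋`. -/
def covD12 (n : ℕ) (p : ℝ) (a b : ℕ) : ℝ :=
  ((a : ℝ) - 2) * ((b : ℝ) - 2) *
    (∑ i ∈ firstVertices n a, ∑ j ∈ firstVertices n a,
      ∑ k ∈ firstVertices n b, ∑ l ∈ firstVertices n b, cov1_21 n p i j k l) +
  ((a : ℝ) - 2) *
    ∑ l ∈ firstVertices n a, ∑ m ∈ firstVertices n a,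
      ∑ i ∈ firstVertices n b, ∑ j ∈ firstVertices n b, ∑ k ∈ firstVertices n b,
        cov22_1 n p i j k l m

/-- Covariance of `D²(s)` and `D²(t)`, where `a = ⌊n s⌋` and `b = ⌊n t⌋`. -/
def covD22 (n : ℕ) (p : ℝ) (a b : ℕ) : ℝ :=
  ((a : ℝ) - 2) * ((b : ℝ) - 2) *
    (∑ i ∈ firstVertices n a, ∑ j ∈ firstVertices n a,
      ∑ k ∈ firstVertices n b, ∑ l ∈ firstVertices n b, cov21_21 n i j k l) +
  ((a : ℝ) - 2) *
    (∑ l ∈ firstVertices n a, ∑ m ∈ firstVertices n a,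
      ∑ i ∈ firstVertices n b, ∑ j ∈ firstVertices n b, ∑ k ∈ firstVertices n b,
        cov22_21 n p i j k l m) +
  ((b : ℝ) - 2) *
    (∑ i ∈ firstVertices n a, ∑ j ∈ firstVertices n a, ∑ k ∈ firstVertices n a,
      ∑ l ∈ firstVertices n b, ∑ m ∈ firstVertices n b, cov22_21 n p i j k l m) +
  ∑ i ∈ firstVertices n a, ∑ j ∈ firstVertices n a, ∑ k ∈ firstVertices n a,
    ∑ r ∈ firstVertices n b, ∑ s ∈ firstVertices n b, ∑ t ∈ firstVertices n b,
      cov22_22 n p i j k r s t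

/-- `D` is a random element of `D([0,1], ℝ²)` with paths that depend on `t` only through `⌊n t⌋`,
and it is a centred Gaussian process with the covariance function above. -/
structure IsPreLimit {Ω : Type*} [MeasurableSpace Ω] (P : Measure Ω) (n : ℕ) (p : ℝ)
    (D : Ω → SkorokhodD 2) : Prop where
  piecewise_constant : ∀ ω s t, revealed n s = revealed n t → (D ω).1 s = (D ω).1 t
  gaussian : IsGaussianProcess (fun (q : Fin 2 × I) ω => (D ω).1 q.2 q.1) P
  centred : ∀ (q : Fin 2) (t : I), ∫ ω, (D ω).1 t q ∂P = 0
  cov_zero_zero : ∀ s t : I,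
    ∫ ω, (D ω).1 s 0 * (D ω).1 t 0 ∂P = covD11 n p (revealed n s) (revealed n t)
  cov_zero_one : ∀ s t : I,
    ∫ ω, (D ω).1 s 0 * (D ω).1 t 1 ∂P = covD12 n p (revealed n s) (revealed n t)
  cov_one_one : ∀ s t : I,
    ∫ ω, (D ω).1 s 1 * (D ω).1 t 1 ∂P = covD22 n p (revealed n s) (revealed n t)

end

/-! ### Functionals with Lipschitz second derivative -/

/-- Twice differentiable functionals whose second derivative has, as a family of quadratic forms,
linear growth with constant `c` and Lipschitz constant `k`. -/
structure HasLipschitzHessian {E : Type*} [NormedAddCommGroup E] [NormedSpace ℝ E]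
    (g : E → ℝ) (c k : ℝ) : Prop where
  differentiable : Differentiable ℝ g
  differentiable_fderiv : Differentiable ℝ (fderiv ℝ g)
  growth : ∃ C, ∀ w, ‖g w‖ ≤ C * (1 + ‖w‖) ^ 3
  growth_fderiv : ∃ C, ∀ w, ‖fderiv ℝ g w‖ ≤ C * (1 + ‖w‖)
  hessian_le : ∀ w h, |fderiv ℝ (fderiv ℝ g) w h h| ≤ c * (1 + ‖w‖) * ‖h‖ ^ 2
  hessian_sub_le : ∀ w v h,
    |fderiv ℝ (fderiv ℝ g) (w + v) h h - fderiv ℝ (fderiv ℝ g) w h h| ≤ k * ‖v‖ * ‖h‖ ^ 2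

/-- Polarization: a symmetric bilinear form is bounded by twice its bound as a quadratic form. -/
theorem abs_bilin_le_of_abs_quadratic_le {E : Type*} [NormedAddCommGroup E] [NormedSpace ℝ E]
    (B : E →L[ℝ] E →L[ℝ] ℝ) (hB : ∀ x y, B x y = B y x) {K : ℝ} (hK : 0 ≤ K)
    (h : ∀ x, |B x x| ≤ K * ‖x‖ ^ 2) (x y : E) : |B x y| ≤ 2 * K * ‖x‖ * ‖y‖ := by
  have key : ∀ u v : E, ‖u‖ ≤ 1 → ‖v‖ ≤ 1 → |B u v| ≤ 2 * K := by
    intro u v hu hv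
    have e : B u v = (B (u + v) (u + v) - B (u - v) (u - v)) / 4 := by
      simp only [map_add, map_sub, add_apply, sub_apply]
      rw [hB v u]; ring
    have h1 := h (u + v)
    have h2 := h (u - v)
    have n1 : ‖u + v‖ ≤ 2 := (norm_add_le _ _).trans (by linarith)
    have n2 : ‖u - v‖ ≤ 2 := (norm_sub_le _ _).trans (by linarith)
    have m1 : K * ‖u + v‖ ^ 2 ≤ K * 4 := by
      refine mul_le_mul_of_nonneg_left ?_ hK
      nlinarith [norm_nonneg (u + v)]
    have m2 : K * ‖u - v‖ ^ 2 ≤ K * 4 := by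
      refine mul_le_mul_of_nonneg_left ?_ hK
      nlinarith [norm_nonneg (u - v)]
    rw [e, abs_le]
    rw [abs_le] at h1 h2
    constructor <;> linarith [h1.1, h1.2, h2.1, h2.2]
  rcases eq_or_ne x 0 with rfl | hx
  · simp
  rcases eq_or_ne y 0 with rfl | hy
  · simp
  have hx' := norm_pos_iff.2 hx
  have hy' := norm_pos_iff.2 hy
  have := key (‖x‖⁻¹ • x) (‖y‖⁻¹ • y) (by simp [norm_smul, hx'.ne']) (by simp [norm_smul, hy'.ne'])
  simp only [map_smul, smul_apply, smul_eq_mul, abs_mul, abs_inv,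
    abs_norm] at this
  rw [show ‖y‖⁻¹ * (‖x‖⁻¹ * |B x y|) = |B x y| / (‖x‖ * ‖y‖) by field_simp,
    div_le_iff₀ (by positivity)] at this
  linarith

namespace HasLipschitzHessian

variable {E : Type*} [NormedAddCommGroup E] [NormedSpace ℝ E] {g : E → ℝ} {c k : ℝ}

theorem symm (hg : HasLipschitzHessian g c k) (w x y : E) :
    fderiv ℝ (fderiv ℝ g) w x y = fderiv ℝ (fderiv ℝ g) w y x :=
  second_derivative_symmetric (fun z => (hg.differentiable z).hasFDerivAt)
    (hg.differentiable_fderiv w).hasFDerivAt x y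

/-- The mixed second difference of the first derivative. -/
theorem abs_fderiv_mixed_le (hg : HasLipschitzHessian g c k) (hk : 0 ≤ k) (u a b r : E) :
    |fderiv ℝ g (u + a + b) r - fderiv ℝ g (u + a) r - fderiv ℝ g (u + b) r + fderiv ℝ g u r|
      ≤ 2 * k * ‖a‖ * ‖b‖ * ‖r‖ := by
  have hd : ∀ (x : E) (θ : ℝ), HasDerivAt (fun θ : ℝ => fderiv ℝ g (x + θ • b) r)
      (fderiv ℝ (fderiv ℝ g) (x + θ • b) b r) θ := by
    intro x θ
    have h1 : HasDerivAt (fun θ : ℝ => x + θ • b) b θ := by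
      simpa using ((hasDerivAt_id θ).smul_const b).const_add x
    have h2 := (hg.differentiable_fderiv (x + θ • b)).hasFDerivAt.comp_hasDerivAt θ h1
    exact ((ContinuousLinearMap.apply ℝ ℝ r).hasFDerivAt.comp_hasDerivAt θ h2)
  have h := norm_image_sub_le_of_norm_deriv_le_segment_01'
    (f := fun θ : ℝ => fderiv ℝ g (u + a + θ • b) r - fderiv ℝ g (u + θ • b) r)
    (f' := fun θ => fderiv ℝ (fderiv ℝ g) (u + a + θ • b) b r
      - fderiv ℝ (fderiv ℝ g) (u + θ • b) b r) (C := 2 * k * ‖a‖ * ‖b‖ * ‖r‖)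
    (fun θ _ => ((hd (u + a) θ).sub (hd u θ)).hasDerivWithinAt) (fun θ _ => by
      have := abs_bilin_le_of_abs_quadratic_le
        (fderiv ℝ (fderiv ℝ g) (u + a + θ • b) - fderiv ℝ (fderiv ℝ g) (u + θ • b))
        (fun x y => by
          simp only [sub_apply]
          rw [hg.symm _ x y, hg.symm (u + θ • b) x y])
        (K := k * ‖a‖) (by positivity) (fun x => by
          have := hg.hessian_sub_le (u + θ • b) a x
          rwa [show u + θ • b + a = u + a + θ • b by abel] at this) b r
      simp only [sub_apply] at this
      rw [Real.norm_eq_abs]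
      linarith)
  simp only [one_smul, zero_smul, add_zero, Real.norm_eq_abs] at h
  convert h using 2
  ring

/-- Second order Taylor expansion. -/
theorem abs_taylor_le (hg : HasLipschitzHessian g c k) (u h : E) :
    |g (u + h) - g u - fderiv ℝ g u h - fderiv ℝ (fderiv ℝ g) u h h / 2| ≤ k / 6 * ‖h‖ ^ 3 := by
  have hl : ∀ θ : ℝ, HasDerivAt (fun θ : ℝ => u + θ • h) h θ := fun θ => by
    simpa using ((hasDerivAt_id θ).smul_const h).const_add u
  have hd0 : ∀ θ : ℝ, HasDerivAt (fun θ : ℝ => g (u + θ • h)) (fderiv ℝ g (u + θ • h) h) θ :=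
    fun θ => (hg.differentiable (u + θ • h)).hasFDerivAt.comp_hasDerivAt θ (hl θ)
  have hd1 : ∀ θ : ℝ, HasDerivAt (fun θ : ℝ => fderiv ℝ g (u + θ • h) h)
      (fderiv ℝ (fderiv ℝ g) (u + θ • h) h h) θ := fun θ =>
    (ContinuousLinearMap.apply ℝ ℝ h).hasFDerivAt.comp_hasDerivAt θ
      ((hg.differentiable_fderiv (u + θ • h)).hasFDerivAt.comp_hasDerivAt θ (hl θ))
  set A := fderiv ℝ g u h
  set B := fderiv ℝ (fderiv ℝ g) u h h
  have hf1 : ∀ θ : ℝ, HasDerivAt (fun θ : ℝ => fderiv ℝ g (u + θ • h) h - A - θ * B)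
      (fderiv ℝ (fderiv ℝ g) (u + θ • h) h h - B) θ := fun θ => by
    have := ((hd1 θ).sub_const A).sub ((hasDerivAt_id' θ).mul_const B)
    rwa [one_mul] at this
  have hf0 : ∀ θ : ℝ, HasDerivAt (fun θ : ℝ => g (u + θ • h) - g u - θ * A - θ ^ 2 / 2 * B)
      (fderiv ℝ g (u + θ • h) h - A - θ * B) θ := fun θ => by
    have := (((hd0 θ).sub_const (g u)).sub ((hasDerivAt_id' θ).mul_const A)).sub
      (((hasDerivAt_pow 2 θ).div_const 2).mul_const B)
    exact this.congr_deriv (by norm_num)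
  have b1 : ∀ θ ∈ Set.Icc (0 : ℝ) 1, ‖fderiv ℝ g (u + θ • h) h - A - θ * B‖
      ≤ k * ‖h‖ ^ 3 * (θ ^ 2 / 2) := by
    intro θ hθ
    refine image_norm_le_of_norm_deriv_right_le_deriv_boundary (a := 0) (b := 1)
      (B := fun θ => k * ‖h‖ ^ 3 * (θ ^ 2 / 2)) (B' := fun θ => k * ‖h‖ ^ 3 * θ)
      (fun x _ => (hf1 x).continuousAt.continuousWithinAt)
      (fun x _ => (hf1 x).hasDerivWithinAt) (by simp [A]) (fun x => ?_) (fun x hx => ?_) hθ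
    · have := ((hasDerivAt_pow 2 x).div_const 2).const_mul (k * ‖h‖ ^ 3)
      exact this.congr_deriv (by norm_num)
    · have := hg.hessian_sub_le u (x • h) h
      rw [norm_smul, Real.norm_eq_abs, abs_of_nonneg hx.1] at this
      rw [Real.norm_eq_abs]
      linarith
  have b0 := image_norm_le_of_norm_deriv_right_le_deriv_boundary (a := 0) (b := 1)
      (f := fun θ : ℝ => g (u + θ • h) - g u - θ * A - θ ^ 2 / 2 * B)
      (B := fun θ => k * ‖h‖ ^ 3 * (θ ^ 3 / 6)) (B' := fun θ => k * ‖h‖ ^ 3 * (θ ^ 2 / 2))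
      (fun x _ => (hf0 x).continuousAt.continuousWithinAt)
      (fun x _ => (hf0 x).hasDerivWithinAt) (by simp) (fun x => by
        have := ((hasDerivAt_pow 3 x).div_const 6).const_mul (k * ‖h‖ ^ 3)
        exact this.congr_deriv (by push_cast; ring)) (fun x hx => b1 x ⟨hx.1, hx.2.le⟩)
      (Set.right_mem_Icc.2 zero_le_one)
  simp only [one_smul, Real.norm_eq_abs] at b0
  calc |g (u + h) - g u - A - B / 2| = |g (u + h) - g u - 1 * A - 1 ^ 2 / 2 * B| := by
        congr 1; ring
    _ ≤ _ := b0
    _ = _ := by ring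

theorem continuous (hg : HasLipschitzHessian g c k) : Continuous g := hg.differentiable.continuous

theorem continuous_fderiv (hg : HasLipschitzHessian g c k) : Continuous (fderiv ℝ g) :=
  hg.differentiable_fderiv.continuous

theorem continuous_hessian (hg : HasLipschitzHessian g c k) (h : E) :
    Continuous fun w => fderiv ℝ (fderiv ℝ g) w h h := by
  refine (LipschitzWith.of_dist_le_mul (K := (k * ‖h‖ ^ 2).toNNReal) fun x y => ?_).continuous
  have := hg.hessian_sub_le y (x - y) h
  rw [add_sub_cancel] at this
  rw [Real.dist_eq, dist_eq_norm]
  refine this.trans ?_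
  rw [mul_right_comm]
  exact mul_le_mul_of_nonneg_right (Real.le_coe_toNNReal _) (norm_nonneg _)

end HasLipschitzHessian

/-! ### The seminorms defining `M²` -/

theorem abs_apply_self_le_iSup {E : Type*} [NormedAddCommGroup E] [NormedSpace ℝ E]
    (B : E →L[ℝ] E →L[ℝ] ℝ) (h : E) :
    |B h h| ≤ (⨆ h : {h : E // ‖h‖ = 1}, |B h.1 h.1|) * ‖h‖ ^ 2 := by
  have hB : BddAbove (Set.range fun h : {h : E // ‖h‖ = 1} => |B h.1 h.1|) := by
    refine ⟨‖B‖, ?_⟩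
    rintro _ ⟨⟨h, hh⟩, rfl⟩
    have := B.le_opNorm₂ h h
    simpa [hh] using this
  rcases eq_or_ne h 0 with rfl | hh
  · simp
  have hh' := norm_pos_iff.2 hh
  have := le_ciSup hB ⟨‖h‖⁻¹ • h, by simp [norm_smul, hh'.ne']⟩
  simp only [map_smul, smul_apply, smul_eq_mul, abs_mul, abs_inv, abs_norm] at this
  rw [show ‖h‖⁻¹ * (‖h‖⁻¹ * |B h h|) = |B h h| / ‖h‖ ^ 2 by field_simp,
    div_le_iff₀ (by positivity)] at this
  exact this

theorem formNorm_nonneg {d : ℕ} (B : SkorokhodD d →L[ℝ] SkorokhodD d →L[ℝ] ℝ) :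
    0 ≤ formNorm B := Real.iSup_nonneg fun _ => abs_nonneg _

theorem abs_apply_self_le_formNorm {d : ℕ} (B : SkorokhodD d →L[ℝ] SkorokhodD d →L[ℝ] ℝ)
    (h : SkorokhodD d) : |B h h| ≤ formNorm B * ‖h‖ ^ 2 :=
  abs_apply_self_le_iSup B h

theorem MemM2.hasLipschitzHessian {d : ℕ} {g : SkorokhodD d → ℝ} (hg : MemM2 g) :
    ∃ c k : ℝ, 0 ≤ c ∧ 0 ≤ k ∧ c + k ≤ normM2 g ∧ HasLipschitzHessian g c k := by
  refine ⟨⨆ w, formNorm (D2 g w) / (1 + ‖w‖), ⨆ x : SkorokhodD d × SkorokhodD d,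
      formNorm (D2 g (x.1 + x.2) - D2 g x.1) / ‖x.2‖,
    Real.iSup_nonneg fun w => div_nonneg (formNorm_nonneg _) (by positivity),
    Real.iSup_nonneg fun w => div_nonneg (formNorm_nonneg _) (norm_nonneg _), ?_,
    hg.memM.differentiable, hg.memM.twice_differentiable, ?_, ?_, ?_, ?_⟩
  · have h1 : 0 ≤ ⨆ w, |g w| / (1 + ‖w‖ ^ 3) := Real.iSup_nonneg fun w => by positivity
    have h2 : 0 ≤ ⨆ w, ‖fderiv ℝ g w‖ / (1 + ‖w‖) := Real.iSup_nonneg fun w => by positivity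
    unfold normM2
    linarith
  · obtain ⟨C, hC⟩ := hg.bdd_zero
    refine ⟨C, fun w => ?_⟩
    have := hC ⟨w, rfl⟩
    rw [div_le_iff₀ (by positivity)] at this
    have hC0 : 0 ≤ C := le_trans (by positivity) (hC ⟨w, rfl⟩)
    refine this.trans (mul_le_mul_of_nonneg_left ?_ hC0)
    nlinarith [norm_nonneg w, sq_nonneg ‖w‖]
  · obtain ⟨C, hC⟩ := hg.bdd_one
    refine ⟨C, fun w => ?_⟩
    have := hC ⟨w, rfl⟩
    rwa [div_le_iff₀ (by positivity)] at this
  · intro w h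
    refine (abs_apply_self_le_formNorm _ h).trans (mul_le_mul_of_nonneg_right ?_ (by positivity))
    have := le_ciSup hg.bdd_two w
    rwa [div_le_iff₀ (by positivity)] at this
  · intro w v h
    refine (abs_apply_self_le_formNorm (D2 g (w + v) - D2 g w) h).trans
      (mul_le_mul_of_nonneg_right ?_ (by positivity))
    rcases eq_or_ne v 0 with rfl | hv
    · simp [formNorm]
    have := le_ciSup hg.bdd_lip (w, v)
    rwa [div_le_iff₀ (norm_pos_iff.2 hv)] at this

/-! ### Functions of finitely many independent real variables -/

/-- Continuous functions of polynomial growth. -/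
structure PolyGrowth {ι F : Type*} [Fintype ι] [SeminormedAddCommGroup F] (f : (ι → ℝ) → F) :
    Prop where
  continuous : Continuous f
  bound : ∃ C : ℝ, ∃ m : ℕ, 0 ≤ C ∧ ∀ x, ‖f x‖ ≤ C * (1 + ‖x‖) ^ m

namespace PolyGrowth

variable {ι F : Type*} [Fintype ι] [NormedAddCommGroup F]

theorem const (v : F) : PolyGrowth fun _ : ι → ℝ => v :=
  ⟨continuous_const, ‖v‖, 0, norm_nonneg _, fun x => by simp⟩

theorem eval (i : ι) : PolyGrowth fun x : ι → ℝ => x i :=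
  ⟨continuous_apply i, 1, 1, zero_le_one, fun x => by
    have := norm_le_pi_norm x i
    linarith⟩

theorem add {f f' : (ι → ℝ) → F} (hf : PolyGrowth f) (hf' : PolyGrowth f') :
    PolyGrowth fun x => f x + f' x := by
  obtain ⟨h, C, m, hC, hb⟩ := hf
  obtain ⟨h', C', m', hC', hb'⟩ := hf'
  refine ⟨h.add h', C + C', m + m', add_nonneg hC hC', fun x => ?_⟩
  have h1 : (1 : ℝ) ≤ 1 + ‖x‖ := by linarith [norm_nonneg x]
  have e1 := pow_le_pow_right₀ h1 (Nat.le_add_right m m')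
  have e2 := pow_le_pow_right₀ h1 (Nat.le_add_left m' m)
  calc ‖f x + f' x‖ ≤ ‖f x‖ + ‖f' x‖ := norm_add_le _ _
    _ ≤ C * (1 + ‖x‖) ^ m + C' * (1 + ‖x‖) ^ m' := add_le_add (hb x) (hb' x)
    _ ≤ C * (1 + ‖x‖) ^ (m + m') + C' * (1 + ‖x‖) ^ (m + m') := by gcongr
    _ = _ := by ring

theorem smul [NormedSpace ℝ F] {c : (ι → ℝ) → ℝ} {f : (ι → ℝ) → F} (hc : PolyGrowth c)
    (hf : PolyGrowth f) : PolyGrowth fun x => c x • f x := by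
  obtain ⟨h, C, m, hC, hb⟩ := hc
  obtain ⟨h', C', m', hC', hb'⟩ := hf
  refine ⟨h.smul h', C * C', m + m', mul_nonneg hC hC', fun x => ?_⟩
  rw [norm_smul]
  calc ‖c x‖ * ‖f x‖ ≤ (C * (1 + ‖x‖) ^ m) * (C' * (1 + ‖x‖) ^ m') :=
        mul_le_mul (hb x) (hb' x) (norm_nonneg _) ((norm_nonneg _).trans (hb x))
    _ = _ := by ring

theorem mul {f f' : (ι → ℝ) → ℝ} (hf : PolyGrowth f) (hf' : PolyGrowth f') :
    PolyGrowth fun x => f x * f' x := hf.smul hf'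

theorem pow {f : (ι → ℝ) → ℝ} (hf : PolyGrowth f) (m : ℕ) : PolyGrowth fun x => f x ^ m := by
  induction m with
  | zero => simpa using const (1 : ℝ)
  | succ m ih => simpa only [pow_succ] using ih.mul hf

theorem const_mul {f : (ι → ℝ) → ℝ} (hf : PolyGrowth f) (c : ℝ) : PolyGrowth fun x => c * f x :=
  (const c).mul hf

theorem sub {f f' : (ι → ℝ) → F} (hf : PolyGrowth f) (hf' : PolyGrowth f') :
    PolyGrowth fun x => f x - f' x := by
  have : PolyGrowth fun x => -f' x := ⟨hf'.1.neg, by simpa using hf'.2⟩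
  simpa only [sub_eq_add_neg] using hf.add this

theorem norm {f : (ι → ℝ) → F} (hf : PolyGrowth f) : PolyGrowth fun x => ‖f x‖ :=
  ⟨hf.1.norm, by simpa using hf.2⟩

theorem abs {f : (ι → ℝ) → ℝ} (hf : PolyGrowth f) : PolyGrowth fun x => |f x| := hf.norm

theorem sup {f f' : (ι → ℝ) → ℝ} (hf : PolyGrowth f) (hf' : PolyGrowth f') :
    PolyGrowth fun x => max (f x) (f' x) := by
  obtain ⟨C, m, hC, hb⟩ := (hf.norm.add hf'.norm).2
  refine ⟨hf.1.max hf'.1, C, m, hC, fun x => le_trans ?_ (hb x)⟩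
  simp only [Real.norm_eq_abs]
  rw [abs_of_nonneg (a := |f x| + |f' x|) (by positivity)]
  rcases max_cases (f x) (f' x) with h | h <;> rw [h.1] <;>
    linarith [abs_nonneg (f x), abs_nonneg (f' x)]

theorem sum {κ : Type*} (s : Finset κ) {f : κ → (ι → ℝ) → F} (hf : ∀ i ∈ s, PolyGrowth (f i)) :
    PolyGrowth fun x => ∑ i ∈ s, f i x := by
  classical
  induction s using Finset.induction_on with
  | empty => simpa using const (0 : F)
  | insert a s ha ih =>
    simp only [Finset.sum_insert ha]
    exact (hf a (Finset.mem_insert_self _ _)).add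
      (ih fun i hi => hf i (Finset.mem_insert_of_mem hi))

/-- Composition with a continuous function of polynomial growth. -/
theorem comp {G : Type*} [NormedAddCommGroup G] {φ : F → G} {f : (ι → ℝ) → F}
    (hf : PolyGrowth f) (hφ : Continuous φ) {C : ℝ} {m : ℕ}
    (hb : ∀ w, ‖φ w‖ ≤ C * (1 + ‖w‖) ^ m) : PolyGrowth fun x => φ (f x) := by
  have hC : 0 ≤ C := by simpa using (norm_nonneg _).trans (hb 0)
  obtain ⟨C', m', hC', hb'⟩ := (((const (1 : ℝ)).add hf.norm).pow m).2
  refine ⟨hφ.comp hf.1, C * C', m', mul_nonneg hC hC', fun x => ?_⟩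
  refine (hb _).trans ?_
  rw [mul_assoc]
  refine mul_le_mul_of_nonneg_left ((le_abs_self _).trans (hb' x)) hC

theorem comp_update [DecidableEq ι] {f : (ι → ℝ) → F} (hf : PolyGrowth f) (i : ι) :
    PolyGrowth fun x => f (Function.update x i 0) := by
  obtain ⟨h, C, m, hC, hb⟩ := hf
  refine ⟨h.comp (continuous_id.update i continuous_const), C, m, hC, fun x => (hb _).trans ?_⟩
  have : ‖Function.update x i 0‖ ≤ ‖x‖ := by
    refine (pi_norm_le_iff_of_nonneg (norm_nonneg _)).2 fun j => ?_
    rcases eq_or_ne j i with rfl | hj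
    · simp
    · rw [Function.update_of_ne hj]; exact norm_le_pi_norm x j
  gcongr

theorem measurable {f : (ι → ℝ) → ℝ} (hf : PolyGrowth f) : Measurable f := hf.1.measurable

theorem integrable {μ : ι → Measure ℝ} [∀ i, IsProbabilityMeasure (μ i)]
    (hμ : ∀ i (m : ℕ), Integrable (fun y : ℝ => |y| ^ m) (μ i)) {f : (ι → ℝ) → ℝ}
    (hf : PolyGrowth f) : Integrable f (Measure.pi μ) := by
  obtain ⟨h, C, m, hC, hb⟩ := hf
  have hi : Integrable (fun x : ι → ℝ => C * (2 ^ (m - 1) * (2 + ∑ i, |x i| ^ m)))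
      (Measure.pi μ) := by
    refine (((integrable_const 2).add (integrable_finsetSum _ fun i _ => ?_)).const_mul _).const_mul _
    exact (measurePreserving_eval μ i).integrable_comp_of_integrable (hμ i m)
  refine hi.mono' h.aestronglyMeasurable (.of_forall fun x => (hb x).trans ?_)
  refine mul_le_mul_of_nonneg_left ((add_pow_le zero_le_one (norm_nonneg _) m).trans ?_) hC
  rw [one_pow]
  refine mul_le_mul_of_nonneg_left ?_ (by positivity)
  rw [← one_add_one_eq_two, add_assoc]
  refine add_le_add_right ?_ 1
  rcases isEmpty_or_nonempty ι with hι | hι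
  · have : ‖x‖ = 0 := by rw [Subsingleton.elim x 0, norm_zero]
    rw [this]
    simpa using pow_le_one₀ (n := m) le_rfl zero_le_one
  · obtain ⟨i, hi⟩ := Finite.exists_max fun i => |x i|
    have : ‖x‖ ≤ |x i| := (pi_norm_le_iff_of_nonneg (abs_nonneg _)).2 hi
    refine ((pow_le_pow_left₀ (norm_nonneg _) this m).trans
      (Finset.single_le_sum (f := fun i => |x i| ^ m) (fun i _ => by positivity)
        (Finset.mem_univ i))).trans (by linarith)

end PolyGrowth

/-- `f` does not depend on the coordinate `i`. -/
def Ignores {ι F : Type*} [DecidableEq ι] (f : (ι → ℝ) → F) (i : ι) : Prop :=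
  ∀ x y, f (Function.update x i y) = f x

theorem Ignores.comp {ι F G : Type*} [DecidableEq ι] {f : (ι → ℝ) → F} {i : ι}
    (hf : Ignores f i) (φ : F → G) : Ignores (fun x => φ (f x)) i := fun x y => by
  simp only [hf x y]

theorem ignores_update {ι F : Type*} [DecidableEq ι] (f : (ι → ℝ) → F) (i : ι) :
    Ignores (fun x => f (Function.update x i 0)) i := fun x y => by
  simp only [Function.update_idem]

theorem Ignores.update {ι F : Type*} [DecidableEq ι] {f : (ι → ℝ) → F} {i : ι}
    (hf : Ignores f i) (j : ι) : Ignores (fun x => f (Function.update x j 0)) i := fun x y => by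
  rcases eq_or_ne i j with rfl | hij
  · simp only [Function.update_idem]
  · simp only [Function.update_comm hij]
    rw [hf]

section Independence

variable {ι : Type*} [Fintype ι] [DecidableEq ι] {μ : ι → Measure ℝ}
  [∀ i, IsProbabilityMeasure (μ i)]

theorem integral_mul_of_ignores (i : ι) {ψ : ℝ → ℝ} (hψ : Measurable ψ) {f : (ι → ℝ) → ℝ}
    (hf : Measurable f) (hi : Ignores f i) :
    ∫ x, ψ (x i) * f x ∂Measure.pi μ = (∫ y, ψ y ∂μ i) * ∫ x, f x ∂Measure.pi μ := by
  have hind : iIndepFun (fun i (x : ι → ℝ) => x i) (Measure.pi μ) :=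
    iIndepFun_pi (X := fun _ y => y) fun i => aemeasurable_id
  have h := hind.indepFun_finset {i} (Finset.univ.erase i) (by simp) (fun i => measurable_pi_apply i)
  let e : (↥(Finset.univ.erase i) → ℝ) → (ι → ℝ) := fun z j =>
    if hj : j ∈ Finset.univ.erase i then z ⟨j, hj⟩ else 0
  have he : Measurable e := by
    refine measurable_pi_lambda _ fun j => ?_
    by_cases hj : j ∈ Finset.univ.erase i
    · simp only [e, hj, dite_true]; exact measurable_pi_apply _
    · simp only [e, hj, dite_false]; exact measurable_const
  have hψ' : Measurable fun z : ({i} : Finset ι) → ℝ => ψ (z ⟨i, by simp⟩) :=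
    hψ.comp (measurable_pi_apply _)
  have h2 := h.comp hψ' (hf.comp he)
  have h3 := h2.integral_fun_mul_eq_mul_integral
    ((hψ.comp (measurable_pi_apply i)).aestronglyMeasurable)
    ((hf.comp he).comp (measurable_pi_lambda _ fun _ => measurable_pi_apply _)).aestronglyMeasurable
  have e1 : ∀ x : ι → ℝ, f (e fun j => x j) = f x := fun x => by
    rw [← hi x 0]
    congr 1
    ext j
    rcases eq_or_ne j i with rfl | hj <;> simp [e, *]
  simp only [Function.comp_def, e1] at h3
  rw [h3]
  congr 1
  rw [← (measurePreserving_eval μ i).map_eq,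
    integral_map (measurable_pi_apply i).aemeasurable hψ.aestronglyMeasurable]

theorem integral_eval_mul_of_ignores {i : ι} (h0 : ∫ y, y ∂μ i = 0) {f : (ι → ℝ) → ℝ}
    (hf : Measurable f) (hi : Ignores f i) : ∫ x, x i * f x ∂Measure.pi μ = 0 := by
  rw [integral_mul_of_ignores i (ψ := fun y => y) measurable_id hf hi, h0, zero_mul]

theorem integral_eval (i : ι) {ψ : ℝ → ℝ} (hψ : Measurable ψ) :
    ∫ x, ψ (x i) ∂Measure.pi μ = ∫ y, ψ y ∂μ i := by
  simpa using integral_mul_of_ignores (μ := μ) i hψ (f := fun _ => 1) measurable_const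
    fun _ _ => rfl

end Independence

/-! ### Replacing one random coefficient -/

namespace HasLipschitzHessian

variable {E : Type*} [NormedAddCommGroup E] [NormedSpace ℝ E] {g : E → ℝ} {c k : ℝ}
  {ι : Type*} [Fintype ι] {U : (ι → ℝ) → E}

theorem polyGrowth (hg : HasLipschitzHessian g c k) (hU : PolyGrowth U) :
    PolyGrowth fun x => g (U x) := by
  obtain ⟨C, hC⟩ := hg.growth
  exact hU.comp hg.continuous hC

theorem polyGrowth_fderiv (hg : HasLipschitzHessian g c k) (hU : PolyGrowth U) (v : E) :
    PolyGrowth fun x => fderiv ℝ g (U x) v := by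
  obtain ⟨C, hC⟩ := hg.growth_fderiv
  refine hU.comp (φ := fun w => fderiv ℝ g w v) (C := C * ‖v‖) (m := 1)
    (hg.continuous_fderiv.clm_apply continuous_const) fun w => ?_
  refine ((fderiv ℝ g w).le_opNorm v).trans ?_
  rw [pow_one, mul_right_comm]
  exact mul_le_mul_of_nonneg_right (hC w) (norm_nonneg _)

theorem polyGrowth_hessian (hg : HasLipschitzHessian g c k) (hU : PolyGrowth U) (v : E) :
    PolyGrowth fun x => fderiv ℝ (fderiv ℝ g) (U x) v v := by
  refine hU.comp (φ := fun w => fderiv ℝ (fderiv ℝ g) w v v) (C := c * ‖v‖ ^ 2) (m := 1)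
    (hg.continuous_hessian v) fun w => ?_
  refine (hg.hessian_le w v).trans (le_of_eq ?_)
  ring

variable {μ : ι → Measure ℝ} [∀ i, IsProbabilityMeasure (μ i)]

theorem abs_integral_taylor_le (hg : HasLipschitzHessian g c k)
    (hμ : ∀ i (m : ℕ), Integrable (fun y : ℝ => |y| ^ m) (μ i)) (hU : PolyGrowth U)
    {ξ : (ι → ℝ) → ℝ} (hξ : PolyGrowth ξ) (v : E) :
    |∫ x, g (U x + ξ x • v) ∂Measure.pi μ - ∫ x, g (U x) ∂Measure.pi μ
        - ∫ x, ξ x * fderiv ℝ g (U x) v ∂Measure.pi μ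
        - (∫ x, ξ x ^ 2 * fderiv ℝ (fderiv ℝ g) (U x) v v ∂Measure.pi μ) / 2|
      ≤ k / 6 * ‖v‖ ^ 3 * ∫ x, |ξ x| ^ 3 ∂Measure.pi μ := by
  have i1 := (hg.polyGrowth (hU.add (hξ.smul (.const v)))).integrable hμ
  have i2 := (hg.polyGrowth hU).integrable hμ
  have i3 := (hξ.mul (hg.polyGrowth_fderiv hU v)).integrable hμ
  have i4 := ((hξ.pow 2).mul (hg.polyGrowth_hessian hU v)).integrable hμ
  have i5 := (hξ.abs.pow 3).integrable hμ
  have i12 : Integrable (fun x => g (U x + ξ x • v) - g (U x)) (Measure.pi μ) := i1.sub i2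
  have i123 : Integrable (fun x => g (U x + ξ x • v) - g (U x) - ξ x * fderiv ℝ g (U x) v)
      (Measure.pi μ) := i12.sub i3
  rw [← integral_div, ← integral_sub i1 i2, ← integral_sub i12 i3,
    ← integral_sub i123 (i4.div_const 2), ← integral_const_mul, ← Real.norm_eq_abs]
  refine norm_integral_le_of_norm_le (i5.const_mul _) (.of_forall fun x => ?_)
  have := hg.abs_taylor_le (U x) (ξ x • v)
  simp only [map_smul, smul_apply, smul_eq_mul, norm_smul, Real.norm_eq_abs] at this
  rw [Real.norm_eq_abs]
  calc _ = |g (U x + ξ x • v) - g (U x) - ξ x * fderiv ℝ g (U x) v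
        - ξ x * (ξ x * fderiv ℝ (fderiv ℝ g) (U x) v v) / 2| := by congr 1; ring
    _ ≤ _ := this
    _ = _ := by ring

variable [DecidableEq ι]

/-- The effect of adding an independent centred summand `x i • v`. -/
theorem abs_integral_add_eval_le (hg : HasLipschitzHessian g c k)
    (hμ : ∀ i (m : ℕ), Integrable (fun y : ℝ => |y| ^ m) (μ i)) (hU : PolyGrowth U) {i : ι}
    (hi : Ignores U i) (h0 : ∫ y, y ∂μ i = 0) (v : E) :
    |∫ x, g (U x + x i • v) ∂Measure.pi μ - ∫ x, g (U x) ∂Measure.pi μ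
        - (∫ y, y ^ 2 ∂μ i) / 2 * ∫ x, fderiv ℝ (fderiv ℝ g) (U x) v v ∂Measure.pi μ|
      ≤ k / 6 * ‖v‖ ^ 3 * ∫ y, |y| ^ 3 ∂μ i := by
  have h := hg.abs_integral_taylor_le hμ hU (.eval i) v
  rw [integral_eval_mul_of_ignores h0 (hg.polyGrowth_fderiv hU v).measurable (hi.comp fun w => fderiv ℝ g w v),
    integral_mul_of_ignores i (ψ := fun y => y ^ 2) (by fun_prop)
      (hg.polyGrowth_hessian hU v).measurable (hi.comp fun w => fderiv ℝ (fderiv ℝ g) w v v),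
    integral_eval i (ψ := fun y => |y| ^ 3) (by fun_prop), sub_zero] at h
  rwa [div_mul_eq_mul_div]

/-- Replacing `x i • v` by `x j • (s • v)`, the variances being equal. -/
theorem abs_integral_swap_le (hg : HasLipschitzHessian g c k)
    (hμ : ∀ i (m : ℕ), Integrable (fun y : ℝ => |y| ^ m) (μ i)) (hU : PolyGrowth U) {i j : ι}
    (hi : Ignores U i) (hj : Ignores U j) (hi0 : ∫ y, y ∂μ i = 0) (hj0 : ∫ y, y ∂μ j = 0)
    {s : ℝ} (hs : 0 ≤ s) (h2 : ∫ y, y ^ 2 ∂μ i = s ^ 2 * ∫ y, y ^ 2 ∂μ j) (v : E) :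
    |∫ x, g (U x + x i • v) ∂Measure.pi μ - ∫ x, g (U x + x j • s • v) ∂Measure.pi μ|
      ≤ k / 6 * ‖v‖ ^ 3 * (∫ y, |y| ^ 3 ∂μ i + s ^ 3 * ∫ y, |y| ^ 3 ∂μ j) := by
  have a1 := hg.abs_integral_add_eval_le hμ hU hi hi0 v
  have a2 := hg.abs_integral_add_eval_le hμ hU hj hj0 (s • v)
  simp only [map_smul, smul_apply, smul_eq_mul, norm_smul, Real.norm_eq_abs,
    abs_of_nonneg hs, integral_const_mul] at a2
  rw [h2] at a1
  rw [abs_le] at *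
  constructor <;> nlinarith [a1.1, a1.2, a2.1, a2.2]

/-- The effect of adding an independent centred summand, in terms of the growth of the second
derivative. -/
theorem abs_integral_add_eval_le' (hg : HasLipschitzHessian g c k)
    (hμ : ∀ i (m : ℕ), Integrable (fun y : ℝ => |y| ^ m) (μ i)) (hU : PolyGrowth U) {i : ι}
    (hi : Ignores U i) (h0 : ∫ y, y ∂μ i = 0) (v : E) :
    |∫ x, g (U x + x i • v) ∂Measure.pi μ - ∫ x, g (U x) ∂Measure.pi μ|
      ≤ c / 2 * (1 + ∫ x, ‖U x‖ ∂Measure.pi μ) * ‖v‖ ^ 2 * (∫ y, y ^ 2 ∂μ i)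
        + k / 6 * ‖v‖ ^ 3 * ∫ y, |y| ^ 3 ∂μ i := by
  have a1 := hg.abs_integral_add_eval_le hμ hU hi h0 v
  have i1 := hU.norm.integrable hμ
  have a2 : |∫ x, fderiv ℝ (fderiv ℝ g) (U x) v v ∂Measure.pi μ|
      ≤ c * (1 + ∫ x, ‖U x‖ ∂Measure.pi μ) * ‖v‖ ^ 2 := by
    have e : c * (1 + ∫ x, ‖U x‖ ∂Measure.pi μ) * ‖v‖ ^ 2
        = ∫ x, c * (1 + ‖U x‖) * ‖v‖ ^ 2 ∂Measure.pi μ := by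
      rw [integral_mul_const, integral_const_mul, integral_add (integrable_const _) i1]
      simp
    rw [e, ← Real.norm_eq_abs]
    exact norm_integral_le_of_norm_le ((((integrable_const _).add i1).const_mul _).mul_const _)
      (.of_forall fun x => hg.hessian_le (U x) v)
  have h2 : 0 ≤ ∫ y, y ^ 2 ∂μ i := integral_nonneg fun y => sq_nonneg y
  have a3 : |(∫ y, y ^ 2 ∂μ i) / 2 * ∫ x, fderiv ℝ (fderiv ℝ g) (U x) v v ∂Measure.pi μ|
      ≤ (∫ y, y ^ 2 ∂μ i) / 2 * (c * (1 + ∫ x, ‖U x‖ ∂Measure.pi μ) * ‖v‖ ^ 2) := by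
    rw [abs_mul, abs_of_nonneg (div_nonneg h2 zero_le_two)]
    exact mul_le_mul_of_nonneg_left a2 (by positivity)
  rw [abs_le] at *
  constructor <;> linarith [a1.1, a1.2, a3.1, a3.2]

/-- Replacing the product `(x e * x f) • v` by `x j • (s • v)`, where `s` is the variance of
`x e` and of `x f`, although the remaining part `U` may depend on `x e` and `x f`. -/
theorem abs_integral_swap_mul_le (hg : HasLipschitzHessian g c k) (hk : 0 ≤ k)
    (hμ : ∀ i (m : ℕ), Integrable (fun y : ℝ => |y| ^ m) (μ i)) (hU : PolyGrowth U) {e f j : ι}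
    (hef : e ≠ f) (hj : Ignores U j) (he0 : ∫ y, y ∂μ e = 0) (hf0 : ∫ y, y ∂μ f = 0)
    (hj0 : ∫ y, y ∂μ j = 0) {s : ℝ} (hs : 0 ≤ s) (he2 : ∫ y, y ^ 2 ∂μ e = s)
    (hf2 : ∫ y, y ^ 2 ∂μ f = s) (hj2 : ∫ y, y ^ 2 ∂μ j = 1)
    (hmix : ∀ x, U x = U (Function.update x f 0) + U (Function.update x e 0)
      - U (Function.update (Function.update x e 0) f 0))
    {A : ℝ} (hA : 0 ≤ A)
    (hb : ∀ᵐ x ∂Measure.pi μ, |x e| ≤ 1 ∧ |x f| ≤ 1 ∧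
      ‖U (Function.update x f 0) - U (Function.update (Function.update x e 0) f 0)‖ ≤ A * |x e| ∧
      ‖U (Function.update x e 0) - U (Function.update (Function.update x e 0) f 0)‖ ≤ A * |x f|)
    (v : E) :
    |∫ x, g (U x + (x e * x f) • v) ∂Measure.pi μ - ∫ x, g (U x + x j • s • v) ∂Measure.pi μ|
      ≤ k * s ^ 2 * (2 * A ^ 2 * ‖v‖ + 2 * A * ‖v‖ ^ 2
        + ‖v‖ ^ 3 / 6 * (1 + s * ∫ y, |y| ^ 3 ∂μ j)) := by
  have hUe := hU.comp_update e
  have hUf := hU.comp_update f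
  have hUef : PolyGrowth fun x => U (Function.update (Function.update x e 0) f 0) :=
    (hU.comp_update f).comp_update e
  have ige : Ignores (fun x => U (Function.update (Function.update x e 0) f 0)) e :=
    ignores_update (fun x => U (Function.update x f 0)) e
  have igf : Ignores (fun x => U (Function.update (Function.update x e 0) f 0)) f :=
    (ignores_update U f).update e
  have pe : PolyGrowth fun x : ι → ℝ => x e := .eval e
  have pf : PolyGrowth fun x : ι → ℝ => x f := .eval f
  have hξ := pe.mul pf
  have ie : ∀ m : ℕ, Ignores (fun x : ι → ℝ => x f ^ m) e := fun m x y => by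
    simp only [Function.update_of_ne hef.symm]
  have int22 : ∫ x, (x e * x f) ^ 2 ∂Measure.pi μ = s ^ 2 := by
    simp only [mul_pow]
    rw [integral_mul_of_ignores e (ψ := fun y => y ^ 2) (by fun_prop) (pf.pow 2).measurable (ie 2),
      integral_eval f (ψ := fun y => y ^ 2) (by fun_prop), he2, hf2, sq]
  have iξ2 := (hξ.pow 2).integrable hμ
  have a1 := hg.abs_integral_taylor_le hμ hU hξ v
  have a2 := hg.abs_integral_add_eval_le hμ hU hj hj0 (s • v)
  simp only [map_smul, smul_apply, smul_eq_mul, norm_smul, Real.norm_eq_abs,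
    abs_of_nonneg hs, integral_const_mul, hj2] at a2
  have a3 : ∫ x, |x e * x f| ^ 3 ∂Measure.pi μ ≤ s ^ 2 := by
    rw [← int22]
    refine integral_mono_ae ((hξ.abs.pow 3).integrable hμ) iξ2 ?_
    filter_upwards [hb] with x hx
    have : |x e * x f| ≤ 1 := by
      rw [abs_mul]; exact mul_le_one₀ hx.1 (abs_nonneg _) hx.2.1
    rw [← sq_abs (x e * x f)]
    exact pow_le_pow_of_le_one (abs_nonneg _) this (by norm_num)
  have a4 : |∫ x, x e * x f * fderiv ℝ g (U x) v ∂Measure.pi μ|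
      ≤ 2 * k * A ^ 2 * ‖v‖ * s ^ 2 := by
    have j1 := (hξ.mul (hg.polyGrowth_fderiv hU v)).integrable hμ
    have j2 := (hξ.mul (hg.polyGrowth_fderiv hUf v)).integrable hμ
    have j3 := (hξ.mul (hg.polyGrowth_fderiv hUe v)).integrable hμ
    have j4 := (hξ.mul (hg.polyGrowth_fderiv hUef v)).integrable hμ
    have z2 : ∫ x, x e * x f * fderiv ℝ g (U (Function.update x f 0)) v ∂Measure.pi μ = 0 := by
      have := integral_eval_mul_of_ignores (μ := μ) hf0
        (f := fun x => x e * fderiv ℝ g (U (Function.update x f 0)) v)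
        (pe.mul (hg.polyGrowth_fderiv hUf v)).measurable (fun x y => by
          simp only [Function.update_idem, Function.update_of_ne hef])
      refine Eq.trans ?_ this
      congr 1; ext x; ring
    have z3 : ∫ x, x e * x f * fderiv ℝ g (U (Function.update x e 0)) v ∂Measure.pi μ = 0 := by
      have := integral_eval_mul_of_ignores (μ := μ) he0
        (f := fun x => x f * fderiv ℝ g (U (Function.update x e 0)) v)
        (pf.mul (hg.polyGrowth_fderiv hUe v)).measurable (fun x y => by
          simp only [Function.update_idem, Function.update_of_ne hef.symm])
      refine Eq.trans ?_ this
      congr 1; ext x; ring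
    have z4 : ∫ x, x e * x f * fderiv ℝ g (U (Function.update (Function.update x e 0) f 0)) v
        ∂Measure.pi μ = 0 := by
      have := integral_eval_mul_of_ignores (μ := μ) he0
        (f := fun x => x f * fderiv ℝ g (U (Function.update (Function.update x e 0) f 0)) v)
        (pf.mul (hg.polyGrowth_fderiv hUef v)).measurable (fun x y => by
          simp only [Function.update_idem, Function.update_of_ne hef.symm])
      refine Eq.trans ?_ this
      congr 1; ext x; ring
    have e1 : ∫ x, x e * x f * fderiv ℝ g (U x) v ∂Measure.pi μ
        = ∫ x, (x e * x f * fderiv ℝ g (U x) v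
          - x e * x f * fderiv ℝ g (U (Function.update x f 0)) v
          - x e * x f * fderiv ℝ g (U (Function.update x e 0)) v
          + x e * x f * fderiv ℝ g (U (Function.update (Function.update x e 0) f 0)) v)
          ∂Measure.pi μ := by
      have j12 : Integrable (fun x : ι → ℝ => x e * x f * fderiv ℝ g (U x) v
          - x e * x f * fderiv ℝ g (U (Function.update x f 0)) v) (Measure.pi μ) := j1.sub j2
      have j123 : Integrable (fun x : ι → ℝ => x e * x f * fderiv ℝ g (U x) v
          - x e * x f * fderiv ℝ g (U (Function.update x f 0)) v
          - x e * x f * fderiv ℝ g (U (Function.update x e 0)) v) (Measure.pi μ) := j12.sub j3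
      rw [integral_add j123 j4, integral_sub j12 j3, integral_sub j1 j2, z2, z3, z4]
      ring
    rw [e1, ← int22, ← integral_const_mul, ← Real.norm_eq_abs]
    refine norm_integral_le_of_norm_le (iξ2.const_mul _) ?_
    filter_upwards [hb] with x ⟨_, _, hx1, hx2⟩
    have := hg.abs_fderiv_mixed_le hk (U (Function.update (Function.update x e 0) f 0))
      (U (Function.update x f 0) - U (Function.update (Function.update x e 0) f 0))
      (U (Function.update x e 0) - U (Function.update (Function.update x e 0) f 0)) v
    rw [add_sub_cancel, add_sub_cancel, add_sub, ← hmix x] at this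
    rw [Real.norm_eq_abs, ← mul_sub, ← mul_sub, ← mul_add, abs_mul]
    calc _ ≤ |x e * x f| * (2 * k * (A * |x e|) * (A * |x f|) * ‖v‖) := by
          refine mul_le_mul_of_nonneg_left (this.trans ?_) (abs_nonneg _)
          gcongr
      _ = _ := by rw [abs_mul, ← sq_abs (x e * x f), abs_mul]; ring
  have a5 : |∫ x, (x e * x f) ^ 2 * fderiv ℝ (fderiv ℝ g) (U x) v v ∂Measure.pi μ
      - s ^ 2 * ∫ x, fderiv ℝ (fderiv ℝ g) (U x) v v ∂Measure.pi μ|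
      ≤ 4 * k * A * ‖v‖ ^ 2 * s ^ 2 := by
    have pQ := hg.polyGrowth_hessian hU v
    have pQ0 := hg.polyGrowth_hessian hUef v
    have z : ∫ x, (x e * x f) ^ 2 * fderiv ℝ (fderiv ℝ g)
          (U (Function.update (Function.update x e 0) f 0)) v v ∂Measure.pi μ
        = s ^ 2 * ∫ x, fderiv ℝ (fderiv ℝ g)
          (U (Function.update (Function.update x e 0) f 0)) v v ∂Measure.pi μ := by
      have h1 := integral_mul_of_ignores (μ := μ) e (ψ := fun y => y ^ 2) (by fun_prop)
        (f := fun x => x f ^ 2 * fderiv ℝ (fderiv ℝ g)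
          (U (Function.update (Function.update x e 0) f 0)) v v)
        ((pf.pow 2).mul pQ0).measurable (fun x y => by
          simp only [Function.update_idem, Function.update_of_ne hef.symm])
      rw [integral_mul_of_ignores f (ψ := fun y => y ^ 2) (by fun_prop) pQ0.measurable
        (igf.comp fun w => fderiv ℝ (fderiv ℝ g) w v v), he2, hf2] at h1
      rw [sq, mul_assoc, ← h1]
      congr 1; ext x; ring
    have i1 := ((hξ.pow 2).mul pQ).integrable hμ
    have i2 := ((hξ.pow 2).mul pQ0).integrable hμ
    have i3 := pQ.integrable hμ
    have i4 := pQ0.integrable hμ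
    have e1 : ∫ x, (x e * x f) ^ 2 * fderiv ℝ (fderiv ℝ g) (U x) v v ∂Measure.pi μ
      - s ^ 2 * ∫ x, fderiv ℝ (fderiv ℝ g) (U x) v v ∂Measure.pi μ
      = ∫ x, ((x e * x f) ^ 2 * fderiv ℝ (fderiv ℝ g) (U x) v v - (x e * x f) ^ 2 *
        fderiv ℝ (fderiv ℝ g) (U (Function.update (Function.update x e 0) f 0)) v v
        - s ^ 2 * (fderiv ℝ (fderiv ℝ g) (U x) v v -
        fderiv ℝ (fderiv ℝ g) (U (Function.update (Function.update x e 0) f 0)) v v))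
          ∂Measure.pi μ := by
      have i12 : Integrable (fun x : ι → ℝ => (x e * x f) ^ 2 * fderiv ℝ (fderiv ℝ g) (U x) v v
        - (x e * x f) ^ 2 * fderiv ℝ (fderiv ℝ g)
          (U (Function.update (Function.update x e 0) f 0)) v v) (Measure.pi μ) := i1.sub i2
      have i34 : Integrable (fun x : ι → ℝ => s ^ 2 * (fderiv ℝ (fderiv ℝ g) (U x) v v
        - fderiv ℝ (fderiv ℝ g) (U (Function.update (Function.update x e 0) f 0)) v v))
          (Measure.pi μ) := (i3.sub i4).const_mul _
      rw [integral_sub i12 i34, integral_sub i1 i2, integral_const_mul, integral_sub i3 i4, z]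
      ring
    have e2 : 4 * k * A * ‖v‖ ^ 2 * s ^ 2
        = ∫ x, 2 * k * A * ‖v‖ ^ 2 * ((x e * x f) ^ 2 + s ^ 2) ∂Measure.pi μ := by
      rw [integral_const_mul, integral_add iξ2 (integrable_const _), int22]
      simp
      ring
    rw [e1, e2, ← Real.norm_eq_abs]
    refine norm_integral_le_of_norm_le ((iξ2.add (integrable_const _)).const_mul _) ?_
    filter_upwards [hb] with x ⟨h1, h2, hx1, hx2⟩
    set u0 := U (Function.update (Function.update x e 0) f 0)
    have hd := hg.hessian_sub_le u0 (U x - u0) v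
    rw [add_sub_cancel] at hd
    have hn : ‖U x - u0‖ ≤ 2 * A := by
      rw [hmix x, show U (Function.update x f 0) + U (Function.update x e 0) - u0 - u0
        = (U (Function.update x f 0) - u0) + (U (Function.update x e 0) - u0) by abel]
      refine (norm_add_le _ _).trans ?_
      nlinarith
    rw [Real.norm_eq_abs, ← mul_sub, ← sub_mul, abs_mul, mul_comm]
    have hd' : |fderiv ℝ (fderiv ℝ g) (U x) v v - fderiv ℝ (fderiv ℝ g) u0 v v|
        ≤ 2 * k * A * ‖v‖ ^ 2 := by
      refine hd.trans ?_
      have : k * ‖U x - u0‖ * ‖v‖ ^ 2 ≤ k * (2 * A) * ‖v‖ ^ 2 := by gcongr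
      linarith
    refine mul_le_mul hd' ?_ (abs_nonneg _) (by positivity)
    refine (abs_sub _ _).trans (le_of_eq ?_)
    rw [abs_of_nonneg (by positivity), abs_of_nonneg (by positivity)]
  have a6 : k / 6 * ‖v‖ ^ 3 * ∫ x, |x e * x f| ^ 3 ∂Measure.pi μ ≤ k / 6 * ‖v‖ ^ 3 * s ^ 2 := by
    gcongr
  rw [abs_le] at *
  constructor <;> linarith [a1.1, a1.2, a2.1, a2.2, a4.1, a4.2, a5.1, a5.2]

end HasLipschitzHessian

/-- Telescoping over a finite set. -/
theorem abs_sub_le_card_mul {κ : Type*} [DecidableEq κ] (H : Finset κ → ℝ) {ε : ℝ}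
    (h : ∀ T a, a ∉ T → |H (insert a T) - H T| ≤ ε) (T : Finset κ) :
    |H T - H ∅| ≤ T.card * ε := by
  induction T using Finset.induction_on with
  | empty => simp
  | insert a T ha ih =>
    rw [Finset.card_insert_of_notMem ha]
    have := abs_sub_le (H (insert a T)) (H T) (H ∅)
    push_cast
    linarith [h T a ha]

/-! ### A maximal inequality for sums of independent variables -/

/-- The running maximum of a sequence, and of `0`. -/
def runningMax (s : ℕ → ℝ) : ℕ → ℝ
  | 0 => 0
  | m + 1 => max (runningMax s m) (s (m + 1))

theorem runningMax_nonneg (s : ℕ → ℝ) (m : ℕ) : 0 ≤ runningMax s m := by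
  induction m with
  | zero => exact le_rfl
  | succ m ih => exact ih.trans (le_max_left _ _)

theorem le_runningMax {s : ℕ → ℝ} (h0 : s 0 = 0) {m n : ℕ} (hmn : m ≤ n) :
    s m ≤ runningMax s n := by
  induction n with
  | zero => rw [Nat.le_zero.1 hmn, h0]; exact le_rfl
  | succ n ih =>
    rcases Nat.le_succ_iff.1 hmn with h | h
    · exact (ih h).trans (le_max_left _ _)
    · rw [h]; exact le_max_right _ _

/-- The pathwise form of Doob's `L²` inequality. -/
theorem runningMax_sq_le (s : ℕ → ℝ) (n : ℕ) :
    runningMax s n ^ 2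
      ≤ 4 * s n ^ 2 - 4 * ∑ k ∈ Finset.range n, runningMax s k * (s (k + 1) - s k) := by
  have key : ∀ n, ∑ k ∈ Finset.range n, runningMax s k * (s (k + 1) - s k)
      ≤ runningMax s n * s n - runningMax s n ^ 2 / 2 := by
    intro n
    induction n with
    | zero => simp [runningMax]
    | succ n ih =>
      rw [Finset.sum_range_succ]
      rcases max_cases (runningMax s n) (s (n + 1)) with h | h <;>
        simp only [runningMax, h.1] <;> nlinarith [sq_nonneg (s (n + 1) - runningMax s n)]
  nlinarith [key n, sq_nonneg (runningMax s n - 2 * s n)]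

section

variable {ι : Type*} [Fintype ι]

/-- The sum of the `a i * x i` over the indices of level below `m`. -/
def levelSum (lev : ι → ℕ) (a : ι → ℝ) (m : ℕ) (x : ι → ℝ) : ℝ :=
  ∑ i with lev i < m, a i * x i

theorem polyGrowth_levelSum (lev : ι → ℕ) (a : ι → ℝ) (m : ℕ) : PolyGrowth (levelSum lev a m) :=
  PolyGrowth.sum _ fun i _ => (PolyGrowth.eval i).const_mul (a i)

theorem polyGrowth_runningMax (lev : ι → ℕ) (a : ι → ℝ) (m : ℕ) :
    PolyGrowth fun x => runningMax (fun k => levelSum lev a k x) m := by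
  induction m with
  | zero => exact .const 0
  | succ m ih => exact ih.sup (polyGrowth_levelSum lev a (m + 1))

theorem levelSum_succ_sub (lev : ι → ℕ) (a : ι → ℝ) (m : ℕ) (x : ι → ℝ) :
    levelSum lev a (m + 1) x - levelSum lev a m x = ∑ i with lev i = m, a i * x i := by
  simp only [levelSum, Finset.sum_filter, ← Finset.sum_sub_distrib]
  refine Finset.sum_congr rfl fun i _ => ?_
  rcases lt_trichotomy (lev i) m with h | h | h
  · simp [h, h.ne, h.trans (Nat.lt_succ_self m)]
  · simp [h]
  · simp [h.not_gt, h.ne', show ¬ lev i < m + 1 by omega]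

variable [DecidableEq ι]

theorem ignores_levelSum {lev : ι → ℕ} (a : ι → ℝ) {m : ℕ} {i : ι} (hi : m ≤ lev i) :
    Ignores (levelSum lev a m) i := by
  intro x y
  refine Finset.sum_congr rfl fun j hj => ?_
  rw [Function.update_of_ne]
  rintro rfl
  exact absurd (Finset.mem_filter.1 hj).2 (by omega)

theorem ignores_runningMax {lev : ι → ℕ} (a : ι → ℝ) {m : ℕ} {i : ι} (hi : m ≤ lev i) :
    Ignores (fun x => runningMax (fun k => levelSum lev a k x) m) i := by
  induction m with
  | zero => intro x y; rfl
  | succ m ih =>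
    intro x y
    have h1 := ih (by omega) x y
    have h2 := ignores_levelSum a hi x y
    simp only [runningMax] at h1 ⊢
    rw [h1, h2]

variable {μ : ι → Measure ℝ} [∀ i, IsProbabilityMeasure (μ i)]

/-- Centred independent variables are orthogonal. -/
theorem integral_eval_mul_eval {i j : ι} (hij : i ≠ j) (h0 : ∫ y, y ∂μ i = 0) :
    ∫ x, x i * x j ∂Measure.pi μ = 0 :=
  integral_eval_mul_of_ignores h0 (f := fun x => x j) (measurable_pi_apply j) fun _ _ =>
    Function.update_of_ne hij.symm _ _

theorem integral_sum_mul_sum (hμ : ∀ i (m : ℕ), Integrable (fun y : ℝ => |y| ^ m) (μ i))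
    (a b : ι → ℝ) (h0 : ∀ i, a i ≠ 0 → ∫ y, y ∂μ i = 0)
    (h1 : ∀ i, a i ≠ 0 → ∫ y, y ^ 2 ∂μ i = 1) :
    ∫ x, (∑ i, a i * x i) * (∑ i, b i * x i) ∂Measure.pi μ = ∑ i, a i * b i := by
  simp only [Finset.sum_mul_sum]
  have hint : ∀ i j, Integrable (fun x : ι → ℝ => a i * x i * (b j * x j)) (Measure.pi μ) :=
    fun i j => (((PolyGrowth.eval i).const_mul _).mul
      ((PolyGrowth.eval j).const_mul _)).integrable hμ
  rw [integral_finsetSum _ fun i _ => integrable_finsetSum _ fun j _ => hint i j]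
  refine Finset.sum_congr rfl fun i _ => ?_
  rw [integral_finsetSum _ fun j _ => hint i j]
  rcases eq_or_ne (a i) 0 with ha | ha
  · simp [ha]
  rw [Finset.sum_eq_single i]
  · have : ∀ x : ι → ℝ, a i * x i * (b i * x i) = a i * b i * x i ^ 2 := fun x => by ring
    simp only [this]
    rw [integral_const_mul, integral_eval i (ψ := fun y => y ^ 2) (by fun_prop), h1 i ha, mul_one]
  · intro j _ hj
    have : ∀ x : ι → ℝ, a i * x i * (b j * x j) = a i * b j * (x i * x j) := fun x => by ring
    simp only [this]
    rw [integral_const_mul, integral_eval_mul_eval hj.symm (h0 i ha), mul_zero]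
  · simp

theorem integral_runningMax_sq_le (hμ : ∀ i (m : ℕ), Integrable (fun y : ℝ => |y| ^ m) (μ i))
    (lev : ι → ℕ) (a : ι → ℝ) (h0 : ∀ i, a i ≠ 0 → ∫ y, y ∂μ i = 0)
    (h1 : ∀ i, a i ≠ 0 → ∫ y, y ^ 2 ∂μ i = 1) (n : ℕ) :
    ∫ x, runningMax (fun k => levelSum lev a k x) n ^ 2 ∂Measure.pi μ ≤ 4 * ∑ i, a i ^ 2 := by
  have pM := fun k => polyGrowth_runningMax lev a k
  have pS := fun k => polyGrowth_levelSum lev a k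
  have pD : ∀ k, PolyGrowth fun x => runningMax (fun k => levelSum lev a k x) k
      * (levelSum lev a (k + 1) x - levelSum lev a k x) := fun k =>
    (pM k).mul ((pS (k + 1)).sub (pS k))
  have hz : ∀ k, ∫ x, runningMax (fun k => levelSum lev a k x) k
      * (levelSum lev a (k + 1) x - levelSum lev a k x) ∂Measure.pi μ = 0 := by
    intro k
    simp only [levelSum_succ_sub, Finset.mul_sum]
    rw [integral_finsetSum _ fun i _ =>
      ((pM k).mul ((PolyGrowth.eval i).const_mul (a i))).integrable hμ]
    refine Finset.sum_eq_zero fun i hi => ?_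
    rcases eq_or_ne (a i) 0 with ha | ha
    · simp [ha]
    have := integral_eval_mul_of_ignores (h0 i ha) ((pM k).const_mul (a i)).measurable
      ((ignores_runningMax a (Finset.mem_filter.1 hi).2.ge).comp fun z => a i * z)
    refine Eq.trans ?_ this
    congr 1; ext x; ring
  have hS : ∫ x, levelSum lev a n x ^ 2 ∂Measure.pi μ ≤ ∑ i, a i ^ 2 := by
    have e : ∀ x, levelSum lev a n x = ∑ i, (if lev i < n then a i else 0) * x i := fun x => by
      simp only [levelSum, Finset.sum_filter, ite_mul, zero_mul]
    simp only [e, sq]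
    rw [integral_sum_mul_sum hμ _ _ (fun i hi => h0 i (by aesop)) fun i hi => h1 i (by aesop)]
    refine Finset.sum_le_sum fun i _ => ?_
    split_ifs
    · exact le_rfl
    · simpa using mul_self_nonneg (a i)
  have i1 := (((pS n).pow 2).const_mul 4).integrable hμ
  have i2 := ((PolyGrowth.sum (Finset.range n) fun k _ => pD k).const_mul 4).integrable hμ
  calc _ ≤ ∫ x, (4 * levelSum lev a n x ^ 2 - 4 * ∑ k ∈ Finset.range n,
        runningMax (fun k => levelSum lev a k x) k
          * (levelSum lev a (k + 1) x - levelSum lev a k x)) ∂Measure.pi μ :=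
        integral_mono (((pM n).pow 2).integrable hμ) (i1.sub i2) fun x =>
          runningMax_sq_le (fun k => levelSum lev a k x) n
    _ = 4 * ∫ x, levelSum lev a n x ^ 2 ∂Measure.pi μ := by
        rw [integral_sub i1 i2, integral_const_mul, integral_const_mul,
          integral_finsetSum _ fun k _ => (pD k).integrable hμ]
        simp [hz]
    _ ≤ _ := by linarith

/-- A maximal inequality: the partial sums are dominated by a variable of controlled mean. -/
theorem exists_levelSum_bound (hμ : ∀ i (m : ℕ), Integrable (fun y : ℝ => |y| ^ m) (μ i))
    (lev : ι → ℕ) (a : ι → ℝ) (h0 : ∀ i, a i ≠ 0 → ∫ y, y ∂μ i = 0)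
    (h1 : ∀ i, a i ≠ 0 → ∫ y, y ^ 2 ∂μ i = 1) (n : ℕ) {δ : ℝ} (hδ : 0 < δ)
    (hV : 8 * ∑ i, a i ^ 2 ≤ δ ^ 2) :
    ∃ N : (ι → ℝ) → ℝ, PolyGrowth N ∧ (∀ x, 0 ≤ N x) ∧
      (∀ x, ∀ m ≤ n, |levelSum lev a m x| ≤ N x) ∧ ∫ x, N x ∂Measure.pi μ ≤ δ := by
  have p1 := polyGrowth_runningMax lev a n
  have p2 := polyGrowth_runningMax lev (fun i => -a i) n
  have b1 := integral_runningMax_sq_le hμ lev a h0 h1 n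
  have b2 := integral_runningMax_sq_le hμ lev (fun i => -a i) (fun i hi => h0 i (by simpa using hi))
    (fun i hi => h1 i (by simpa using hi)) n
  simp only [neg_sq] at b2
  have hneg : ∀ m x, levelSum lev (fun i => -a i) m x = -levelSum lev a m x := fun m x => by
    simp [levelSum]
  have q1 := (p1.pow 2).integrable hμ
  have q2 := (p2.pow 2).integrable hμ
  refine ⟨_, p1.sup p2, fun x => (runningMax_nonneg _ _).trans (le_max_left _ _),
    fun x m hm => ?_, ?_⟩
  · rw [abs_le]
    have e1 := le_runningMax (s := fun k => levelSum lev a k x) (by simp [levelSum]) hm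
    have e2 := le_runningMax (s := fun k => levelSum lev (fun i => -a i) k x)
      (by simp [levelSum]) hm
    simp only [hneg] at e2
    constructor
    · have := e2.trans (le_max_right (runningMax (fun k => levelSum lev a k x) n) _)
      simp only [hneg]
      linarith
    · exact e1.trans (le_max_left _ _)
  · have e : ∀ x, max (runningMax (fun k => levelSum lev a k x) n)
        (runningMax (fun k => levelSum lev (fun i => -a i) k x) n)
        ≤ δ / 2 + (1 / (2 * δ)) * (runningMax (fun k => levelSum lev a k x) n ^ 2
          + runningMax (fun k => levelSum lev (fun i => -a i) k x) n ^ 2) := by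
      intro x
      set A := runningMax (fun k => levelSum lev a k x) n
      set B := runningMax (fun k => levelSum lev (fun i => -a i) k x) n
      rw [show δ / 2 + (1 / (2 * δ)) * (A ^ 2 + B ^ 2) = (δ ^ 2 + A ^ 2 + B ^ 2) / (2 * δ) by
        field_simp; ring, le_div_iff₀ (by positivity)]
      rcases max_cases A B with h | h <;> rw [h.1] <;>
        nlinarith [sq_nonneg (A - δ), sq_nonneg (B - δ), sq_nonneg A, sq_nonneg B]
    have q12 : Integrable (fun x => runningMax (fun k => levelSum lev a k x) n ^ 2
          + runningMax (fun k => levelSum lev (fun i => -a i) k x) n ^ 2) (Measure.pi μ) := q1.add q2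
    refine (integral_mono (μ := Measure.pi μ) ((p1.sup p2).integrable hμ)
      (g := fun x => δ / 2 + (1 / (2 * δ)) * (runningMax (fun k => levelSum lev a k x) n ^ 2
          + runningMax (fun k => levelSum lev (fun i => -a i) k x) n ^ 2))
      ((integrable_const _).add (q12.const_mul _)) e).trans ?_
    rw [integral_add (integrable_const _) (q12.const_mul _), integral_const_mul, integral_add q1 q2]
    simp only [integral_const, probReal_univ, one_smul]
    have : 1 / (2 * δ) * (∫ x, runningMax (fun k => levelSum lev a k x) n ^ 2 ∂Measure.pi μ
        + ∫ x, runningMax (fun k => levelSum lev (fun i => -a i) k x) n ^ 2 ∂Measure.pi μ)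
        ≤ 1 / (2 * δ) * δ ^ 2 := by
      refine mul_le_mul_of_nonneg_left ?_ (by positivity)
      linarith
    have e2 : 1 / (2 * δ) * δ ^ 2 = δ / 2 := by field_simp
    linarith

end

/-! ### Paths depending on `⌊n t⌋` only -/

noncomputable section

theorem revealed_le (n : ℕ) (t : I) : revealed n t ≤ n := by
  refine Nat.floor_le_of_le ?_
  have := mul_le_mul_of_nonneg_left t.2.2 (Nat.cast_nonneg (α := ℝ) n)
  simpa using this

/-- The path with value `a ⌊n t⌋` at time `t`. -/
def stepPath (n : ℕ) : (ℕ → EuclideanSpace ℝ (Fin 2)) →ₗ[ℝ] SkorokhodD 2 where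
  toFun a := ofCadlag _ (isCadlag_revealed n a)
  map_add' _ _ := rfl
  map_smul' _ _ := rfl

theorem stepPath_apply (n : ℕ) (a : ℕ → EuclideanSpace ℝ (Fin 2)) (t : I) :
    (stepPath n a).1 t = a (revealed n t) := rfl

theorem norm_stepPath_le {n : ℕ} {a : ℕ → EuclideanSpace ℝ (Fin 2)} {C : ℝ} (hC : 0 ≤ C)
    (h : ∀ m ≤ n, ‖a m‖ ≤ C) : ‖stepPath n a‖ ≤ C :=
  lp.norm_le_of_forall_le hC fun t => h _ (revealed_le n t)

theorem norm_pair (a b : ℝ) : ‖(!₂[a, b] : EuclideanSpace ℝ (Fin 2))‖ = √(a ^ 2 + b ^ 2) := by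
  simp [EuclideanSpace.norm_eq]

/-! ### Edges and two-stars -/

/-- The least number of revealed vertices that reveals the edge `e`, minus one. -/
def edgeLevel {n : ℕ} (e : Sym2 (Fin n)) : ℕ :=
  Sym2.lift ⟨fun i j => max i.val j.val, fun _ _ => max_comm _ _⟩ e

/-- The indicator that `e` is a potential edge between two of the first `m` vertices. -/
def edgeIn {n : ℕ} (e : Sym2 (Fin n)) (m : ℕ) : ℝ :=
  open Classical in if ¬ e.IsDiag ∧ edgeLevel e < m then 1 else 0

/-- Triples `(i, j, k)` representing the two-star with centre `j` and leaves `i < k`. -/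
def IsStar {n : ℕ} (s : Fin n × Fin n × Fin n) : Prop := s.1 < s.2.2 ∧ s.1 ≠ s.2.1 ∧ s.2.1 ≠ s.2.2

def starLevel {n : ℕ} (s : Fin n × Fin n × Fin n) : ℕ := max s.1.val (max s.2.1.val s.2.2.val)

/-- The indicator that `s` represents a two-star among the first `m` vertices. -/
def starIn {n : ℕ} (s : Fin n × Fin n × Fin n) (m : ℕ) : ℝ :=
  open Classical in if IsStar s ∧ starLevel s < m then 1 else 0

/-- The two edges of a two-star. -/
def leftEdge {n : ℕ} (s : Fin n × Fin n × Fin n) : Sym2 (Fin n) := s(s.1, s.2.1)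

def rightEdge {n : ℕ} (s : Fin n × Fin n × Fin n) : Sym2 (Fin n) := s(s.2.1, s.2.2)

theorem leftEdge_ne_rightEdge {n : ℕ} {s : Fin n × Fin n × Fin n} (hs : IsStar s) :
    leftEdge s ≠ rightEdge s := by
  obtain ⟨i, j, k⟩ := s
  obtain ⟨h1, h2, h3⟩ := hs
  simp only [leftEdge, rightEdge, ne_eq, Sym2.eq_iff] at *
  rintro (⟨h, -⟩ | ⟨h, -⟩)
  · exact h2 h
  · exact h1.ne h

/-- A two-star is determined by its edges. -/
theorem IsStar.eq_of_edges {n : ℕ} {s s' : Fin n × Fin n × Fin n} (hs : IsStar s)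
    (hs' : IsStar s')
    (h : (leftEdge s' = leftEdge s ∧ rightEdge s' = rightEdge s) ∨
      (leftEdge s' = rightEdge s ∧ rightEdge s' = leftEdge s)) : s' = s := by
  obtain ⟨i, j, k⟩ := s
  obtain ⟨i', j', k'⟩ := s'
  obtain ⟨h1, h2, h3⟩ := hs
  obtain ⟨h1', h2', h3'⟩ := hs'
  simp only [leftEdge, rightEdge, Sym2.eq_iff, Prod.mk.injEq] at *
  grind

/-- The responses of the path to the edge variables, the products of edge variables, and the
additional noise. -/
def edgePath (n : ℕ) (p : ℝ) (e : Sym2 (Fin n)) : SkorokhodD 2 :=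
  stepPath n fun m => (((m : ℝ) - 2) / (n : ℝ) ^ 2 * edgeIn e m) • !₂[1, 2 * p]

def starPath (n : ℕ) (s : Fin n × Fin n × Fin n) : SkorokhodD 2 :=
  stepPath n fun m => (1 / (n : ℝ) ^ 2 * starIn s m) • !₂[0, 1]

def noisePath (n : ℕ) (e : Sym2 (Fin n)) : SkorokhodD 2 :=
  stepPath n fun m => (√(2 / (n : ℝ) ^ 5) * ((m : ℝ) - 2) * edgeIn e m) • !₂[0, 1]

theorem starPath_eq_zero {n : ℕ} {s : Fin n × Fin n × Fin n} (hs : ¬ IsStar s) :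
    starPath n s = 0 := by
  have : (fun m : ℕ => (1 / (n : ℝ) ^ 2 * starIn s m) • (!₂[0, 1] : EuclideanSpace ℝ (Fin 2)))
      = 0 := by
    ext1 m
    simp [starIn, hs]
  rw [starPath, this, map_zero]

theorem two_le_of_edgeLevel_lt {n : ℕ} {e : Sym2 (Fin n)} {m : ℕ} (he : ¬ e.IsDiag)
    (hm : edgeLevel e < m) : 2 ≤ m := by
  induction e using Sym2.ind with
  | _ i j =>
    simp only [Sym2.mk_isDiag_iff, edgeLevel, Sym2.lift_mk, Fin.ext_iff] at *
    omega

theorem abs_sub_two_le {m n : ℕ} (h2 : 2 ≤ m) (hm : m ≤ n) : |(m : ℝ) - 2| ≤ n := by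
  have h2' : (2 : ℝ) ≤ m := by exact_mod_cast h2
  have hm' : (m : ℝ) ≤ n := by exact_mod_cast hm
  rw [abs_of_nonneg (by linarith)]
  linarith

theorem abs_mul_edgeIn_le {m n : ℕ} (e : Sym2 (Fin n)) (hm : m ≤ n) :
    |((m : ℝ) - 2) * edgeIn e m| ≤ n := by
  by_cases h : ¬ e.IsDiag ∧ edgeLevel e < m
  · simp only [edgeIn, h, not_false_eq_true, and_self, if_true, mul_one]
    exact abs_sub_two_le (two_le_of_edgeLevel_lt h.1 h.2) hm
  · simp [edgeIn, h]

theorem sqrt_one_add_le (p : I) : √((1 : ℝ) ^ 2 + (2 * (p : ℝ)) ^ 2) ≤ 9 / 4 := by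
  refine Real.sqrt_le_iff.2 ⟨by norm_num, ?_⟩
  nlinarith [p.2.1, p.2.2]

theorem norm_edgePath_le {n : ℕ} (hn : 1 ≤ n) (p : I) (e : Sym2 (Fin n)) :
    ‖edgePath n p e‖ ≤ 9 / 4 / n := by
  have hn' : (0 : ℝ) < n := by exact_mod_cast hn
  refine norm_stepPath_le (by positivity) fun m hm => ?_
  rw [norm_smul, norm_pair, Real.norm_eq_abs, div_mul_eq_mul_div, abs_div,
    abs_of_pos (pow_pos hn' 2)]
  calc |((m : ℝ) - 2) * edgeIn e m| / (n : ℝ) ^ 2 * √((1 : ℝ) ^ 2 + (2 * (p : ℝ)) ^ 2)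
      ≤ (n : ℝ) / (n : ℝ) ^ 2 * (9 / 4) := by
        gcongr
        · exact abs_mul_edgeIn_le e hm
        · exact sqrt_one_add_le p
    _ = 9 / 4 / (n : ℝ) := by field_simp

theorem starIn_mem {n : ℕ} (s : Fin n × Fin n × Fin n) (m : ℕ) : |starIn s m| ≤ 1 := by
  unfold starIn
  split_ifs <;> simp

theorem norm_starPath_le {n : ℕ} (s : Fin n × Fin n × Fin n) :
    ‖starPath n s‖ ≤ 1 / (n : ℝ) ^ 2 := by
  refine norm_stepPath_le (by positivity) fun m hm => ?_
  rw [norm_smul, norm_pair, Real.norm_eq_abs, abs_mul, abs_of_nonneg (by positivity)]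
  have := starIn_mem s m
  simp only [ne_eq, OfNat.ofNat_ne_zero, not_false_eq_true, zero_pow, one_pow, zero_add,
    Real.sqrt_one, mul_one]
  exact mul_le_of_le_one_right (by positivity) this

theorem norm_noisePath_sq_le {n : ℕ} (hn : 1 ≤ n) (e : Sym2 (Fin n)) :
    ‖noisePath n e‖ ^ 2 ≤ 2 / (n : ℝ) ^ 3 := by
  have hn' : (0 : ℝ) < n := by exact_mod_cast hn
  have h : ‖noisePath n e‖ ≤ √(2 / (n : ℝ) ^ 5) * n := by
    refine norm_stepPath_le (by positivity) fun m hm => ?_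
    rw [norm_smul, norm_pair, Real.norm_eq_abs, mul_assoc, abs_mul,
      abs_of_nonneg (Real.sqrt_nonneg _)]
    simp only [ne_eq, OfNat.ofNat_ne_zero, not_false_eq_true, zero_pow, one_pow, zero_add,
      Real.sqrt_one, mul_one]
    exact mul_le_mul_of_nonneg_left (abs_mul_edgeIn_le e hm) (Real.sqrt_nonneg _)
  calc ‖noisePath n e‖ ^ 2 ≤ (√(2 / (n : ℝ) ^ 5) * n) ^ 2 := by gcongr
    _ = 2 / (n : ℝ) ^ 3 := by
        rw [mul_pow, Real.sq_sqrt (by positivity)]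
        field_simp

/-! ### The law of the coordinates -/

/-- The law of a centred Bernoulli variable. -/
abbrev centredBernoulli (p : I) : Measure ℝ := bernoulliMeasure (1 - p : ℝ) (-p : ℝ) p

theorem integral_centredBernoulli (p : I) (f : ℝ → ℝ) :
    ∫ y, f y ∂centredBernoulli p = p * f (1 - p) + (1 - p) * f (-p) := by
  rw [integral_bernoulliMeasure]
  simp

theorem ae_centredBernoulli (p : I) :
    ∀ᵐ y ∂centredBernoulli p, y = 1 - (p : ℝ) ∨ y = -(p : ℝ) := by
  rw [centredBernoulli, bernoulliMeasure_def, ae_add_measure_iff]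
  constructor
  · refine Measure.ae_smul_measure ?_ _
    simp [ae_dirac_eq]
  · refine Measure.ae_smul_measure ?_ _
    simp [ae_dirac_eq]

theorem integrable_abs_pow_gaussianReal (m : ℕ) :
    Integrable (fun y : ℝ => |y| ^ m) (gaussianReal 0 1) := by
  have := (memLp_id_gaussianReal' (μ := 0) (v := 1) (m : ENNReal) (by simp)).integrable_norm_pow'
  simpa using this

theorem integral_sq_gaussianReal : ∫ y : ℝ, y ^ 2 ∂gaussianReal 0 1 = 1 := by
  have := variance_id_gaussianReal (μ := 0) (v := 1)
  rw [variance_of_integral_eq_zero aemeasurable_id (by simp)] at this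
  simpa using this

theorem integral_abs_cube_gaussianReal_le : ∫ y : ℝ, |y| ^ 3 ∂gaussianReal 0 1 ≤ 3 := by
  have i1 := integrable_exp_mul_gaussianReal (μ := 0) (v := 1) 1
  have i2 := integrable_exp_mul_gaussianReal (μ := 0) (v := 1) (-1)
  have e1 : ∀ t, ∫ y, Real.exp (t * y) ∂gaussianReal 0 1 = Real.exp (t ^ 2 / 2) := fun t => by
    have := congrFun (mgf_id_gaussianReal (μ := 0) (v := 1)) t
    simpa [mgf] using this
  have i3 : Integrable (fun y : ℝ => y ^ 2) (gaussianReal 0 1) := by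
    simpa using integrable_abs_pow_gaussianReal 2
  have key : ∀ y : ℝ, |y| ^ 3
      ≤ 6 * (Real.exp (1 * y) + Real.exp (-1 * y)) - 12 - 11 / 2 * y ^ 2 := by
    intro y
    have hc : 1 + y ^ 2 / 2 + y ^ 4 / 24 ≤ Real.cosh y := by
      have := sum_le_hasSum (Finset.range 3)
        (fun m _ => div_nonneg (by rw [pow_mul]; positivity) (by positivity)) (Real.hasSum_cosh y)
      simpa [Finset.sum_range_succ, Nat.factorial] using this
    rw [Real.cosh_eq] at hc
    have h3 : |y| ^ 3 ≤ (y ^ 2 + y ^ 4) / 2 := by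
      have e2 := sq_abs y
      have e4 : |y| ^ 4 = y ^ 4 := by rw [show 4 = 2 * 2 from rfl, pow_mul, pow_mul, sq_abs]
      rw [← e2, ← e4]
      nlinarith [sq_nonneg (|y| * (|y| - 1))]
    rw [one_mul, neg_one_mul]
    linarith
  have i12 : Integrable (fun y : ℝ => 6 * (Real.exp (1 * y) + Real.exp (-1 * y)))
    (gaussianReal 0 1) := (i1.add i2).const_mul 6
  have i12' : Integrable (fun y : ℝ => 6 * (Real.exp (1 * y) + Real.exp (-1 * y)) - 12)
    (gaussianReal 0 1) := i12.sub (integrable_const _)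
  refine (integral_mono (g := fun y => 6 * (Real.exp (1 * y) + Real.exp (-1 * y)) - 12
    - 11 / 2 * y ^ 2) (integrable_abs_pow_gaussianReal 3) (i12'.sub (i3.const_mul _)) key).trans ?_
  rw [integral_sub i12' (i3.const_mul _), integral_sub i12 (integrable_const _),
    integral_const_mul, integral_const_mul, integral_add i1 i2, e1, e1, integral_sq_gaussianReal]
  have : Real.exp (1 / 2) ≤ 1.7 := by
    have h1 : Real.exp (1 / 2) ^ 2 = Real.exp 1 := by rw [← Real.exp_nat_mul]; norm_num
    have h2 := Real.exp_one_lt_d9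
    nlinarith [Real.exp_pos (1 / 2)]
  norm_num at this ⊢
  linarith

/-- Coordinates: the edge variables, their Gaussian substitutes, the Gaussian substitutes of the
products of edge variables, and the additional noise. -/
abbrev Coord (n : ℕ) : Type :=
  Sym2 (Fin n) ⊕ (Sym2 (Fin n) ⊕ ((Fin n × Fin n × Fin n) ⊕ Sym2 (Fin n)))

abbrev bernCoord {n : ℕ} (e : Sym2 (Fin n)) : Coord n := .inl e
abbrev linCoord {n : ℕ} (e : Sym2 (Fin n)) : Coord n := .inr (.inl e)
abbrev quadCoord {n : ℕ} (s : Fin n × Fin n × Fin n) : Coord n := .inr (.inr (.inl s))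
abbrev noiseCoord {n : ℕ} (e : Sym2 (Fin n)) : Coord n := .inr (.inr (.inr e))

def coordLaw {n : ℕ} (p : I) : Coord n → Measure ℝ
  | .inl _ => centredBernoulli p
  | .inr _ => gaussianReal 0 1

instance {n : ℕ} (p : I) (i : Coord n) : IsProbabilityMeasure (coordLaw p i) := by
  rcases i with _ | _ <;> unfold coordLaw <;> infer_instance

theorem integrable_coordLaw {n : ℕ} (p : I) (i : Coord n) (m : ℕ) :
    Integrable (fun y : ℝ => |y| ^ m) (coordLaw p i) := by
  rcases i with _ | _
  · exact integrable_bernoulliMeasure _ _ _ _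
  · exact integrable_abs_pow_gaussianReal m

theorem integral_id_coordLaw {n : ℕ} (p : I) (i : Coord n) : ∫ y, y ∂coordLaw p i = 0 := by
  rcases i with _ | _
  · rw [coordLaw, integral_centredBernoulli]; ring
  · exact integral_id_gaussianReal

theorem integral_sq_bern {n : ℕ} (p : I) (e : Sym2 (Fin n)) :
    ∫ y, y ^ 2 ∂coordLaw p (bernCoord e) = p * (1 - p) := by
  rw [coordLaw, integral_centredBernoulli]; ring

theorem integral_sq_gauss {n : ℕ} (p : I) (i) :
    ∫ y, y ^ 2 ∂coordLaw (n := n) p (.inr i) = 1 := integral_sq_gaussianReal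

theorem ae_abs_bern_le {n : ℕ} (p : I) :
    ∀ᵐ x ∂Measure.pi (coordLaw (n := n) p), ∀ e, |x (bernCoord e)| ≤ 1 := by
  rw [ae_all_iff]
  intro e
  have := (measurePreserving_eval (coordLaw (n := n) p) (bernCoord e)).quasiMeasurePreserving.ae
    (ae_centredBernoulli p)
  filter_upwards [this] with x hx
  have h0 := p.2.1
  have h1 := p.2.2
  rcases hx with hx | hx <;> simp only [Function.eval] at hx <;> rw [hx, abs_le] <;>
    constructor <;> linarith

end

/-! ### Comparison of the models -/

noncomputable section

theorem Finset.sum_compl_eq_add {κ M : Type*} [Fintype κ] [DecidableEq κ] [AddCommMonoid M]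
    {T : Finset κ} {a : κ} (ha : a ∉ T) (f : κ → M) :
    ∑ s ∈ Tᶜ, f s = f a + ∑ s ∈ (insert a T)ᶜ, f s := by
  rw [Finset.compl_insert, Finset.add_sum_erase _ _ (Finset.mem_compl.2 ha)]

theorem Ignores.add {ι F : Type*} [DecidableEq ι] [Add F] {f f' : (ι → ℝ) → F} {i : ι}
    (hf : Ignores f i) (hf' : Ignores f' i) : Ignores (fun x => f x + f' x) i := fun x y =>
  congrArg₂ (· + ·) (hf x y) (hf' x y)

theorem Ignores.sum {ι κ F : Type*} [DecidableEq ι] [AddCommMonoid F] {s : Finset κ}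
    {f : κ → (ι → ℝ) → F} {i : ι} (hf : ∀ a ∈ s, Ignores (f a) i) :
    Ignores (fun x => ∑ a ∈ s, f a x) i := fun x y =>
  Finset.sum_congr rfl fun a ha => hf a ha x y

theorem ignores_eval {ι : Type*} [DecidableEq ι] {i j : ι} (hij : j ≠ i) :
    Ignores (fun x : ι → ℝ => x j) i := fun _ _ => Function.update_of_ne hij _ _

/-- `f` is a sum of a function ignoring the coordinate `i` and one ignoring `j`. -/
def NoMixed {ι F : Type*} [DecidableEq ι] [AddCommGroup F] (f : (ι → ℝ) → F) (i j : ι) : Prop :=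
  ∀ x, f x = f (Function.update x j 0) + f (Function.update x i 0)
    - f (Function.update (Function.update x i 0) j 0)

namespace NoMixed

variable {ι κ F : Type*} [DecidableEq ι] [AddCommGroup F] {i j : ι}

theorem of_left {f : (ι → ℝ) → F} (h : Ignores f i) : NoMixed f i j := fun x => by
  have := h.update j x 0
  simp only at this
  rw [this, h x 0]
  abel

theorem of_right {f : (ι → ℝ) → F} (h : Ignores f j) : NoMixed f i j := fun x => by
  rw [h, h]
  abel

theorem add {f f' : (ι → ℝ) → F} (h : NoMixed f i j) (h' : NoMixed f' i j) :
    NoMixed (fun x => f x + f' x) i j := fun x => by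
  simp only
  rw [h x, h' x]
  abel

theorem sum {s : Finset κ} {f : κ → (ι → ℝ) → F} (h : ∀ a ∈ s, NoMixed (f a) i j) :
    NoMixed (fun x => ∑ a ∈ s, f a x) i j := fun x => by
  simp only [← Finset.sum_add_distrib, ← Finset.sum_sub_distrib]
  exact Finset.sum_congr rfl fun a ha => h a ha x

end NoMixed

section Model

variable (n : ℕ) (p : I)

/-- The path with edges given by the Bernoulli coordinates, except that the products of edge
variables are kept only for the two-stars in `S` and replaced by Gaussian variables in `T`. -/
def mixedPath (S T : Finset (Fin n × Fin n × Fin n)) (x : Coord n → ℝ) : SkorokhodD 2 :=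
  ∑ e, x (bernCoord e) • edgePath n p e +
    (∑ s ∈ S, (x (bernCoord (leftEdge s)) * x (bernCoord (rightEdge s))) • starPath n s +
      ∑ s ∈ T, x (quadCoord s) • ((p : ℝ) * (1 - p)) • starPath n s)

/-- The linear part, with Gaussian variables for the edges in `T`, and Gaussian two-stars. -/
def linearPath (T : Finset (Sym2 (Fin n))) (x : Coord n → ℝ) : SkorokhodD 2 :=
  (∑ e ∈ Tᶜ, x (bernCoord e) • edgePath n p e +
      ∑ e ∈ T, x (linCoord e) • √((p : ℝ) * (1 - p)) • edgePath n p e) +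
    ∑ s, x (quadCoord s) • ((p : ℝ) * (1 - p)) • starPath n s

/-- The Gaussian path, with noise for the edges in `T`. -/
def gaussPath (T : Finset (Sym2 (Fin n))) (x : Coord n → ℝ) : SkorokhodD 2 :=
  (∑ e, x (linCoord e) • √((p : ℝ) * (1 - p)) • edgePath n p e +
      ∑ s, x (quadCoord s) • ((p : ℝ) * (1 - p)) • starPath n s) +
    ∑ e ∈ T, x (noiseCoord e) • noisePath n e

variable {n p}

theorem polyGrowth_smul_const {ι F : Type*} [Fintype ι] [NormedAddCommGroup F] [NormedSpace ℝ F]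
    (i : ι) (v : F) : PolyGrowth fun x : ι → ℝ => x i • v := (PolyGrowth.eval i).smul (.const v)

theorem polyGrowth_mixedPath (S T : Finset (Fin n × Fin n × Fin n)) :
    PolyGrowth (mixedPath n p S T) :=
  (PolyGrowth.sum _ fun _ _ => polyGrowth_smul_const _ _).add
    ((PolyGrowth.sum _ fun _ _ => ((PolyGrowth.eval _).mul (PolyGrowth.eval _)).smul (.const _)).add
      (PolyGrowth.sum _ fun _ _ => polyGrowth_smul_const _ _))

theorem polyGrowth_gaussPath (T : Finset (Sym2 (Fin n))) : PolyGrowth (gaussPath n p T) :=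
  ((PolyGrowth.sum _ fun _ _ => polyGrowth_smul_const _ _).add
    (PolyGrowth.sum _ fun _ _ => polyGrowth_smul_const _ _)).add
      (PolyGrowth.sum _ fun _ _ => polyGrowth_smul_const _ _)

theorem card_pairs_le (e : Sym2 (Fin n)) :
    ∑ i : Fin n, ∑ j : Fin n, (if s(i, j) = e then (1 : ℝ) else 0) ≤ 2 := by
  rw [← Fintype.sum_prod_type' (f := fun i j : Fin n => if s(i, j) = e then (1 : ℝ) else 0),
    Finset.sum_boole]
  induction e using Sym2.ind with
  | _ a b =>
    have : (Finset.univ.filter fun z : Fin n × Fin n => s(z.1, z.2) = s(a, b))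
        ⊆ {(a, b), (b, a)} := by
      rintro ⟨i, j⟩ h
      simp only [Finset.mem_filter, Finset.mem_univ, true_and, Sym2.eq_iff] at h
      simpa [Prod.ext_iff] using h
    exact_mod_cast (Finset.card_le_card this).trans Finset.card_le_two

theorem sum_incident_le (e : Sym2 (Fin n)) :
    ∑ s : Fin n × Fin n × Fin n, ((if leftEdge s = e then (1 : ℝ) else 0)
      + if rightEdge s = e then 1 else 0) ≤ 4 * n := by
  let F : Fin n → Fin n → ℝ := fun i j => if s(i, j) = e then 1 else 0
  have h1 : ∑ s : Fin n × Fin n × Fin n, (if leftEdge s = e then (1 : ℝ) else 0)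
      = n * ∑ i : Fin n, ∑ j : Fin n, F i j := by
    have : ∀ s : Fin n × Fin n × Fin n, (if leftEdge s = e then (1 : ℝ) else 0) = F s.1 s.2.1 :=
      fun s => rfl
    simp only [this, Fintype.sum_prod_type, Finset.sum_const, Finset.card_univ, Fintype.card_fin,
      nsmul_eq_mul, Finset.mul_sum]
  have h2 : ∑ s : Fin n × Fin n × Fin n, (if rightEdge s = e then (1 : ℝ) else 0)
      = n * ∑ i : Fin n, ∑ j : Fin n, F i j := by
    have : ∀ s : Fin n × Fin n × Fin n, (if rightEdge s = e then (1 : ℝ) else 0)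
      = F s.2.1 s.2.2 := fun s => rfl
    simp only [this, Fintype.sum_prod_type, Finset.sum_const, Finset.card_univ, Fintype.card_fin,
      nsmul_eq_mul]
  rw [Finset.sum_add_distrib, h1, h2]
  have := mul_le_mul_of_nonneg_left (card_pairs_le e) (Nat.cast_nonneg (α := ℝ) n)
  simp only [F]
  linarith

/-- The response of the path to one edge. -/
theorem norm_mixedPath_sub_le (hn : 1 ≤ n) (S T : Finset (Fin n × Fin n × Fin n))
    (e : Sym2 (Fin n)) {x : Coord n → ℝ} (hx : ∀ e, |x (bernCoord e)| ≤ 1) :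
    ‖mixedPath n p S T x - mixedPath n p S T (Function.update x (bernCoord e) 0)‖
      ≤ 25 / 4 / n * |x (bernCoord e)| := by
  have hn' : (0 : ℝ) < n := by exact_mod_cast hn
  set x' := Function.update x (bernCoord e) 0 with hx'
  have hs : x' (bernCoord e) = 0 := Function.update_self _ _ _
  have ho : ∀ a, a ≠ e → x' (bernCoord a) = x (bernCoord a) := fun a ha =>
    Function.update_of_ne (by simpa using ha) _ _
  have hT : ∑ s ∈ T, x' (quadCoord s) • ((p : ℝ) * (1 - p)) • starPath n s
      = ∑ s ∈ T, x (quadCoord s) • ((p : ℝ) * (1 - p)) • starPath n s :=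
    Finset.sum_congr rfl fun s _ => by rw [hx', Function.update_of_ne (by simp)]
  have hE : ∑ a, x (bernCoord a) • edgePath n p a - ∑ a, x' (bernCoord a) • edgePath n p a
      = x (bernCoord e) • edgePath n p e := by
    rw [← Finset.sum_sub_distrib, Finset.sum_eq_single e]
    · rw [hs, zero_smul, sub_zero]
    · intro a _ ha
      rw [ho a ha, sub_self]
    · simp
  have hS : ‖∑ s ∈ S, (x (bernCoord (leftEdge s)) * x (bernCoord (rightEdge s))) • starPath n s
      - ∑ s ∈ S, (x' (bernCoord (leftEdge s)) * x' (bernCoord (rightEdge s))) • starPath n s‖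
      ≤ |x (bernCoord e)| / (n : ℝ) ^ 2 * (4 * n) := by
    rw [← Finset.sum_sub_distrib]
    calc _ ≤ ∑ s ∈ S, |x (bernCoord e)| / (n : ℝ) ^ 2 *
          ((if leftEdge s = e then (1 : ℝ) else 0) + if rightEdge s = e then 1 else 0) := by
          refine (norm_sum_le _ _).trans (Finset.sum_le_sum fun s _ => ?_)
          rw [← sub_smul, norm_smul, Real.norm_eq_abs]
          have h1 := norm_starPath_le s
          have h2 : |x (bernCoord (leftEdge s)) * x (bernCoord (rightEdge s))
              - x' (bernCoord (leftEdge s)) * x' (bernCoord (rightEdge s))|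
              ≤ |x (bernCoord e)| * ((if leftEdge s = e then (1 : ℝ) else 0)
                + if rightEdge s = e then 1 else 0) := by
            by_cases hl : leftEdge s = e
            · rw [hl, hs, zero_mul, sub_zero, abs_mul, if_pos rfl]
              have := hx (rightEdge s)
              refine mul_le_mul_of_nonneg_left (this.trans ?_) (abs_nonneg _)
              split_ifs <;> norm_num
            · by_cases hr : rightEdge s = e
              · rw [hr, hs, mul_zero, sub_zero, abs_mul, if_pos rfl, if_neg hl, mul_comm]
                refine mul_le_mul_of_nonneg_left ((hx (leftEdge s)).trans ?_) (abs_nonneg _)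
                norm_num
              · rw [ho _ hl, ho _ hr, sub_self, if_neg hl, if_neg hr]
                simp
          calc _ ≤ (|x (bernCoord e)| * ((if leftEdge s = e then (1 : ℝ) else 0)
                + if rightEdge s = e then 1 else 0)) * (1 / (n : ℝ) ^ 2) :=
                mul_le_mul h2 h1 (norm_nonneg _) ((abs_nonneg _).trans h2)
            _ = _ := by ring
      _ = |x (bernCoord e)| / (n : ℝ) ^ 2 * ∑ s ∈ S,
          ((if leftEdge s = e then (1 : ℝ) else 0) + if rightEdge s = e then 1 else 0) := by
          rw [Finset.mul_sum]
      _ ≤ _ := by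
          refine mul_le_mul_of_nonneg_left (le_trans ?_ (sum_incident_le e)) (by positivity)
          refine Finset.sum_le_sum_of_subset_of_nonneg (Finset.subset_univ _) fun s _ _ => ?_
          split_ifs <;> norm_num
  have key : mixedPath n p S T x - mixedPath n p S T x' = x (bernCoord e) • edgePath n p e +
      (∑ s ∈ S, (x (bernCoord (leftEdge s)) * x (bernCoord (rightEdge s))) • starPath n s
      - ∑ s ∈ S, (x' (bernCoord (leftEdge s)) * x' (bernCoord (rightEdge s))) • starPath n s) := by
    rw [mixedPath, mixedPath, hT, ← hE]
    abel
  rw [key]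
  refine (norm_add_le _ _).trans ((add_le_add (le_of_eq (norm_smul _ _)) hS).trans ?_)
  have h1 := mul_le_mul_of_nonneg_left (norm_edgePath_le hn p e) (abs_nonneg (x (bernCoord e)))
  have h2 : |x (bernCoord e)| / (n : ℝ) ^ 2 * (4 * n) = |x (bernCoord e)| * (4 / n) := by
    field_simp
  rw [h2, Real.norm_eq_abs]
  calc _ ≤ |x (bernCoord e)| * (9 / 4 / n) + |x (bernCoord e)| * (4 / n) := by linarith
    _ = _ := by ring

theorem noMixed_mixedPath {S T : Finset (Fin n × Fin n × Fin n)} {a : Fin n × Fin n × Fin n}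
    (ha : IsStar a) (haS : a ∉ S) :
    NoMixed (mixedPath n p S T) (bernCoord (leftEdge a)) (bernCoord (rightEdge a)) := by
  have hne := leftEdge_ne_rightEdge ha
  have hb : ∀ e f : Sym2 (Fin n), e ≠ f → Ignores (fun x : Coord n → ℝ => x (bernCoord e))
      (bernCoord f) := fun e f hef => ignores_eval (by simpa using hef)
  refine (NoMixed.sum fun e _ => ?_).add ((NoMixed.sum fun s hs => ?_).add
    (NoMixed.sum fun s _ => ?_))
  · by_cases he : e = leftEdge a
    · exact .of_right ((hb e _ (he ▸ hne)).comp fun c => c • edgePath n p e)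
    · exact .of_left ((hb e _ he).comp fun c => c • edgePath n p e)
  · by_cases hstar : IsStar s
    · have hsa : s ≠ a := fun h => haS (h ▸ hs)
      have hm : ∀ f, leftEdge s ≠ f → rightEdge s ≠ f → Ignores (fun x : Coord n → ℝ =>
          (x (bernCoord (leftEdge s)) * x (bernCoord (rightEdge s))) • starPath n s)
          (bernCoord f) := fun f h1 h2 x y => by
        have e1 := hb _ f h1 x y
        have e2 := hb _ f h2 x y
        simp only at e1 e2 ⊢
        rw [e1, e2]
      by_cases h1 : leftEdge s ≠ leftEdge a ∧ rightEdge s ≠ leftEdge a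
      · exact .of_left (hm _ h1.1 h1.2)
      · refine .of_right (hm _ (fun h => hsa (ha.eq_of_edges hstar (.inr ⟨h, ?_⟩)))
          fun h => hsa (ha.eq_of_edges hstar (.inl ⟨?_, h⟩)))
        · by_contra h2
          exact h1 ⟨fun h3 => hne (h3.symm.trans h), h2⟩
        · by_contra h2
          exact h1 ⟨h2, fun h3 => hne (h3.symm.trans h)⟩
    · refine .of_left fun x y => ?_
      simp only [starPath_eq_zero hstar, smul_zero]
  · exact .of_left ((ignores_eval (by simp)).comp
      fun c => c • ((p : ℝ) * (1 - p)) • starPath n s)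

variable {g : SkorokhodD 2 → ℝ} {c k : ℝ}

theorem variance_le (p : I) : (p : ℝ) * (1 - p) ≤ 1 / 4 := by nlinarith [sq_nonneg ((p : ℝ) - 1 / 2)]

theorem variance_nonneg (p : I) : 0 ≤ (p : ℝ) * (1 - p) :=
  mul_nonneg p.2.1 (by linarith [p.2.2])

/-- Replacing one product of edge variables. -/
theorem abs_mixedPath_step_le (hg : HasLipschitzHessian g c k) (hk : 0 ≤ k) (hn : 1 ≤ n)
    (T : Finset (Fin n × Fin n × Fin n)) (a : Fin n × Fin n × Fin n) (ha : a ∉ T) :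
    |∫ x, g (mixedPath n p (insert a T)ᶜ (insert a T) x) ∂Measure.pi (coordLaw p)
        - ∫ x, g (mixedPath n p Tᶜ T x) ∂Measure.pi (coordLaw p)| ≤ 6 * k / n / (n : ℝ) ^ 3 := by
  have hn' : (1 : ℝ) ≤ n := by exact_mod_cast hn
  have e1 : ∀ x, mixedPath n p (insert a T)ᶜ (insert a T) x = mixedPath n p (insert a T)ᶜ T x
      + x (quadCoord a) • ((p : ℝ) * (1 - p)) • starPath n a := fun x => by
    rw [mixedPath, mixedPath, Finset.sum_insert ha]
    abel
  have e2 : ∀ x, mixedPath n p Tᶜ T x = mixedPath n p (insert a T)ᶜ T x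
      + (x (bernCoord (leftEdge a)) * x (bernCoord (rightEdge a))) • starPath n a := fun x => by
    rw [mixedPath, mixedPath, Finset.sum_compl_eq_add ha]
    abel
  simp only [e1, e2]
  by_cases hstar : IsStar a
  swap
  · simp only [starPath_eq_zero hstar, smul_zero, add_zero, sub_self, abs_zero]
    positivity
  have hne := leftEdge_ne_rightEdge hstar
  have hmem : a ∉ (insert a T)ᶜ := by simp
  set U := mixedPath n p (insert a T)ᶜ T
  have hj : Ignores U (quadCoord a) := by
    refine (Ignores.sum fun e _ => ?_).add ((Ignores.sum fun s _ => ?_).add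
      (Ignores.sum fun s hs => ?_))
    · exact (ignores_eval (by simp)).comp fun c => c • edgePath n p e
    · intro x y
      simp only [Function.update_of_ne (show bernCoord (leftEdge s) ≠ quadCoord a by simp),
        Function.update_of_ne (show bernCoord (rightEdge s) ≠ quadCoord a by simp)]
    · have : s ≠ a := fun h => ha (h ▸ hs)
      exact (ignores_eval (by simpa using this)).comp
        fun c => c • ((p : ℝ) * (1 - p)) • starPath n s
  have h := hg.abs_integral_swap_mul_le hk (integrable_coordLaw p)
    (polyGrowth_mixedPath (p := p) (insert a T)ᶜ T)
    (e := bernCoord (leftEdge a)) (f := bernCoord (rightEdge a)) (j := quadCoord a)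
    (by simpa using hne) hj (integral_id_coordLaw p _) (integral_id_coordLaw p _)
    (integral_id_coordLaw p _) (variance_nonneg p) (integral_sq_bern p _) (integral_sq_bern p _)
    (integral_sq_gauss p _) (noMixed_mixedPath hstar hmem) (A := 25 / 4 / n) (by positivity)
    (by
      filter_upwards [ae_abs_bern_le (n := n) p] with x hx
      have hu : ∀ f e : Sym2 (Fin n), |Function.update x (bernCoord f) 0 (bernCoord e)| ≤ 1 := by
        intro f e
        rcases eq_or_ne e f with rfl | hef
        · simp
        · rw [Function.update_of_ne (by simpa using hef)]; exact hx e
      refine ⟨hx _, hx _, ?_, ?_⟩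
      · have := norm_mixedPath_sub_le (p := p) hn (insert a T)ᶜ T (leftEdge a) (hu (rightEdge a))
        rwa [Function.update_comm (by simpa using hne.symm), Function.update_of_ne
          (by simpa using hne)] at this
      · have := norm_mixedPath_sub_le (p := p) hn (insert a T)ᶜ T (rightEdge a) (hu (leftEdge a))
        rwa [Function.update_of_ne (by simpa using hne.symm)] at this) (starPath n a)
  rw [abs_sub_comm]
  refine h.trans ?_
  have hv0 := variance_nonneg p
  have hv := variance_le p
  have h3 : ∫ y, |y| ^ 3 ∂coordLaw p (quadCoord a) ≤ 3 := integral_abs_cube_gaussianReal_le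
  have h30 : 0 ≤ ∫ y, |y| ^ 3 ∂coordLaw p (quadCoord a) :=
    integral_nonneg fun y => by positivity
  have hr := norm_starPath_le a
  set v := (p : ℝ) * (1 - p)
  set M := ∫ y, |y| ^ 3 ∂coordLaw p (quadCoord a)
  calc _ ≤ k * (1 / 4) ^ 2 * (2 * (25 / 4 / (n : ℝ)) ^ 2 * (1 / (n : ℝ) ^ 2)
        + 2 * (25 / 4 / (n : ℝ)) * (1 / (n : ℝ) ^ 2) ^ 2
        + (1 / (n : ℝ) ^ 2) ^ 3 / 6 * (1 + 1 / 4 * 3)) := by gcongr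
    _ = k / (n : ℝ) ^ 4 * (1 / 16 * (2 * (25 / 4) ^ 2 + 2 * (25 / 4) * (1 / n)
        + 1 / 6 * (1 / n) ^ 2 * (7 / 4))) := by field_simp; ring
    _ ≤ k / (n : ℝ) ^ 4 * 6 := by
        refine mul_le_mul_of_nonneg_left ?_ (by positivity)
        have i1 : (1 : ℝ) / n ≤ 1 := by rw [div_le_one (by linarith)]; exact hn'
        have i2 : ((1 : ℝ) / n) ^ 2 ≤ 1 := pow_le_one₀ (by positivity) i1
        linarith
    _ = _ := by field_simp

/-- Replacing one edge variable. -/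
theorem abs_linearPath_step_le (hg : HasLipschitzHessian g c k) (hk : 0 ≤ k) (hn : 1 ≤ n)
    (T : Finset (Sym2 (Fin n))) (a : Sym2 (Fin n)) (ha : a ∉ T) :
    |∫ x, g (linearPath n p (insert a T) x) ∂Measure.pi (coordLaw p)
        - ∫ x, g (linearPath n p T x) ∂Measure.pi (coordLaw p)| ≤ 2 * k / n / (n : ℝ) ^ 2 := by
  have hn' : (0 : ℝ) < n := by exact_mod_cast hn
  set v := (p : ℝ) * (1 - p) with hvdef
  have hv0 : 0 ≤ v := variance_nonneg p
  have hv : v ≤ 1 / 4 := variance_le p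
  let U : (Coord n → ℝ) → SkorokhodD 2 := fun x =>
    (∑ e ∈ (insert a T)ᶜ, x (bernCoord e) • edgePath n p e +
      ∑ e ∈ T, x (linCoord e) • √v • edgePath n p e) + ∑ s, x (quadCoord s) • v • starPath n s
  have e1 : ∀ x, linearPath n p (insert a T) x = U x + x (linCoord a) • √v • edgePath n p a :=
    fun x => by
      rw [linearPath, Finset.sum_insert ha]
      simp only [U, hvdef]
      abel
  have e2 : ∀ x, linearPath n p T x = U x + x (bernCoord a) • edgePath n p a := fun x => by
    rw [linearPath, Finset.sum_compl_eq_add ha]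
    simp only [U, hvdef]
    abel
  have hU : PolyGrowth U := ((PolyGrowth.sum _ fun _ _ => polyGrowth_smul_const _ _).add
    (PolyGrowth.sum _ fun _ _ => polyGrowth_smul_const _ _)).add
      (PolyGrowth.sum _ fun _ _ => polyGrowth_smul_const _ _)
  have hi : Ignores U (bernCoord a) := by
    refine ((Ignores.sum fun e he => ?_).add (Ignores.sum fun e _ => ?_)).add
      (Ignores.sum fun s _ => ?_)
    · have : e ≠ a := fun h => by simp [h] at he
      exact (ignores_eval (by simpa using this)).comp fun c => c • edgePath n p e
    · exact (ignores_eval (by simp)).comp fun c => c • √v • edgePath n p e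
    · exact (ignores_eval (by simp)).comp fun c => c • v • starPath n s
  have hj : Ignores U (linCoord a) := by
    refine ((Ignores.sum fun e _ => ?_).add (Ignores.sum fun e he => ?_)).add
      (Ignores.sum fun s _ => ?_)
    · exact (ignores_eval (by simp)).comp fun c => c • edgePath n p e
    · have : e ≠ a := fun h => ha (h ▸ he)
      exact (ignores_eval (by simpa using this)).comp fun c => c • √v • edgePath n p e
    · exact (ignores_eval (by simp)).comp fun c => c • v • starPath n s
  simp only [e1, e2]
  rw [abs_sub_comm]
  refine (hg.abs_integral_swap_le (integrable_coordLaw p) hU hi hj (integral_id_coordLaw p _)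
    (integral_id_coordLaw p _) (Real.sqrt_nonneg v)
    (by rw [integral_sq_bern, integral_sq_gauss, Real.sq_sqrt hv0, mul_one]) _).trans ?_
  have h3 : ∫ y, |y| ^ 3 ∂coordLaw p (linCoord a) ≤ 3 := integral_abs_cube_gaussianReal_le
  have h3' : ∫ y, |y| ^ 3 ∂coordLaw p (bernCoord a) ≤ 1 / 4 := by
    refine le_trans ?_ hv
    rw [hvdef, ← integral_sq_bern p a]
    refine integral_mono_ae (integrable_coordLaw p _ 3)
      (by simpa using integrable_coordLaw p (bernCoord a) 2) ?_
    filter_upwards [ae_centredBernoulli p] with y hy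
    have h1 : |y| ≤ 1 := by
      rw [abs_le]
      rcases hy with rfl | rfl <;> constructor <;> linarith [p.2.1, p.2.2]
    rw [← sq_abs y]
    exact pow_le_pow_of_le_one (abs_nonneg _) h1 (by norm_num)
  have h30 : 0 ≤ ∫ y, |y| ^ 3 ∂coordLaw p (linCoord a) := integral_nonneg fun y => by positivity
  have hs : √v ≤ 1 / 2 := by
    rw [Real.sqrt_le_iff]
    constructor <;> [norm_num; linarith]
  have hr := norm_edgePath_le hn p a
  calc _ ≤ k / 6 * (9 / 4 / (n : ℝ)) ^ 3 * (1 / 4 + (1 / 2) ^ 3 * 3) := by gcongr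
    _ = k / (n : ℝ) ^ 3 * (1 / 6 * (9 / 4) ^ 3 * (5 / 8)) := by ring
    _ ≤ k / (n : ℝ) ^ 3 * 2 := by
        refine mul_le_mul_of_nonneg_left ?_ (by positivity)
        norm_num
    _ = _ := by field_simp

end Model

end

noncomputable section

section Noise

variable {n : ℕ} {p : I}

/-- The number of vertices, minus one, that reveals a coordinate. -/
def coordLevel : Coord n → ℕ :=
  Sum.elim edgeLevel (Sum.elim edgeLevel (Sum.elim starLevel edgeLevel))

theorem card_edges_le (n : ℕ) : (Fintype.card (Sym2 (Fin n)) : ℝ) ≤ (n : ℝ) ^ 2 := by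
  have := Fintype.card_le_of_surjective (fun z : Fin n × Fin n => s(z.1, z.2)) fun e => by
    induction e using Sym2.ind with
    | _ i j => exact ⟨(i, j), rfl⟩
  simp only [Fintype.card_prod, Fintype.card_fin] at this
  rw [sq]
  exact_mod_cast this

theorem card_stars (n : ℕ) : (Fintype.card (Fin n × Fin n × Fin n) : ℝ) = (n : ℝ) ^ 3 := by
  simp only [Fintype.card_prod, Fintype.card_fin]
  push_cast
  ring

theorem mul_sum_edgeIn_le (y : Sym2 (Fin n) → ℝ) {m : ℕ} (hm : m ≤ n) {N : ℝ}
    (hN : |∑ e, edgeIn e m * y e| ≤ N) : |((m : ℝ) - 2) * ∑ e, edgeIn e m * y e| ≤ n * N := by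
  by_cases h2 : 2 ≤ m
  · rw [abs_mul]
    exact mul_le_mul (abs_sub_two_le h2 hm) hN (abs_nonneg _) (Nat.cast_nonneg _)
  · have : ∀ e : Sym2 (Fin n), edgeIn e m = 0 := fun e => by
      rw [edgeIn, if_neg fun h => h2 (two_le_of_edgeLevel_lt h.1 h.2)]
    simp only [this, zero_mul, Finset.sum_const_zero, mul_zero, abs_zero]
    exact mul_nonneg (Nat.cast_nonneg _) ((abs_nonneg _).trans hN)

open Classical in
/-- Partial sums of Gaussian edge variables are dominated by a variable of mean at most `3 n`. -/
theorem exists_edgeSum_bound (hn : 1 ≤ n) (p : I) (T : Finset (Sym2 (Fin n)))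
    (φ : Sym2 (Fin n) → Coord n) (hφ : φ = linCoord ∨ φ = noiseCoord) :
    ∃ N : (Coord n → ℝ) → ℝ, PolyGrowth N ∧ (∀ x, 0 ≤ N x) ∧
      (∀ x, ∀ m ≤ n, |∑ e, edgeIn e m * (if e ∈ T then x (φ e) else 0)| ≤ N x) ∧
      ∫ x, N x ∂Measure.pi (coordLaw p) ≤ 3 * n := by
  have hn' : (0 : ℝ) < n := by exact_mod_cast hn
  let b : Sym2 (Fin n) → ℝ := fun e => if ¬ e.IsDiag ∧ e ∈ T then 1 else 0
  let a : Coord n → ℝ :=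
    if φ = linCoord then Sum.elim 0 (Sum.elim b 0) else Sum.elim 0 (Sum.elim 0 (Sum.elim 0 b))
  have ha1 : ∀ i, a i ≠ 0 → ∫ y, y ^ 2 ∂coordLaw p i = 1 := by
    rintro (i | i) hi
    · exfalso
      simp only [a] at hi
      split_ifs at hi <;> simp at hi
    · exact integral_sq_gauss p i
  have hb : ∑ e, b e ^ 2 ≤ (n : ℝ) ^ 2 := by
    refine le_trans ?_ (card_edges_le n)
    rw [← Finset.card_univ, ← nsmul_one, ← Finset.sum_const]
    refine Finset.sum_le_sum fun e _ => ?_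
    simp only [b]
    split_ifs <;> norm_num
  have ha : ∑ i, a i ^ 2 ≤ (n : ℝ) ^ 2 := by
    refine le_trans (le_of_eq ?_) hb
    simp only [a]
    split_ifs <;> simp [Fintype.sum_sum_type]
  obtain ⟨N, h1, h2, h3, h4⟩ := exists_levelSum_bound (integrable_coordLaw p) coordLevel a
    (fun i _ => integral_id_coordLaw p i) ha1 n (δ := 3 * n) (by positivity) (by nlinarith)
  refine ⟨N, h1, h2, fun x m hm => ?_, h4⟩
  convert h3 x m hm using 2
  have hc : ∀ e : Sym2 (Fin n), edgeIn e m * (if e ∈ T then x (φ e) else 0)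
      = if edgeLevel e < m then b e * x (φ e) else 0 := fun e => by
    simp only [edgeIn, b]
    by_cases h1 : e.IsDiag <;> by_cases h2 : e ∈ T <;> by_cases h3 : edgeLevel e < m <;>
      simp [h1, h2, h3]
  simp only [hc, levelSum, Finset.sum_filter, a]
  rcases hφ with rfl | rfl
  · simp [Fintype.sum_sum_type, coordLevel]
    congr!
  · have : ¬ (noiseCoord (n := n) = linCoord) := fun h => by
      have := congrFun h s(⟨0, hn⟩, ⟨0, hn⟩)
      simp at this
    simp [Fintype.sum_sum_type, coordLevel, this]
    congr!

open Classical in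
theorem exists_starSum_bound (hn : 1 ≤ n) (p : I) :
    ∃ N : (Coord n → ℝ) → ℝ, PolyGrowth N ∧ (∀ x, 0 ≤ N x) ∧
      (∀ x, ∀ m ≤ n, |∑ s, starIn s m * x (quadCoord s)| ≤ N x) ∧
      ∫ x, N x ∂Measure.pi (coordLaw p) ≤ 3 * (n : ℝ) ^ 2 := by
  have hn' : (1 : ℝ) ≤ n := by exact_mod_cast hn
  let b : (Fin n × Fin n × Fin n) → ℝ := fun s => if IsStar s then 1 else 0
  let a : Coord n → ℝ := Sum.elim 0 (Sum.elim 0 (Sum.elim b 0))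
  have ha1 : ∀ i, a i ≠ 0 → ∫ y, y ^ 2 ∂coordLaw p i = 1 := by
    rintro (i | i) hi
    · simp [a] at hi
    · exact integral_sq_gauss p i
  have ha : ∑ i, a i ^ 2 ≤ (n : ℝ) ^ 3 := by
    have : ∑ i, a i ^ 2 = ∑ s, b s ^ 2 := by simp [a, Fintype.sum_sum_type]
    rw [this, ← card_stars, ← Finset.card_univ, ← nsmul_one, ← Finset.sum_const]
    refine Finset.sum_le_sum fun e _ => ?_
    simp only [b]
    split_ifs <;> norm_num
  have hn3 : (n : ℝ) ^ 3 ≤ (n : ℝ) ^ 4 := pow_le_pow_right₀ hn' (by norm_num)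
  obtain ⟨N, h1, h2, h3, h4⟩ := exists_levelSum_bound (integrable_coordLaw p) coordLevel a
    (fun i _ => integral_id_coordLaw p i) ha1 n (δ := 3 * (n : ℝ) ^ 2) (by positivity)
    (by
      have : (3 * (n : ℝ) ^ 2) ^ 2 = 9 * (n : ℝ) ^ 4 := by ring
      have : (0 : ℝ) ≤ (n : ℝ) ^ 4 := by positivity
      linarith)
  refine ⟨N, h1, h2, fun x m hm => ?_, h4⟩
  convert h3 x m hm using 2
  have hc : ∀ s : Fin n × Fin n × Fin n, starIn s m * x (quadCoord s)
      = if starLevel s < m then b s * x (quadCoord s) else 0 := fun s => by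
    simp only [starIn, b]
    by_cases h1 : IsStar s <;> by_cases h3 : starLevel s < m <;> simp [h1, h3]
  simp only [hc, levelSum, Finset.sum_filter, a]
  simp [Fintype.sum_sum_type, coordLevel]
  congr!

/-- A linear combination of step paths with a common direction. -/
theorem sum_smul_stepPath {κ : Type*} (S : Finset κ) (y : κ → ℝ) (f : κ → ℕ → ℝ)
    (u : EuclideanSpace ℝ (Fin 2)) :
    ∑ i ∈ S, y i • stepPath n (fun m => f i m • u)
      = stepPath n fun m => (∑ i ∈ S, f i m * y i) • u := by
  simp only [← map_smul, ← map_sum]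
  congr 1
  ext1 m
  simp only [Finset.sum_apply, Pi.smul_apply, Finset.sum_smul, smul_smul, mul_comm]

open Classical in
theorem integral_norm_gaussPath_le (hn : 1 ≤ n) (p : I) (T : Finset (Sym2 (Fin n))) :
    ∫ x, ‖gaussPath n p T x‖ ∂Measure.pi (coordLaw p) ≤ 10 := by
  have hn' : (1 : ℝ) ≤ n := by exact_mod_cast hn
  obtain ⟨N1, a1, a2, a3, a4⟩ := exists_edgeSum_bound hn p Finset.univ linCoord (.inl rfl)
  obtain ⟨N2, b1, b2, b3, b4⟩ := exists_starSum_bound hn p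
  obtain ⟨N3, c1, c2, c3, c4⟩ := exists_edgeSum_bound hn p T noiseCoord (.inr rfl)
  have hv0 := variance_nonneg p
  have hv := variance_le p
  have hs : √((p : ℝ) * (1 - p)) ≤ 1 / 2 := by
    rw [Real.sqrt_le_iff]
    constructor <;> [norm_num; linarith]
  have h1 : ∀ x : Coord n → ℝ, ‖∑ e, x (linCoord e) • √((p : ℝ) * (1 - p)) • edgePath n p e‖
      ≤ 9 / 8 / n * N1 x := by
    intro x
    simp only [smul_comm (x _), ← Finset.smul_sum]
    rw [norm_smul, Real.norm_eq_abs, abs_of_nonneg (Real.sqrt_nonneg _)]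
    have : ‖∑ e, x (linCoord e) • edgePath n p e‖ ≤ 9 / 4 / n * N1 x := by
      simp only [edgePath]
      rw [sum_smul_stepPath]
      refine norm_stepPath_le (mul_nonneg (by positivity) (a2 x)) fun m hm => ?_
      have hb := mul_sum_edgeIn_le (fun e => x (linCoord e)) hm (by simpa using a3 x m hm)
      rw [norm_smul, norm_pair, Real.norm_eq_abs]
      have e : ∑ e, ((m : ℝ) - 2) / (n : ℝ) ^ 2 * edgeIn e m * x (linCoord e)
          = ((m - 2) * ∑ e, edgeIn e m * x (linCoord e)) / (n : ℝ) ^ 2 := by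
        rw [Finset.mul_sum, Finset.sum_div]
        exact Finset.sum_congr rfl fun _ _ => by ring
      rw [e, abs_div, abs_of_nonneg (by positivity : (0 : ℝ) ≤ (n : ℝ) ^ 2)]
      calc _ ≤ (n * N1 x) / (n : ℝ) ^ 2 * (9 / 4) := by
            refine mul_le_mul ?_ (sqrt_one_add_le p) (Real.sqrt_nonneg _)
              (div_nonneg (mul_nonneg (by positivity) (a2 x)) (by positivity))
            gcongr
        _ = _ := by field_simp
    calc _ ≤ 1 / 2 * (9 / 4 / n * N1 x) := mul_le_mul hs this (norm_nonneg _) (by norm_num)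
      _ = _ := by ring
  have h2 : ∀ x : Coord n → ℝ, ‖∑ s, x (quadCoord s) • ((p : ℝ) * (1 - p)) • starPath n s‖
      ≤ 1 / 4 / (n : ℝ) ^ 2 * N2 x := by
    intro x
    simp only [smul_comm (x _), ← Finset.smul_sum]
    rw [norm_smul, Real.norm_eq_abs, abs_of_nonneg hv0]
    have : ‖∑ s, x (quadCoord s) • starPath n s‖ ≤ 1 / (n : ℝ) ^ 2 * N2 x := by
      simp only [starPath]
      rw [sum_smul_stepPath]
      refine norm_stepPath_le (mul_nonneg (by positivity) (b2 x)) fun m hm => ?_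
      rw [norm_smul, norm_pair, Real.norm_eq_abs]
      simp only [mul_assoc, ← Finset.mul_sum]
      rw [abs_mul, abs_of_nonneg (by positivity)]
      simpa using mul_le_mul_of_nonneg_left (b3 x m hm) (by positivity : 0 ≤ 1 / (n : ℝ) ^ 2)
    calc _ ≤ 1 / 4 * (1 / (n : ℝ) ^ 2 * N2 x) := mul_le_mul hv this (norm_nonneg _) (by norm_num)
      _ = _ := by ring
  have h3 : ∀ x : Coord n → ℝ, ‖∑ e ∈ T, x (noiseCoord e) • noisePath n e‖
      ≤ 3 / 2 / n * N3 x := by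
    intro x
    have hq : √(2 / (n : ℝ) ^ 5) ≤ 3 / 2 / (n : ℝ) ^ 2 := by
      rw [Real.sqrt_le_iff]
      refine ⟨by positivity, ?_⟩
      rw [div_pow, div_le_div_iff₀ (by positivity) (by positivity)]
      have e1 : (n : ℝ) ^ 5 = (n : ℝ) ^ 4 * n := by ring
      have e2 : ((n : ℝ) ^ 2) ^ 2 = (n : ℝ) ^ 4 := by ring
      rw [e1, e2]
      have : (0 : ℝ) < (n : ℝ) ^ 4 := by positivity
      nlinarith
    simp only [noisePath]
    rw [sum_smul_stepPath]
    refine norm_stepPath_le (mul_nonneg (by positivity) (c2 x)) fun m hm => ?_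
    have hb := mul_sum_edgeIn_le (fun e => if e ∈ T then x (noiseCoord e) else 0) hm (c3 x m hm)
    have e : ∑ e ∈ T, √(2 / (n : ℝ) ^ 5) * ((m : ℝ) - 2) * edgeIn e m * x (noiseCoord e)
        = √(2 / (n : ℝ) ^ 5) *
          ((m - 2) * ∑ e, edgeIn e m * (if e ∈ T then x (noiseCoord e) else 0)) := by
      simp only [mul_ite, mul_zero]
      rw [Finset.sum_ite_mem, Finset.univ_inter, Finset.mul_sum, Finset.mul_sum]
      exact Finset.sum_congr rfl fun _ _ => by ring
    rw [norm_smul, norm_pair, Real.norm_eq_abs, e, abs_mul, abs_of_nonneg (Real.sqrt_nonneg _)]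
    simp only [ne_eq, OfNat.ofNat_ne_zero, not_false_eq_true, zero_pow, one_pow, zero_add,
      Real.sqrt_one, mul_one]
    calc _ ≤ 3 / 2 / (n : ℝ) ^ 2 * (n * N3 x) := by gcongr
      _ = _ := by field_simp
  have i1 := (a1.const_mul (9 / 8 / n)).integrable (integrable_coordLaw p)
  have i2 := (b1.const_mul (1 / 4 / (n : ℝ) ^ 2)).integrable (integrable_coordLaw p)
  have i3 := (c1.const_mul (3 / 2 / n)).integrable (integrable_coordLaw p)
  have i12 : Integrable (fun x => 9 / 8 / n * N1 x + 1 / 4 / (n : ℝ) ^ 2 * N2 x)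
    (Measure.pi (coordLaw p)) := i1.add i2
  calc ∫ x, ‖gaussPath n p T x‖ ∂Measure.pi (coordLaw p)
      ≤ ∫ x, (9 / 8 / n * N1 x + 1 / 4 / (n : ℝ) ^ 2 * N2 x + 3 / 2 / n * N3 x)
        ∂Measure.pi (coordLaw p) := by
        refine integral_mono ((polyGrowth_gaussPath T).norm.integrable (integrable_coordLaw p))
          (i12.add i3) fun x => ?_
        exact (norm_add_le _ _).trans
          (add_le_add ((norm_add_le _ _).trans (add_le_add (h1 x) (h2 x))) (h3 x))
    _ = 9 / 8 / n * ∫ x, N1 x ∂Measure.pi (coordLaw p)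
        + 1 / 4 / (n : ℝ) ^ 2 * ∫ x, N2 x ∂Measure.pi (coordLaw p)
        + 3 / 2 / n * ∫ x, N3 x ∂Measure.pi (coordLaw p) := by
        rw [integral_add i12 i3, integral_add i1 i2, integral_const_mul, integral_const_mul,
          integral_const_mul]
    _ ≤ 9 / 8 / n * (3 * n) + 1 / 4 / (n : ℝ) ^ 2 * (3 * (n : ℝ) ^ 2) + 3 / 2 / n * (3 * n) := by
        gcongr
    _ = 27 / 8 + 3 / 4 + 9 / 2 := by
        field_simp
        norm_num
    _ ≤ 10 := by norm_num

variable {g : SkorokhodD 2 → ℝ} {c k : ℝ}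

/-- Adding the noise of one edge. -/
theorem abs_gaussPath_step_le (hg : HasLipschitzHessian g c k) (hc : 0 ≤ c) (hk : 0 ≤ k)
    (hn : 1 ≤ n) (T : Finset (Sym2 (Fin n))) (a : Sym2 (Fin n)) (ha : a ∉ T) :
    |∫ x, g (gaussPath n p (insert a T) x) ∂Measure.pi (coordLaw p)
        - ∫ x, g (gaussPath n p T x) ∂Measure.pi (coordLaw p)|
      ≤ (11 * c + 2 * k) / n / (n : ℝ) ^ 2 := by
  have hn' : (1 : ℝ) ≤ n := by exact_mod_cast hn
  have e1 : ∀ x, gaussPath n p (insert a T) x = gaussPath n p T x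
      + x (noiseCoord a) • noisePath n a := fun x => by
    rw [gaussPath, gaussPath, Finset.sum_insert ha]
    abel
  have hi : Ignores (gaussPath n p T) (noiseCoord a) := by
    refine ((Ignores.sum fun e _ => ?_).add (Ignores.sum fun s _ => ?_)).add
      (Ignores.sum fun e he => ?_)
    · exact (ignores_eval (by simp)).comp fun c => c • √((p : ℝ) * (1 - p)) • edgePath n p e
    · exact (ignores_eval (by simp)).comp fun c => c • ((p : ℝ) * (1 - p)) • starPath n s
    · have : e ≠ a := fun h => ha (h ▸ he)
      exact (ignores_eval (by simpa using this)).comp fun c => c • noisePath n e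
  simp only [e1]
  refine (hg.abs_integral_add_eval_le' (integrable_coordLaw p) (polyGrowth_gaussPath T) hi
    (integral_id_coordLaw p _) _).trans ?_
  have hw := norm_noisePath_sq_le hn a
  have hw1 : ‖noisePath n a‖ ≤ 3 / 2 := by
    have : 2 / (n : ℝ) ^ 3 ≤ 2 := div_le_self zero_le_two (one_le_pow₀ hn')
    nlinarith [norm_nonneg (noisePath n a)]
  have h3 : ∫ y, |y| ^ 3 ∂coordLaw p (noiseCoord a) ≤ 3 := integral_abs_cube_gaussianReal_le
  have h30 : 0 ≤ ∫ y, |y| ^ 3 ∂coordLaw p (noiseCoord a) :=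
    integral_nonneg fun y => by positivity
  have hE := integral_norm_gaussPath_le hn p T
  have hE0 : 0 ≤ ∫ x, ‖gaussPath n p T x‖ ∂Measure.pi (coordLaw p) :=
    integral_nonneg fun x => norm_nonneg _
  rw [integral_sq_gauss, mul_one, show ‖noisePath n a‖ ^ 3
    = ‖noisePath n a‖ ^ 2 * ‖noisePath n a‖ by ring]
  calc _ ≤ c / 2 * (1 + 10) * (2 / (n : ℝ) ^ 3) + k / 6 * (2 / (n : ℝ) ^ 3 * (3 / 2)) * 3 := by
        gcongr
    _ = (11 * c + 3 / 2 * k) / (n : ℝ) ^ 3 := by ring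
    _ ≤ (11 * c + 2 * k) / (n : ℝ) ^ 3 := by gcongr; norm_num
    _ = _ := by field_simp

/-- The distance between the graph model and the Gaussian model. -/
theorem abs_integral_mixedPath_sub_gaussPath_le (hg : HasLipschitzHessian g c k) (hc : 0 ≤ c)
    (hk : 0 ≤ k) (hn : 1 ≤ n) :
    |∫ x, g (mixedPath n p Finset.univ ∅ x) ∂Measure.pi (coordLaw p)
        - ∫ x, g (gaussPath n p Finset.univ x) ∂Measure.pi (coordLaw p)|
      ≤ 12 * (c + k) / n := by
  have hn' : (0 : ℝ) < n := by exact_mod_cast hn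
  have s1 := abs_sub_le_card_mul
    (fun T => ∫ x, g (mixedPath n p Tᶜ T x) ∂Measure.pi (coordLaw p))
    (abs_mixedPath_step_le hg hk hn) Finset.univ
  have s2 := abs_sub_le_card_mul
    (fun T => ∫ x, g (linearPath n p T x) ∂Measure.pi (coordLaw p))
    (abs_linearPath_step_le hg hk hn) Finset.univ
  have s3 := abs_sub_le_card_mul
    (fun T => ∫ x, g (gaussPath n p T x) ∂Measure.pi (coordLaw p))
    (abs_gaussPath_step_le hg hc hk hn) Finset.univ
  have e1 : ∀ x, mixedPath n p Finset.univᶜ Finset.univ x = linearPath n p ∅ x := fun x => by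
    simp [mixedPath, linearPath]
  have e2 : ∀ x, linearPath n p Finset.univ x = gaussPath n p ∅ x := fun x => by
    simp [gaussPath, linearPath]
  simp only [e1, e2, Finset.compl_empty, Finset.card_univ] at s1 s2 s3
  rw [card_stars] at s1
  have t1 : (n : ℝ) ^ 3 * (6 * k / n / (n : ℝ) ^ 3) = 6 * k / n := by field_simp
  have t2 : (Fintype.card (Sym2 (Fin n)) : ℝ) * (2 * k / n / (n : ℝ) ^ 2) ≤ 2 * k / n := by
    refine (mul_le_mul_of_nonneg_right (card_edges_le n) (by positivity)).trans (le_of_eq ?_)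
    field_simp
  have t3 : (Fintype.card (Sym2 (Fin n)) : ℝ) * ((11 * c + 2 * k) / n / (n : ℝ) ^ 2)
      ≤ (11 * c + 2 * k) / n := by
    refine (mul_le_mul_of_nonneg_right (card_edges_le n) (by positivity)).trans (le_of_eq ?_)
    field_simp
  rw [t1] at s1
  have t4 : 6 * k / n + 2 * k / n + (11 * c + 2 * k) / n ≤ 12 * (c + k) / n := by
    rw [← add_div, ← add_div]
    gcongr
    linarith
  rw [abs_le] at *
  constructor <;> linarith [s1.1, s1.2, s2.1, s2.2, s3.1, s3.2]

end Noise

end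

/-! ### Counting edges and two-stars -/

noncomputable section

section Counting

variable {n : ℕ}

theorem mem_firstVertices {m : ℕ} {i : Fin n} : i ∈ firstVertices n m ↔ i.val < m := by
  simp [firstVertices]

theorem card_firstVertices {m : ℕ} (hm : m ≤ n) : (firstVertices n m).card = m := by
  rw [firstVertices, Fin.card_filter_val_lt, min_eq_right hm]

/-- Summation over ordered pairs and over potential edges. -/
theorem sum_pairs_eq (m : ℕ) (f : Sym2 (Fin n) → ℝ) :
    ∑ i ∈ firstVertices n m, ∑ j ∈ firstVertices n m, (if i = j then 0 else f s(i, j))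
      = 2 * ∑ e, edgeIn e m * f e := by
  have h1 := Finset.sum_sym2_filter_not_isDiag (firstVertices n m) f
  have h2 : ∑ e, edgeIn e m * f e = ∑ e ∈ (firstVertices n m).sym2 with ¬ e.IsDiag, f e := by
    rw [← Finset.sum_subset (Finset.subset_univ {e ∈ (firstVertices n m).sym2 | ¬ e.IsDiag})]
    · refine Finset.sum_congr rfl fun e he => ?_
      induction e using Sym2.ind with
      | _ i j =>
        rw [Finset.mem_filter, Finset.mk_mem_sym2_iff, mem_firstVertices, mem_firstVertices] at he
        rw [edgeIn, if_pos ⟨he.2, by simpa [edgeLevel] using he.1⟩, one_mul]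
    · intro e _ he
      induction e using Sym2.ind with
      | _ i j =>
        rw [Finset.mem_filter, Finset.mk_mem_sym2_iff, mem_firstVertices, mem_firstVertices] at he
        rw [edgeIn, if_neg, zero_mul]
        exact fun h => he ⟨by simpa [edgeLevel] using h.2, h.1⟩
  have h3 : ∀ i j : Fin n, (if i = j then 0 else f s(i, j))
      = (if i < j then f s(i, j) else 0) + if j < i then f s(j, i) else 0 := fun i j => by
    rcases lt_trichotomy i j with h | h | h
    · simp [h, h.ne, h.not_gt]
    · simp [h]
    · simp [h, h.ne', h.not_gt, Sym2.eq_swap]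
  have h4 : ∑ e ∈ (firstVertices n m).sym2 with ¬ e.IsDiag, f e
      = ∑ i ∈ firstVertices n m, ∑ j ∈ firstVertices n m, if i < j then f s(i, j) else 0 := by
    rw [h1, ← Finset.sum_product', ← Finset.sum_filter]
    refine Finset.sum_congr ?_ fun _ _ => rfl
    ext ⟨i, j⟩
    simp only [Finset.mem_filter, Finset.mem_offDiag, Finset.mem_product]
    constructor
    · rintro ⟨⟨a, b, -⟩, c⟩; exact ⟨⟨a, b⟩, c⟩
    · rintro ⟨⟨a, b⟩, c⟩; exact ⟨⟨a, b, c.ne⟩, c⟩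
  simp only [h3, Finset.sum_add_distrib]
  rw [h2, h4, two_mul]
  congr 1
  exact Finset.sum_comm

theorem sum_triples_swap {α : Type*} (s : Finset α) (H : α → α → α → ℝ) :
    ∑ i ∈ s, ∑ j ∈ s, ∑ k ∈ s, H k j i = ∑ i ∈ s, ∑ j ∈ s, ∑ k ∈ s, H i j k := by
  rw [Finset.sum_congr rfl fun i _ => Finset.sum_comm, Finset.sum_comm]
  exact Finset.sum_congr rfl fun i _ => Finset.sum_comm

/-- Summation over ordered triples and over two-stars. -/
theorem sum_triples_eq (m : ℕ) (F : Fin n → Fin n → Fin n → ℝ)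
    (hF : ∀ i j k, F i j k = F k j i) :
    ∑ i ∈ firstVertices n m, ∑ j ∈ firstVertices n m, ∑ k ∈ firstVertices n m,
      (if i ≠ j ∧ j ≠ k ∧ i ≠ k then F i j k else 0)
      = 2 * ∑ s, starIn s m * F s.1 s.2.1 s.2.2 := by
  let H : Fin n → Fin n → Fin n → ℝ := fun i j k =>
    if i < k ∧ i ≠ j ∧ j ≠ k then F i j k else 0
  have h1 : ∀ i j k, (if i ≠ j ∧ j ≠ k ∧ i ≠ k then F i j k else 0) = H i j k + H k j i := by
    intro i j k
    simp only [H]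
    rw [hF k j i]
    rcases lt_trichotomy i k with h | h | h
    · by_cases h1 : i = j <;> by_cases h2 : j = k <;> simp [h, h.ne, h.not_gt, h1, h2]
    · simp [h]
    · by_cases h1 : i = j <;> by_cases h2 : j = k <;> simp [h, h.ne', h.not_gt, h1, h2, eq_comm]
  have h2 : ∑ s, starIn s m * F s.1 s.2.1 s.2.2 = ∑ i ∈ firstVertices n m,
      ∑ j ∈ firstVertices n m, ∑ k ∈ firstVertices n m, H i j k := by
    have h : ∀ i j k : Fin n, starIn (i, j, k) m * F i j k
        = if i.val < m then if j.val < m then if k.val < m then H i j k else 0 else 0 else 0 := by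
      intro i j k
      simp only [starIn, starLevel, IsStar, H, max_lt_iff]
      split_ifs <;> first | tauto | simp
    simp only [Fintype.sum_prod_type, h, firstVertices, Finset.sum_filter]
    refine Finset.sum_congr rfl fun i _ => ?_
    by_cases hi : i.val < m
    · simp only [hi, if_true]
      refine Finset.sum_congr rfl fun j _ => ?_
      by_cases hj : j.val < m <;> simp [hj]
    · simp [hi]
  simp only [h1, Finset.sum_add_distrib]
  rw [sum_triples_swap _ H, h2, two_mul]

/-- The number of third vertices. -/
theorem sum_third {m : ℕ} (hm : m ≤ n) {i j : Fin n} (hi : i ∈ firstVertices n m)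
    (hj : j ∈ firstVertices n m) (hij : i ≠ j) :
    ∑ k ∈ firstVertices n m, (if j ≠ k ∧ i ≠ k then (1 : ℝ) else 0) = m - 2 := by
  have h : (firstVertices n m).filter (fun k => j ≠ k ∧ i ≠ k)
      = ((firstVertices n m).erase i).erase j := by
    ext k
    simp only [Finset.mem_filter, Finset.mem_erase]
    tauto
  have h1 := Finset.card_erase_add_one (Finset.mem_erase.2 ⟨hij.symm, hj⟩)
  have h2 := Finset.card_erase_add_one hi
  rw [← Finset.sum_filter, h, Finset.sum_const, nsmul_one]
  rw [card_firstVertices hm] at h2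
  have h3 : ((((firstVertices n m).erase i).erase j).card : ℝ) + 1 + 1 = m := by
    exact_mod_cast congrArg (· + 1) h1 |>.trans h2
  linarith

theorem sum_triples_left {m : ℕ} (hm : m ≤ n) (F : Fin n → Fin n → ℝ) :
    ∑ i ∈ firstVertices n m, ∑ j ∈ firstVertices n m, ∑ k ∈ firstVertices n m,
      (if i ≠ j ∧ j ≠ k ∧ i ≠ k then F i j else 0)
      = (m - 2) * ∑ i ∈ firstVertices n m, ∑ j ∈ firstVertices n m,
        (if i = j then 0 else F i j) := by
  simp only [Finset.mul_sum]
  refine Finset.sum_congr rfl fun i hi => Finset.sum_congr rfl fun j hj => ?_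
  by_cases hij : i = j
  · simp [hij]
  · rw [if_neg hij, ← sum_third hm hi hj hij, Finset.sum_mul]
    exact Finset.sum_congr rfl fun k _ => by simp [hij]

end Counting

end

/-! ### The graph process and the Bernoulli model -/

noncomputable section

section Graph

variable {n : ℕ}

theorem stepPath_congr {a b : ℕ → EuclideanSpace ℝ (Fin 2)} (h : ∀ m ≤ n, a m = b m) :
    stepPath n a = stepPath n b := by
  refine Subtype.ext (lp.ext (funext fun t => ?_))
  exact h _ (revealed_le n t)

/-- The expectations of `edgeStat` and `twoStarStat`. -/
def edgeMean (n : ℕ) (p : ℝ) (m : ℕ) : ℝ :=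
  ((m : ℝ) - 2) / (2 * (n : ℝ) ^ 2) *
    ∑ i ∈ firstVertices n m, ∑ j ∈ firstVertices n m, if i = j then 0 else p

def twoStarMean (n : ℕ) (p : ℝ) (m : ℕ) : ℝ :=
  1 / (2 * (n : ℝ) ^ 2) *
    ∑ i ∈ firstVertices n m, ∑ j ∈ firstVertices n m, ∑ k ∈ firstVertices n m,
      if i ≠ j ∧ j ≠ k ∧ i ≠ k then p ^ 2 else 0

/-- `X` is the family of centred edge indicators of `G`. -/
def IsCentredEdges (p : ℝ) (G : SimpleGraph (Fin n)) (X : Sym2 (Fin n) → ℝ) : Prop :=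
  ∀ i j, edgeInd G i j = if i = j then 0 else X s(i, j) + p

variable {p : ℝ} {G : SimpleGraph (Fin n)} {X : Sym2 (Fin n) → ℝ}

theorem IsCentredEdges.edgeStat_eq (h : IsCentredEdges p G X) (m : ℕ) :
    edgeStat n m G = edgeMean n p m + ∑ e, ((m : ℝ) - 2) / (n : ℝ) ^ 2 * edgeIn e m * X e := by
  have e1 : ∀ i j, edgeInd G i j = (if i = j then 0 else p) + if i = j then 0 else X s(i, j) :=
    fun i j => by rw [h]; split_ifs <;> ring
  simp only [edgeStat, edgeMean, e1, Finset.sum_add_distrib, sum_pairs_eq, mul_assoc,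
    ← Finset.mul_sum]
  ring

theorem IsCentredEdges.twoStarStat_eq (h : IsCentredEdges p G X) {m : ℕ} (hm : m ≤ n) :
    twoStarStat n m G = twoStarMean n p m
      + 2 * p * (∑ e, ((m : ℝ) - 2) / (n : ℝ) ^ 2 * edgeIn e m * X e)
      + ∑ s, 1 / (n : ℝ) ^ 2 * starIn s m * (X (leftEdge s) * X (rightEdge s)) := by
  have e1 : ∀ i j k, (if i ≠ j ∧ j ≠ k ∧ i ≠ k then edgeInd G i j * edgeInd G j k else 0)
      = (if i ≠ j ∧ j ≠ k ∧ i ≠ k then p ^ 2 else 0)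
        + (if i ≠ j ∧ j ≠ k ∧ i ≠ k then p * X s(i, j) else 0)
        + (if k ≠ j ∧ j ≠ i ∧ k ≠ i then p * X s(k, j) else 0)
        + if i ≠ j ∧ j ≠ k ∧ i ≠ k then X s(i, j) * X s(j, k) else 0 := fun i j k => by
    have : (k ≠ j ∧ j ≠ i ∧ k ≠ i) ↔ (i ≠ j ∧ j ≠ k ∧ i ≠ k) := by tauto
    simp only [this, h i j, h j k]
    by_cases h1 : i ≠ j ∧ j ≠ k ∧ i ≠ k
    · rw [if_pos h1, if_pos h1, if_pos h1, if_pos h1, if_pos h1, if_neg h1.1, if_neg h1.2.1,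
        Sym2.eq_swap (a := k)]
      ring
    · simp only [if_neg h1, add_zero]
  simp only [twoStarStat, twoStarMean, e1, Finset.sum_add_distrib]
  rw [sum_triples_swap (firstVertices n m)
      (fun i j k => if i ≠ j ∧ j ≠ k ∧ i ≠ k then p * X s(i, j) else 0),
    sum_triples_left hm (fun i j => p * X s(i, j)),
    sum_triples_eq m (fun i j k => X s(i, j) * X s(j, k)) (fun i j k => by
      rw [mul_comm, Sym2.eq_swap (a := j), Sym2.eq_swap (a := i)]),
    sum_pairs_eq m fun e => p * X e]
  simp only [mul_assoc, ← Finset.mul_sum, mul_left_comm _ p, leftEdge, rightEdge]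
  ring

end Graph

section Law

variable (n : ℕ) (p : I)

/-- The graph encoded by the Bernoulli coordinates. -/
def graphOf (x : Coord n → ℝ) : SimpleGraph (Fin n) :=
  .fromEdgeSet {e | x (bernCoord e) = 1 - p}

variable {n p}

theorem isCentredEdges_graphOf {x : Coord n → ℝ}
    (hx : ∀ e, x (bernCoord e) = 1 - p ∨ x (bernCoord e) = -p) :
    IsCentredEdges p (graphOf n p x) fun e => x (bernCoord e) := by
  intro i j
  simp only [edgeInd, graphOf, SimpleGraph.fromEdgeSet_adj, Set.mem_ofPred_eq]
  by_cases hij : i = j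
  · simp [hij]
  · rcases hx s(i, j) with h | h
    · simp [h, hij]
    · have : ¬ (-(p : ℝ) = 1 - p) := by linarith
      simp [h, hij, this]

theorem ae_isCentredEdges_graphOf :
    ∀ᵐ x ∂Measure.pi (coordLaw (n := n) p),
      IsCentredEdges p (graphOf n p x) fun e => x (bernCoord e) := by
  have : ∀ᵐ x ∂Measure.pi (coordLaw (n := n) p),
      ∀ e, x (bernCoord e) = 1 - (p : ℝ) ∨ x (bernCoord e) = -(p : ℝ) := by
    rw [ae_all_iff]
    exact fun e => (measurePreserving_eval (coordLaw (n := n) p)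
      (bernCoord e)).quasiMeasurePreserving.ae (ae_centredBernoulli p)
  filter_upwards [this] with x hx using isCentredEdges_graphOf hx

theorem hasLaw_graphOf : HasLaw (graphOf n p) (SimpleGraph.binomialRandom (Fin n) p)
    (Measure.pi (coordLaw p)) := by
  let γ : Sym2 (Fin n) → ℝ → Prop := fun e y => ¬ e.IsDiag ∧ y = 1 - p
  have hγ : ∀ e, Measurable (γ e) := fun e => by
    refine Measurable.and measurable_const ?_
    exact measurableSet_setOfPred.1 (measurableSet_singleton _)
  let B : (Coord n → ℝ) → Sym2 (Fin n) → Prop := fun x e => γ e (x (bernCoord e))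
  have hB : Measurable B := measurable_pi_lambda _ fun e => (hγ e).comp (measurable_pi_apply _)
  have hset : Measurable fun P : Sym2 (Fin n) → Prop => {e | P e} := by fun_prop
  have hG : graphOf n p = fun x => SimpleGraph.fromEdgeSet {e | B x e} := by
    ext x i j
    simp only [graphOf, SimpleGraph.fromEdgeSet_adj, Set.mem_ofPred_eq, B, γ, Sym2.mk_isDiag_iff]
    tauto
  have hind : iIndepFun (fun e (x : Coord n → ℝ) => γ e (x (bernCoord e)))
      (Measure.pi (coordLaw p)) := by
    have h : iIndepFun (fun i (x : Coord n → ℝ) => x i) (Measure.pi (coordLaw p)) :=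
      iIndepFun_pi (X := fun _ y => y) fun i => aemeasurable_id
    exact (h.precomp (g := bernCoord) Sum.inl_injective).comp γ hγ
  have hmap : (Measure.pi (coordLaw p)).map B
      = Measure.pi fun e : Sym2 (Fin n) => toNNReal p • Measure.dirac (e ∈ Sym2.diagSetᶜ)
        + toNNReal (σ p) • Measure.dirac False := by
    refine ((iIndepFun_iff_map_fun_eq_pi_map fun e =>
      ((hγ e).comp (measurable_pi_apply _)).aemeasurable).1 hind).trans ?_
    congr 1
    ext1 e
    have h1 : (Measure.pi (coordLaw p)).map (fun x => x (bernCoord e)) = centredBernoulli p :=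
      (measurePreserving_eval (coordLaw (n := n) p) (bernCoord e)).map_eq
    have h2 := Measure.map_map (μ := Measure.pi (coordLaw p)) (hγ e)
      (measurable_pi_apply (bernCoord e))
    rw [h1] at h2
    refine h2.symm.trans ?_
    rw [map_bernoulliMeasure' _ _ (hγ e), bernoulliMeasure_def]
    have h3 : γ e (1 - p) = (e ∈ Sym2.diagSetᶜ) := by simp [γ]
    have h4 : γ e (-p) = False := by
      have : ¬ (-(p : ℝ) = 1 - p) := by linarith
      simp [γ, this]
    rw [h3, h4]
  refine ⟨?_, ?_⟩
  · rw [hG]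
    exact (SimpleGraph.measurable_fromEdgeSet.comp (hset.comp hB)).aemeasurable
  · rw [SimpleGraph.binomialRandom_eq_map, setBernoulli_eq_map, Measure.infinitePi_eq_pi, ← hmap,
      Measure.map_map hset hB, Measure.map_map SimpleGraph.measurable_fromEdgeSet
        (hset.comp hB), hG]
    rfl

theorem SimpleGraph.measurable_of_fin (h : SimpleGraph (Fin n) → ℝ) : Measurable h := by
  have : ∀ S : Set (SimpleGraph (Fin n)), MeasurableSet S := fun S => by
    rw [← SimpleGraph.measurableEmbedding_edgeSet.measurableSet_image]
    exact Set.Finite.measurableSet (Set.toFinite _)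
  exact fun s _ => this _

theorem integrable_and_integral_sum_bern (c : Sym2 (Fin n) → ℝ) :
    Integrable (fun x => ∑ e, c e * x (bernCoord e)) (Measure.pi (coordLaw p)) ∧
      ∫ x, ∑ e, c e * x (bernCoord e) ∂Measure.pi (coordLaw (n := n) p) = 0 := by
  have hi : ∀ e, Integrable (fun x => c e * x (bernCoord e)) (Measure.pi (coordLaw p)) :=
    fun e => ((PolyGrowth.eval _).const_mul _).integrable (integrable_coordLaw p)
  refine ⟨integrable_finsetSum _ fun e _ => hi e, ?_⟩
  rw [integral_finsetSum _ fun e _ => hi e]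
  refine Finset.sum_eq_zero fun e _ => ?_
  rw [integral_const_mul, integral_eval (μ := coordLaw p) (bernCoord e) (ψ := fun y => y)
    measurable_id, integral_id_coordLaw, mul_zero]

theorem integrable_and_integral_sum_stars (c : ℝ) (m : ℕ) :
    Integrable (fun x => ∑ s : Fin n × Fin n × Fin n, c * starIn s m *
      (x (bernCoord (leftEdge s)) * x (bernCoord (rightEdge s)))) (Measure.pi (coordLaw p)) ∧
    ∫ x, ∑ s : Fin n × Fin n × Fin n, c * starIn s m *
      (x (bernCoord (leftEdge s)) * x (bernCoord (rightEdge s)))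
        ∂Measure.pi (coordLaw (n := n) p) = 0 := by
  have hi : ∀ s : Fin n × Fin n × Fin n, Integrable (fun x => c * starIn s m *
      (x (bernCoord (leftEdge s)) * x (bernCoord (rightEdge s)))) (Measure.pi (coordLaw p)) :=
    fun s => (((PolyGrowth.eval _).mul (PolyGrowth.eval _)).const_mul _).integrable
      (integrable_coordLaw p)
  refine ⟨integrable_finsetSum _ fun s _ => hi s, ?_⟩
  rw [integral_finsetSum _ fun s _ => hi s]
  refine Finset.sum_eq_zero fun s _ => ?_
  rw [integral_const_mul]
  by_cases hs : IsStar s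
  · rw [integral_eval_mul_eval (fun h => leftEdge_ne_rightEdge hs (Sum.inl_injective h))
      (integral_id_coordLaw p _), mul_zero]
  · simp [starIn, hs]

theorem integral_graphOf_edgeStat (m : ℕ) :
    ∫ x, edgeStat n m (graphOf n p x) ∂Measure.pi (coordLaw p) = edgeMean n p m := by
  rw [integral_congr_ae (ae_isCentredEdges_graphOf.mono fun x hx => hx.edgeStat_eq m)]
  obtain ⟨h1, h2⟩ := integrable_and_integral_sum_bern (p := p)
    fun e : Sym2 (Fin n) => ((m : ℝ) - 2) / (n : ℝ) ^ 2 * edgeIn e m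
  rw [integral_add (integrable_const _) h1, h2]
  simp

theorem integral_graphOf_twoStarStat {m : ℕ} (hm : m ≤ n) :
    ∫ x, twoStarStat n m (graphOf n p x) ∂Measure.pi (coordLaw p) = twoStarMean n p m := by
  rw [integral_congr_ae (ae_isCentredEdges_graphOf.mono fun x hx => hx.twoStarStat_eq hm)]
  obtain ⟨h1, h2⟩ := integrable_and_integral_sum_bern (p := p)
    fun e : Sym2 (Fin n) => ((m : ℝ) - 2) / (n : ℝ) ^ 2 * edgeIn e m
  obtain ⟨h3, h4⟩ := integrable_and_integral_sum_stars (n := n) (p := p) (1 / (n : ℝ) ^ 2) m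
  have h5 := (integrable_const (μ := Measure.pi (coordLaw (n := n) p)) (twoStarMean n p m)).add
    (h1.const_mul (2 * (p : ℝ)))
  refine (integral_add h5 h3).trans ?_
  rw [h4]
  refine (congrArg (· + (0 : ℝ)) (integral_add (integrable_const _) (h1.const_mul _))).trans ?_
  rw [integral_const_mul, h2]
  simp

/-- The centred statistics of a graph, as a path. -/
def centredPath (n : ℕ) (p : ℝ) (H : SimpleGraph (Fin n)) : SkorokhodD 2 :=
  stepPath n fun m => !₂[edgeStat n m H - edgeMean n p m, twoStarStat n m H - twoStarMean n p m]

theorem ae_centredPath_graphOf :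
    ∀ᵐ x ∂Measure.pi (coordLaw (n := n) p),
      centredPath n p (graphOf n p x) = mixedPath n p Finset.univ ∅ x := by
  filter_upwards [ae_isCentredEdges_graphOf] with x hx
  simp only [mixedPath, edgePath, starPath, sum_smul_stepPath, Finset.sum_empty, add_zero,
    centredPath, ← map_add]
  refine stepPath_congr fun m hm => ?_
  rw [hx.edgeStat_eq, hx.twoStarStat_eq hm]
  ext q
  fin_cases q
  · simp
  · simp
    ring

variable {Ω : Type*} [MeasurableSpace Ω] {P : Measure Ω} {G : Ω → SimpleGraph (Fin n)}

theorem integral_comp_graphOf (hG : HasLaw G (SimpleGraph.binomialRandom (Fin n) p) P)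
    (h : SimpleGraph (Fin n) → ℝ) :
    ∫ ω, h (G ω) ∂P = ∫ x, h (graphOf n p x) ∂Measure.pi (coordLaw p) :=
  (hG.integral_comp (SimpleGraph.measurable_of_fin h).aestronglyMeasurable).trans
    (hasLaw_graphOf.integral_comp (SimpleGraph.measurable_of_fin h).aestronglyMeasurable).symm

theorem graphProcess_eq (hG : HasLaw G (SimpleGraph.binomialRandom (Fin n) p) P) (ω : Ω) :
    graphProcess P G ω = centredPath n p (G ω) := by
  have h : graphProcess P G ω = stepPath n fun m =>
      !₂[edgeStat n m (G ω) - ∫ η, edgeStat n m (G η) ∂P,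
        twoStarStat n m (G ω) - ∫ η, twoStarStat n m (G η) ∂P] := rfl
  rw [h]
  refine stepPath_congr fun m hm => ?_
  rw [integral_comp_graphOf hG, integral_comp_graphOf hG, integral_graphOf_edgeStat,
    integral_graphOf_twoStarStat hm]

theorem integral_graphProcess (hG : HasLaw G (SimpleGraph.binomialRandom (Fin n) p) P)
    (g : SkorokhodD 2 → ℝ) :
    ∫ ω, g (graphProcess P G ω) ∂P
      = ∫ x, g (mixedPath n p Finset.univ ∅ x) ∂Measure.pi (coordLaw p) := by
  simp only [graphProcess_eq hG]
  rw [integral_comp_graphOf hG fun H => g (centredPath n p H)]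
  exact integral_congr_ae (ae_centredPath_graphOf.mono fun x hx => congrArg g hx)

theorem integrable_graphProcess (hG : HasLaw G (SimpleGraph.binomialRandom (Fin n) p) P)
    (g : SkorokhodD 2 → ℝ) : Integrable (fun ω => g (graphProcess P G ω)) P := by
  simp only [graphProcess_eq hG]
  have hm := SimpleGraph.measurable_of_fin fun H => g (centredPath n p H)
  refine (integrable_map_measure (f := G) hm.aestronglyMeasurable hG.aemeasurable).1 ?_
  rw [hG.map_eq]
  obtain ⟨C, hC⟩ := (Set.finite_range fun H => ‖g (centredPath n p H)‖).bddAbove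
  exact (integrable_const C).mono' hm.aestronglyMeasurable
    (.of_forall fun H => hC (Set.mem_range_self H))

end Law

end

/-! ### The covariances of the Gaussian model -/

noncomputable section

section Covariance

variable {n : ℕ}

/-- The number of ordered pairs of distinct vertices among the first `m`. -/
def numPairs (n m : ℕ) : ℝ :=
  ∑ i ∈ firstVertices n m, ∑ j ∈ firstVertices n m, if i = j then 0 else 1

theorem edgeIn_mul (e : Sym2 (Fin n)) (a b : ℕ) :
    edgeIn e a * edgeIn e b = edgeIn e (min a b) := by
  simp only [edgeIn, lt_min_iff]
  split_ifs <;> first | tauto | simp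

theorem starIn_mul (s : Fin n × Fin n × Fin n) (a b : ℕ) :
    starIn s a * starIn s b = starIn s (min a b) := by
  by_cases hs : IsStar s <;> by_cases h1 : starLevel s < a <;> by_cases h2 : starLevel s < b <;>
    simp [starIn, hs, h1, h2]

theorem sum_edgeIn (m : ℕ) : ∑ e : Sym2 (Fin n), edgeIn e m = numPairs n m / 2 := by
  have := sum_pairs_eq (n := n) m fun _ => 1
  simp only [mul_one] at this
  rw [numPairs, this]
  ring

theorem sum_starIn {m : ℕ} (hm : m ≤ n) :
    ∑ s : Fin n × Fin n × Fin n, starIn s m = ((m : ℝ) - 2) * numPairs n m / 2 := by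
  have h1 := sum_triples_eq (n := n) m (fun _ _ _ => 1) fun _ _ _ => rfl
  have h2 := sum_triples_left hm fun _ _ => 1
  simp only [mul_one] at h1
  rw [numPairs, ← h2, h1]
  ring

theorem firstVertices_inter (a b : ℕ) :
    firstVertices n a ∩ firstVertices n b = firstVertices n (min a b) := by
  ext i
  simp [mem_firstVertices]

theorem sum_pairs_collapse (A B : Finset (Fin n)) (F : Fin n → Fin n → ℝ) :
    ∑ i ∈ A, ∑ j ∈ A, ∑ k ∈ B, ∑ l ∈ B, (if i = k ∧ j = l then F i j else 0)
      = ∑ i ∈ A ∩ B, ∑ j ∈ A ∩ B, F i j := by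
  have h : ∀ i j, ∑ k ∈ B, ∑ l ∈ B, (if i = k ∧ j = l then F i j else 0)
      = if i ∈ B then if j ∈ B then F i j else 0 else 0 := fun i j => by
    simp only [ite_and, Finset.sum_ite_irrel, Finset.sum_const_zero, Finset.sum_ite_eq]
  simp only [h, Finset.sum_ite_irrel, Finset.sum_const_zero, Finset.sum_ite_mem]

theorem sum_pairs_const (m : ℕ) (c : ℝ) :
    ∑ i ∈ firstVertices n m, ∑ j ∈ firstVertices n m, (if i = j then 0 else c)
      = c * numPairs n m := by
  simp only [numPairs, Finset.mul_sum, mul_ite, mul_zero, mul_one]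

theorem sum_diag_pairs (a b : ℕ) (c : ℝ) :
    ∑ i ∈ firstVertices n a, ∑ j ∈ firstVertices n a,
      ∑ k ∈ firstVertices n b, ∑ l ∈ firstVertices n b,
        (if i = k ∧ j = l ∧ i ≠ j then c else 0) = c * numPairs n (min a b) := by
  have h : ∀ i j k l : Fin n, (if i = k ∧ j = l ∧ i ≠ j then c else 0)
      = if i = k ∧ j = l then (if i = j then 0 else c) else 0 := fun i j k l => by
    split_ifs <;> first | rfl | tauto
  simp only [h]
  rw [sum_pairs_collapse, firstVertices_inter, sum_pairs_const]

theorem sum_third' {b : ℕ} (hb : b ≤ n) {i j : Fin n} (hi : i ∈ firstVertices n b)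
    (hj : j ∈ firstVertices n b) (c : ℝ) :
    ∑ k ∈ firstVertices n b, (if i ≠ j ∧ j ≠ k ∧ k ≠ i then c else 0)
      = if i = j then 0 else c * (b - 2) := by
  by_cases hij : i = j
  · simp [hij]
  · rw [if_neg hij, ← sum_third hb hi hj hij, Finset.mul_sum]
    refine Finset.sum_congr rfl fun k _ => ?_
    simp [hij, eq_comm]

theorem sum_triples_pairs (a b : ℕ) (hb : b ≤ n) (c : ℝ) :
    ∑ l ∈ firstVertices n a, ∑ m ∈ firstVertices n a,
      ∑ i ∈ firstVertices n b, ∑ j ∈ firstVertices n b, ∑ k ∈ firstVertices n b,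
        (if i = l ∧ j = m ∧ i ≠ j ∧ j ≠ k ∧ k ≠ i then c else 0)
      = c * (b - 2) * numPairs n (min a b) := by
  have h : ∀ l m i j : Fin n, ∑ k ∈ firstVertices n b,
      (if i = l ∧ j = m ∧ i ≠ j ∧ j ≠ k ∧ k ≠ i then c else 0)
      = if l = i ∧ m = j then ∑ k ∈ firstVertices n b,
        (if l ≠ m ∧ m ≠ k ∧ k ≠ l then c else 0) else 0 := fun l m i j => by
    by_cases h1 : l = i <;> by_cases h2 : m = j <;> simp [h1, h2, eq_comm]
  simp only [h]
  rw [sum_pairs_collapse, firstVertices_inter, ← sum_pairs_const]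
  refine Finset.sum_congr rfl fun i hi => Finset.sum_congr rfl fun j hj => ?_
  rw [← firstVertices_inter, Finset.mem_inter] at hi hj
  exact sum_third' hb hi.2 hj.2 c

theorem sum_third_third {a b : ℕ} (ha : a ≤ n) (hb : b ≤ n) {i j : Fin n}
    (hi : i ∈ firstVertices n (min a b)) (hj : j ∈ firstVertices n (min a b)) (c d : ℝ) :
    ∑ k ∈ firstVertices n a, ∑ t ∈ firstVertices n b,
      (if (i ≠ j ∧ j ≠ k ∧ k ≠ i) ∧ (i ≠ j ∧ j ≠ t ∧ t ≠ i) then if k = t then c else d else 0)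
      = if i = j then 0 else d * (a - 2) * (b - 2) + (c - d) * (((min a b : ℕ) : ℝ) - 2) := by
  by_cases hij : i = j
  · simp [hij]
  have hi' := Finset.mem_inter.1 ((firstVertices_inter a b).symm ▸ hi)
  have hj' := Finset.mem_inter.1 ((firstVertices_inter a b).symm ▸ hj)
  have h : ∀ k t : Fin n,
      (if (i ≠ j ∧ j ≠ k ∧ k ≠ i) ∧ (i ≠ j ∧ j ≠ t ∧ t ≠ i) then if k = t then c else d else 0)
      = d * ((if j ≠ k ∧ i ≠ k then 1 else 0) * (if j ≠ t ∧ i ≠ t then 1 else 0))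
        + (c - d) * if k = t then (if j ≠ k ∧ i ≠ k then 1 else 0) else 0 := fun k t => by
    by_cases h1 : k = t
    · subst h1
      by_cases h2 : j = k <;> by_cases h3 : i = k <;> simp [hij, h2, h3, eq_comm]
    · by_cases h2 : j = k <;> by_cases h3 : i = k <;> by_cases h4 : j = t <;>
        by_cases h5 : i = t <;> simp_all [eq_comm]
  rw [if_neg hij]
  simp only [h, Finset.sum_add_distrib, ← Finset.mul_sum,
    Finset.sum_ite_eq, Finset.sum_ite_mem, firstVertices_inter, ← Finset.sum_mul]
  rw [sum_third ha hi'.1 hj'.1 hij, sum_third hb hi'.2 hj'.2 hij,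
    sum_third (min_le_of_left_le ha) hi hj hij]
  ring

theorem sum_cov22_22 {a b : ℕ} (ha : a ≤ n) (hb : b ≤ n) (p : ℝ) :
    ∑ i ∈ firstVertices n a, ∑ j ∈ firstVertices n a, ∑ k ∈ firstVertices n a,
      ∑ r ∈ firstVertices n b, ∑ s ∈ firstVertices n b, ∑ t ∈ firstVertices n b,
        cov22_22 n p i j k r s t
      = (p ^ 3 * (1 - p) / (n : ℝ) ^ 4 * (a - 2) * (b - 2) +
          (p ^ 2 * (1 - p ^ 2) / (2 * (n : ℝ) ^ 4) - p ^ 3 * (1 - p) / (n : ℝ) ^ 4)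
            * (((min a b : ℕ) : ℝ) - 2)) * numPairs n (min a b) := by
  set c := p ^ 2 * (1 - p ^ 2) / (2 * (n : ℝ) ^ 4)
  set d := p ^ 3 * (1 - p) / (n : ℝ) ^ 4
  let W : Fin n → Fin n → Fin n → Fin n → ℝ := fun i j k t =>
    if (i ≠ j ∧ j ≠ k ∧ k ≠ i) ∧ (i ≠ j ∧ j ≠ t ∧ t ≠ i) then if k = t then c else d else 0
  have h : ∀ i j k r s t, cov22_22 n p i j k r s t
      = if i = r ∧ j = s then W i j k t else 0 := fun i j k r s t => by
    simp only [cov22_22, W]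
    by_cases h1 : i = r <;> by_cases h2 : j = s <;> by_cases h3 : k = t <;>
      simp [h1, h2, h3, c, d]
  have h' : ∀ i j : Fin n, ∑ k ∈ firstVertices n a, ∑ r ∈ firstVertices n b,
      ∑ s ∈ firstVertices n b, ∑ t ∈ firstVertices n b, cov22_22 n p i j k r s t
      = ∑ r ∈ firstVertices n b, ∑ s ∈ firstVertices n b, if i = r ∧ j = s then
        ∑ k ∈ firstVertices n a, ∑ t ∈ firstVertices n b, W i j k t else 0 := fun i j => by
    rw [Finset.sum_comm]
    refine Finset.sum_congr rfl fun r _ => ?_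
    rw [Finset.sum_comm]
    refine Finset.sum_congr rfl fun s _ => ?_
    simp only [h, Finset.sum_ite_irrel, Finset.sum_const_zero]
  simp only [h']
  rw [sum_pairs_collapse, firstVertices_inter, ← sum_pairs_const]
  exact Finset.sum_congr rfl fun i hi => Finset.sum_congr rfl fun j hj =>
    sum_third_third ha hb hi hj c d

theorem covD11_eq (p : ℝ) (a b : ℕ) :
    covD11 n p a b = ((a : ℝ) - 2) * (b - 2) *
      (p * (1 - p) / (2 * (n : ℝ) ^ 4) * numPairs n (min a b)) := by
  simp only [covD11, cov1_1, sum_diag_pairs]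

theorem covD12_eq (p : ℝ) {a b : ℕ} (hb : b ≤ n) :
    covD12 n p a b = ((a : ℝ) - 2) * (b - 2) *
      (p ^ 2 * (1 - p) / (n : ℝ) ^ 4 * numPairs n (min a b)) := by
  simp only [covD12, cov1_21, cov22_1, sum_diag_pairs, sum_triples_pairs a b hb]
  ring

theorem covD22_eq (p : ℝ) {a b : ℕ} (ha : a ≤ n) (hb : b ≤ n) :
    covD22 n p a b = (((a : ℝ) - 2) * (b - 2) * (2 * p ^ 3 * (1 - p) / (n : ℝ) ^ 4
        + 1 / (n : ℝ) ^ 5) + (((min a b : ℕ) : ℝ) - 2) * (p ^ 2 * (1 - p) ^ 2 / (2 * (n : ℝ) ^ 4)))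
      * numPairs n (min a b) := by
  have h : ∑ i ∈ firstVertices n a, ∑ j ∈ firstVertices n a, ∑ k ∈ firstVertices n a,
      ∑ l ∈ firstVertices n b, ∑ m ∈ firstVertices n b, cov22_21 n p i j k l m
      = p ^ 3 * (1 - p) / (2 * (n : ℝ) ^ 4) * (a - 2) * numPairs n (min a b) := by
    have h' : ∀ i j : Fin n, ∑ k ∈ firstVertices n a, ∑ l ∈ firstVertices n b,
        ∑ m ∈ firstVertices n b, cov22_21 n p i j k l m
        = ∑ l ∈ firstVertices n b, ∑ m ∈ firstVertices n b, if i = l ∧ j = m then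
          ∑ k ∈ firstVertices n a, (if i ≠ j ∧ j ≠ k ∧ k ≠ i then
            p ^ 3 * (1 - p) / (2 * (n : ℝ) ^ 4) else 0) else 0 := fun i j => by
      rw [Finset.sum_comm]
      refine Finset.sum_congr rfl fun l _ => ?_
      rw [Finset.sum_comm]
      refine Finset.sum_congr rfl fun m _ => ?_
      by_cases h1 : i = l <;> by_cases h2 : j = m <;> simp [cov22_21, h1, h2]
    simp only [h']
    rw [sum_pairs_collapse, firstVertices_inter, ← sum_pairs_const]
    refine Finset.sum_congr rfl fun i hi => Finset.sum_congr rfl fun j hj => ?_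
    rw [← firstVertices_inter, Finset.mem_inter] at hi hj
    exact sum_third' ha hi.1 hj.1 _
  simp only [covD22, sum_cov22_22 ha hb, h]
  simp only [cov21_21, cov22_21, sum_diag_pairs, sum_triples_pairs a b hb]
  ring

end Covariance

end

/-! ### Gaussian processes with the prescribed covariances -/

noncomputable section

section Existence

variable (n : ℕ) (p : I)

/-- The Gaussian coordinates. -/
abbrev GaussCoord (n : ℕ) : Type :=
  Sym2 (Fin n) ⊕ ((Fin n × Fin n × Fin n) ⊕ Sym2 (Fin n))

/-- The coefficients of the Gaussian model at a time when `m` vertices are revealed. -/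
def gaussCoeff (m : ℕ) (q : Fin 2) : GaussCoord n → ℝ :=
  Sum.elim (fun e => √((p : ℝ) * (1 - p)) * (((m : ℝ) - 2) / (n : ℝ) ^ 2 * edgeIn e m) *
      (![1, 2 * (p : ℝ)] : Fin 2 → ℝ) q)
    (Sum.elim (fun s => (p : ℝ) * (1 - p) * (1 / (n : ℝ) ^ 2 * starIn s m) *
      (![0, 1] : Fin 2 → ℝ) q)
    fun e => √(2 / (n : ℝ) ^ 5) * ((m : ℝ) - 2) * edgeIn e m *
      (![0, 1] : Fin 2 → ℝ) q)

variable {n p}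

theorem skorokhod_add_apply (v w : SkorokhodD 2) (t : I) (q : Fin 2) :
    (v + w).1 t q = v.1 t q + w.1 t q := rfl

theorem skorokhod_smul_apply (c : ℝ) (v : SkorokhodD 2) (t : I) (q : Fin 2) :
    (c • v).1 t q = c * v.1 t q := rfl

theorem skorokhod_sum_apply {κ : Type*} (s : Finset κ) (v : κ → SkorokhodD 2) (t : I)
    (q : Fin 2) : (∑ i ∈ s, v i).1 t q = ∑ i ∈ s, (v i).1 t q :=
  map_sum (AddMonoidHom.mk' (fun w : SkorokhodD 2 => w.1 t q)
    fun v w => skorokhod_add_apply v w t q) v s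

theorem gaussPath_apply (x : Coord n → ℝ) (t : I) (q : Fin 2) :
    (gaussPath n p Finset.univ x).1 t q
      = ∑ i, gaussCoeff n p (revealed n t) q i * x (.inr i) := by
  simp only [gaussPath, skorokhod_add_apply, skorokhod_sum_apply, skorokhod_smul_apply, edgePath,
    starPath, noisePath, stepPath_apply, PiLp.smul_apply, smul_eq_mul, gaussCoeff,
    Fintype.sum_sum_type, Sum.elim_inl, Sum.elim_inr, ← add_assoc]
  refine congrArg₂ _ (congrArg₂ _ ?_ ?_) ?_ <;>
    exact Finset.sum_congr rfl fun _ _ => by ring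

theorem integral_gaussPath_mul (s t : I) (q r : Fin 2) :
    ∫ x, (gaussPath n p Finset.univ x).1 s q * (gaussPath n p Finset.univ x).1 t r
        ∂Measure.pi (coordLaw p)
      = ∑ i, gaussCoeff n p (revealed n s) q i * gaussCoeff n p (revealed n t) r i := by
  have h := integral_sum_mul_sum (integrable_coordLaw (n := n) p)
    (Sum.elim 0 (gaussCoeff n p (revealed n s) q)) (Sum.elim 0 (gaussCoeff n p (revealed n t) r))
    (fun i _ => integral_id_coordLaw p i) (by
      rintro (i | i) hi
      · simp at hi
      · exact integral_sq_gauss p i)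
  simp only [gaussPath_apply]
  simpa [Fintype.sum_sum_type] using h

theorem hasGaussianLaw_gaussCoord :
    HasGaussianLaw (fun (x : Coord n → ℝ) (i : GaussCoord n) => x (.inr i))
      (Measure.pi (coordLaw p)) := by
  have h : iIndepFun (fun i (x : Coord n → ℝ) => x i) (Measure.pi (coordLaw p)) :=
    iIndepFun_pi (X := fun _ y => y) fun i => aemeasurable_id
  refine iIndepFun.hasGaussianLaw (fun i => ⟨?_⟩) (h.precomp (g := Sum.inr) Sum.inr_injective)
  have h1 : (Measure.pi (coordLaw p)).map (fun x : Coord n → ℝ => x (.inr i))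
      = gaussianReal 0 1 := (measurePreserving_eval (coordLaw (n := n) p) (.inr i)).map_eq
  rw [h1]
  infer_instance

theorem sum_gaussCoeff_mul (a b : ℕ) (q r : Fin 2) (hab : min a b ≤ n) :
    ∑ i, gaussCoeff n p a q i * gaussCoeff n p b r i
      = ((a : ℝ) - 2) * (b - 2) * (p * (1 - p) / (2 * (n : ℝ) ^ 4) *
          ((![1, 2 * (p : ℝ)] : Fin 2 → ℝ) q *
            (![1, 2 * (p : ℝ)] : Fin 2 → ℝ) r)
          + 1 / (n : ℝ) ^ 5 * ((![0, 1] : Fin 2 → ℝ) q *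
            (![0, 1] : Fin 2 → ℝ) r)) * numPairs n (min a b)
        + (((min a b : ℕ) : ℝ) - 2) * ((p * (1 - p)) ^ 2 / (2 * (n : ℝ) ^ 4)) *
          ((![0, 1] : Fin 2 → ℝ) q *
            (![0, 1] : Fin 2 → ℝ) r) * numPairs n (min a b) := by
  have hv : √((p : ℝ) * (1 - p)) * √((p : ℝ) * (1 - p)) = p * (1 - p) :=
    Real.mul_self_sqrt (variance_nonneg p)
  have hw : √(2 / (n : ℝ) ^ 5) * √(2 / (n : ℝ) ^ 5) = 2 / (n : ℝ) ^ 5 :=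
    Real.mul_self_sqrt (by positivity)
  simp only [gaussCoeff, Fintype.sum_sum_type, Sum.elim_inl, Sum.elim_inr]
  generalize √((p : ℝ) * (1 - p)) = τ at hv ⊢
  generalize √(2 / (n : ℝ) ^ 5) = ρ at hw ⊢
  generalize (![1, 2 * (p : ℝ)] : Fin 2 → ℝ) = u
  generalize (![0, 1] : Fin 2 → ℝ) = w
  have h1 : ∀ e : Sym2 (Fin n), τ * (((a : ℝ) - 2) / (n : ℝ) ^ 2 * edgeIn e a)
      * u q * (τ * (((b : ℝ) - 2) / (n : ℝ) ^ 2 * edgeIn e b) * u r)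
      = p * (1 - p) * (((a : ℝ) - 2) * (b - 2) / (n : ℝ) ^ 4 * (u q * u r))
        * edgeIn e (min a b) := fun e => by
    rw [← edgeIn_mul, ← hv]
    ring
  have h2 : ∀ s : Fin n × Fin n × Fin n, (p : ℝ) * (1 - p) * (1 / (n : ℝ) ^ 2 * starIn s a) * w q
      * ((p : ℝ) * (1 - p) * (1 / (n : ℝ) ^ 2 * starIn s b) * w r)
      = ((p : ℝ) * (1 - p)) ^ 2 / (n : ℝ) ^ 4 * (w q * w r) * starIn s (min a b) := fun s => by
    rw [← starIn_mul]
    ring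
  have h3 : ∀ e : Sym2 (Fin n), ρ * ((a : ℝ) - 2) * edgeIn e a * w q
      * (ρ * ((b : ℝ) - 2) * edgeIn e b * w r)
      = 2 / (n : ℝ) ^ 5 * (((a : ℝ) - 2) * (b - 2) * (w q * w r)) * edgeIn e (min a b) :=
    fun e => by
      rw [← edgeIn_mul, ← hw]
      ring
  rw [Finset.sum_congr rfl fun e _ => h1 e, Finset.sum_congr rfl fun s _ => h2 s,
    Finset.sum_congr rfl fun e _ => h3 e, ← Finset.mul_sum, ← Finset.mul_sum, ← Finset.mul_sum,
    sum_edgeIn, sum_starIn hab]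
  ring

theorem isPreLimit_gaussPath :
    IsPreLimit (Measure.pi (coordLaw (n := n) p)) n p (gaussPath n p Finset.univ) where
  piecewise_constant x s t h := by
    ext q
    rw [gaussPath_apply, gaussPath_apply, h]
  gaussian := by
    refine ⟨fun S => ?_⟩
    let L : (GaussCoord n → ℝ) →L[ℝ] (S → ℝ) := ContinuousLinearMap.pi fun z =>
      ∑ i, gaussCoeff n p (revealed n z.1.2) z.1.1 i • ContinuousLinearMap.proj i
    have h : (fun x : Coord n → ℝ => S.restrict fun z : Fin 2 × I =>
        (gaussPath n p Finset.univ x).1 z.2 z.1) = fun x => L fun i => x (.inr i) := by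
      funext x z
      simp [L, gaussPath_apply]
    rw [h]
    exact hasGaussianLaw_gaussCoord.map_fun L
  centred q t := by
    simp only [gaussPath_apply]
    rw [integral_finsetSum _ fun i _ => ((PolyGrowth.eval _).const_mul _).integrable
      (integrable_coordLaw p)]
    refine Finset.sum_eq_zero fun i _ => ?_
    rw [integral_const_mul, integral_eval (μ := coordLaw p) (Sum.inr i) (ψ := fun y => y)
      measurable_id, integral_id_coordLaw, mul_zero]
  cov_zero_zero s t := by
    rw [integral_gaussPath_mul, sum_gaussCoeff_mul _ _ _ _ (min_le_of_left_le (revealed_le n s)),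
      covD11_eq]
    simp
    ring
  cov_zero_one s t := by
    rw [integral_gaussPath_mul, sum_gaussCoeff_mul _ _ _ _ (min_le_of_left_le (revealed_le n s)),
      covD12_eq _ (revealed_le n t)]
    simp
    ring
  cov_one_one s t := by
    rw [integral_gaussPath_mul, sum_gaussCoeff_mul _ _ _ _ (min_le_of_left_le (revealed_le n s)),
      covD22_eq _ (revealed_le n s) (revealed_le n t)]
    simp
    ring

end Existence

end

/-! ### Uniqueness in law -/

noncomputable section

theorem integral_and_variance_apply_of_hasGaussianLaw {Ω κ : Type*} [MeasurableSpace Ω] [Fintype κ]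
    [DecidableEq κ] {P : Measure Ω} {X : Ω → κ → ℝ} (hX : HasGaussianLaw X P)
    (hX0 : ∀ i, ∫ ω, X ω i ∂P = 0) (L : StrongDual ℝ (κ → ℝ)) :
    ∫ ω, L (X ω) ∂P = 0 ∧ Var[fun ω => L (X ω); P]
      = ∑ i, ∑ j, L (Pi.single i 1) * L (Pi.single j 1) * ∫ ω, X ω i * X ω j ∂P := by
  have hL : ∀ ω, L (X ω) = ∑ i, L (Pi.single i 1) * X ω i := fun ω => by
    conv_lhs => rw [pi_eq_sum_univ' (X ω)]
    rw [map_sum]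
    refine Finset.sum_congr rfl fun i _ => ?_
    rw [map_smul, smul_eq_mul, mul_comm]
  have hc : ∀ i, HasGaussianLaw (fun ω => X ω i) P := fun i =>
    hX.map_fun (ContinuousLinearMap.proj i)
  have h1 : ∫ ω, L (X ω) ∂P = 0 := by
    simp only [hL]
    rw [integral_finsetSum _ fun i _ => (hc i).integrable.const_mul _]
    simp [integral_const_mul, hX0]
  refine ⟨h1, ?_⟩
  rw [variance_of_integral_eq_zero (hX.map_fun L).aemeasurable h1]
  have hi : ∀ i j, Integrable (fun ω => L (Pi.single i 1) * L (Pi.single j 1) *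
      (X ω i * X ω j)) P := fun i j =>
    ((hc i).memLp_two.integrable_mul (hc j).memLp_two).const_mul _
  have e : ∀ ω, L (X ω) ^ 2 = ∑ i, ∑ j, L (Pi.single i 1) * L (Pi.single j 1) *
      (X ω i * X ω j) := fun ω => by
    rw [hL, sq, Finset.sum_mul_sum]
    exact Finset.sum_congr rfl fun i _ => Finset.sum_congr rfl fun j _ => by ring
  simp only [e]
  rw [integral_finsetSum _ fun i _ => integrable_finsetSum _ fun j _ => hi i j]
  refine Finset.sum_congr rfl fun i _ => ?_
  rw [integral_finsetSum _ fun j _ => hi i j]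
  exact Finset.sum_congr rfl fun j _ => integral_const_mul _ _

/-- A centred Gaussian vector is determined by its covariances. -/
theorem map_eq_map_of_hasGaussianLaw {Ω Ω' κ : Type*} [MeasurableSpace Ω] [MeasurableSpace Ω']
    [Fintype κ] {P : Measure Ω} {P' : Measure Ω'} {X : Ω → κ → ℝ} {Y : Ω' → κ → ℝ}
    (hX : HasGaussianLaw X P) (hY : HasGaussianLaw Y P') (hX0 : ∀ i, ∫ ω, X ω i ∂P = 0)
    (hY0 : ∀ i, ∫ ω, Y ω i ∂P' = 0)
    (h : ∀ i j, ∫ ω, X ω i * X ω j ∂P = ∫ ω, Y ω i * Y ω j ∂P') : P.map X = P'.map Y := by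
  classical
  have := hX.isProbabilityMeasure
  have := hY.isProbabilityMeasure
  have := Measure.isProbabilityMeasure_map hX.aemeasurable
  have := Measure.isProbabilityMeasure_map hY.aemeasurable
  refine Measure.ext_of_charFunDual ?_
  ext L
  obtain ⟨h1, h2⟩ := integral_and_variance_apply_of_hasGaussianLaw hX hX0 L
  obtain ⟨h3, h4⟩ := integral_and_variance_apply_of_hasGaussianLaw hY hY0 L
  rw [hX.charFunDual_map_eq_fun, hY.charFunDual_map_eq_fun, h1, h2, h3, h4]
  simp only [h]

section Uniqueness

variable {n : ℕ}

/-- The first time at which `m` vertices are revealed. -/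
def gridTime (n : ℕ) (m : Fin (n + 1)) : I :=
  ⟨(m : ℝ) / n, by positivity, div_le_one_of_le₀ (by exact_mod_cast Nat.lt_succ_iff.1 m.2)
    (Nat.cast_nonneg _)⟩

theorem revealed_gridTime (hn : 1 ≤ n) (m : Fin (n + 1)) : revealed n (gridTime n m) = m := by
  have hn' : (n : ℝ) ≠ 0 := by positivity
  rw [revealed, gridTime]
  simp only
  rw [mul_div_cancel₀ _ hn', Nat.floor_natCast]

/-- The values of a path at the grid times. -/
def gridValues (n : ℕ) (w : SkorokhodD 2) (z : Fin 2 × Fin (n + 1)) : ℝ :=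
  w.1 (gridTime n z.2) z.1

/-- The path with given values at the grid times. -/
def ofGridValues (n : ℕ) : (Fin 2 × Fin (n + 1) → ℝ) →ₗ[ℝ] SkorokhodD 2 where
  toFun u := stepPath n fun m => WithLp.toLp 2 fun q => u (q, Fin.ofNat (n + 1) m)
  map_add' _ _ := rfl
  map_smul' _ _ := rfl

theorem continuous_ofGridValues (n : ℕ) : Continuous (ofGridValues n) :=
  LinearMap.continuous_of_finiteDimensional _

variable {Ω Ω' : Type*} [MeasurableSpace Ω] [MeasurableSpace Ω'] {P : Measure Ω}
  {P' : Measure Ω'} {p : ℝ} {D : Ω → SkorokhodD 2} {D' : Ω' → SkorokhodD 2}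

theorem IsPreLimit.eq_ofGridValues (hD : IsPreLimit P n p D) (hn : 1 ≤ n) (ω : Ω) :
    D ω = ofGridValues n (gridValues n (D ω)) := by
  refine Subtype.ext (lp.ext (funext fun t => ?_))
  have h : revealed n (gridTime n (Fin.ofNat (n + 1) (revealed n t))) = revealed n t := by
    rw [revealed_gridTime hn, Fin.val_ofNat, Nat.mod_eq_of_lt (Nat.lt_succ_of_le (revealed_le n t))]
  exact (hD.piecewise_constant ω _ _ h).symm

theorem IsPreLimit.hasGaussianLaw (hD : IsPreLimit P n p D) :
    HasGaussianLaw (fun ω => gridValues n (D ω)) P := by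
  let f : Fin 2 × Fin (n + 1) → Fin 2 × I := fun z => (z.1, gridTime n z.2)
  have h := (hD.gaussian.comp_right f).hasGaussianLaw Finset.univ
  let L : ({z // z ∈ (Finset.univ : Finset (Fin 2 × Fin (n + 1)))} → ℝ) →L[ℝ] (Fin 2 × Fin (n + 1) → ℝ) :=
    ContinuousLinearMap.pi fun z => ContinuousLinearMap.proj ⟨z, Finset.mem_univ z⟩
  exact h.map_fun L

theorem IsPreLimit.map_eq_map (hD : IsPreLimit P n p D) (hD' : IsPreLimit P' n p D') :
    P.map (fun ω => gridValues n (D ω)) = P'.map (fun ω => gridValues n (D' ω)) := by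
  refine map_eq_map_of_hasGaussianLaw hD.hasGaussianLaw hD'.hasGaussianLaw
    (fun z => hD.centred _ _) (fun z => hD'.centred _ _) ?_
  rintro ⟨q, i⟩ ⟨r, j⟩
  simp only [gridValues]
  fin_cases q <;> fin_cases r
  · exact (hD.cov_zero_zero _ _).trans (hD'.cov_zero_zero _ _).symm
  · exact (hD.cov_zero_one _ _).trans (hD'.cov_zero_one _ _).symm
  · simp only [mul_comm (((D _).1 (gridTime n i)) _), mul_comm (((D' _).1 (gridTime n i)) _)]
    exact (hD.cov_zero_one _ _).trans (hD'.cov_zero_one _ _).symm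
  · exact (hD.cov_one_one _ _).trans (hD'.cov_one_one _ _).symm

theorem IsPreLimit.integral_eq (hD : IsPreLimit P n p D) (hD' : IsPreLimit P' n p D')
    (hn : 1 ≤ n) {g : SkorokhodD 2 → ℝ} (hg : Continuous g) :
    ∫ ω, g (D ω) ∂P = ∫ ω, g (D' ω) ∂P' := by
  have hc := hg.comp (continuous_ofGridValues n)
  have e : ∀ ω, g (D ω) = (g ∘ ofGridValues n) (gridValues n (D ω)) := fun ω =>
    congrArg g (hD.eq_ofGridValues hn ω)
  have e' : ∀ ω, g (D' ω) = (g ∘ ofGridValues n) (gridValues n (D' ω)) := fun ω =>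
    congrArg g (hD'.eq_ofGridValues hn ω)
  simp only [e, e']
  rw [← integral_map hD.hasGaussianLaw.aemeasurable hc.aestronglyMeasurable,
    ← integral_map hD'.hasGaussianLaw.aemeasurable hc.aestronglyMeasurable, hD.map_eq_map hD']

theorem IsPreLimit.integrable_iff (hD : IsPreLimit P n p D) (hD' : IsPreLimit P' n p D')
    (hn : 1 ≤ n) {g : SkorokhodD 2 → ℝ} (hg : Continuous g) :
    Integrable (fun ω => g (D ω)) P ↔ Integrable (fun ω => g (D' ω)) P' := by
  have hc := hg.comp (continuous_ofGridValues n)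
  have e : (fun ω => g (D ω)) = (g ∘ ofGridValues n) ∘ fun ω => gridValues n (D ω) :=
    funext fun ω => congrArg g (hD.eq_ofGridValues hn ω)
  have e' : (fun ω => g (D' ω)) = (g ∘ ofGridValues n) ∘ fun ω => gridValues n (D' ω) :=
    funext fun ω => congrArg g (hD'.eq_ofGridValues hn ω)
  rw [e, e', ← integrable_map_measure hc.aestronglyMeasurable hD.hasGaussianLaw.aemeasurable,
    ← integrable_map_measure hc.aestronglyMeasurable hD'.hasGaussianLaw.aemeasurable,
    hD.map_eq_map hD']

end Uniqueness

end

theorem mainTheorem4 (n : ℕ) (hn : 1 ≤ n) (p : I) :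
    -- the pre-limiting Gaussian process exists
    (∃ (Ω' : Type) (_ : MeasurableSpace Ω') (P' : Measure Ω') (_ : IsProbabilityMeasure P')
      (D : Ω' → SkorokhodD 2), IsPreLimit P' n p D) ∧
    -- and its distance from the graph process is at most `12 ‖g‖ / n`
    ∀ {Ω : Type*} [MeasurableSpace Ω] (P : Measure Ω) [IsProbabilityMeasure P]
      (G : Ω → SimpleGraph (Fin n)) (_ : HasLaw G (SimpleGraph.binomialRandom (Fin n) p) P)
      {Ω' : Type*} [MeasurableSpace Ω'] (P' : Measure Ω') [IsProbabilityMeasure P']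
      (D : Ω' → SkorokhodD 2) (_ : IsPreLimit P' n p D)
      (g : SkorokhodD 2 → ℝ) (_ : MemM2 g),
      Integrable (fun ω => g (graphProcess P G ω)) P ∧
      Integrable (fun ω => g (D ω)) P' ∧
      |(∫ ω, g (graphProcess P G ω) ∂P) - ∫ ω, g (D ω) ∂P'| ≤ 12 * normM2 g / n := by
  refine ⟨⟨Coord n → ℝ, inferInstance, Measure.pi (coordLaw p), inferInstance,
    gaussPath n p Finset.univ, isPreLimit_gaussPath⟩, ?_⟩
  intro Ω _ P _ G hG Ω' _ P' _ D hD g hg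
  obtain ⟨c, k, hc, hk, hck, hL⟩ := hg.hasLipschitzHessian
  refine ⟨integrable_graphProcess hG g, ?_, ?_⟩
  · exact (hD.integrable_iff isPreLimit_gaussPath hn hL.continuous).2
      ((hL.polyGrowth (polyGrowth_gaussPath Finset.univ)).integrable (integrable_coordLaw p))
  · rw [integral_graphProcess hG, hD.integral_eq isPreLimit_gaussPath hn hL.continuous]
    refine (abs_integral_mixedPath_sub_gaussPath_le hL hc hk hn).trans ?_
    gcongr
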